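/- **Setting.** All objects are smooth; metrics may be indefinite. Let $(M,I,\omega,\nabla)$ be an affine special Kähler manifold: $(M,I,\omega)$ is pseudo-Kähler (with metric $\omega(-,I-)$), and $\nabla$ is a flat torsion-free connection on $TM$ with $\nabla\omega=0$ and $\mathrm d_\nabla I=0$. Let $\pi:N=TM\to M$ be the projection, $V_\pi=\ker \mathrm d\pi$, $\mathcal H:\pi^*(TM)\to TN$ the Ehresmann connection induced by the parallel transport of $\nabla$, and $\nu:\pi^*(TM)\to V_\pi$ the canonical identification; both are extended complex-linearly. Let $\omega^\nu$ be the symplectic form on $V_\pi$ that corresponds to $\omega$ under $\nu$. For a function $f$ on a fibre of $\pi$ let $\mathrm{Ham}_f$ be the vertical vector field with $Vf=\omega^\nu(V,\mathrm{Ham}_f)$ for vertical $V$. For $X\in T_pM\otimes\mathbb C$, the functions $\mathcal H_XJ$ and $\nu_XJ$ on $T_pM$ are obtained by applying $\mathcal H$ and $\nu$ to the constant vector $X$ along the fibre $T_pM$. An *almost special Joyce structure* is given by a complex-linear bundle map $h:\pi^*(T^{1,0}M)\to TN\otimes\mathbb C$ and an antilinear bundle map $v:\pi^*(T^{1,0}M)\to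 V_\pi\otimes\mathbb C$ such that $$TN\otimes\mathbb C=\mathrm{Im}\,h\oplus\mathrm{Im}\,\overline h\oplus\mathrm{Im}\,v\oplus\mathrm{Im}\,\overline v,\qquad \mathrm d\pi(h_X)=X,$$ and such that for some smooth $J:N\to\mathbb C$ $$h_X=\mathcal H_X+\mathrm{Ham}_{\mathcal H_XJ},\qquad v_X=2\pi\mathrm i\,(\nu_{\overline X}+\mathrm{Ham}_{\nu_{\overline X}J}),\qquad X\in\pi^*(T^{1,0}M).$$ It defines for $\zeta\in\mathbb C^\times$ the complex-linear map $\mathcal A^\zeta:\pi^*(TM)\otimes\mathbb C\to TN\otimes\mathbb C$ with $\mathcal A^\zeta_X=h_X-\zeta^{-1}\overline{v_X}$ and $\mathcal A^\zeta_{\overline X}=\overline{h_X}+\zeta v_X$ for $X\in \pi^*(T^{1,0}M)$, and also $\mathcal A^0$ with $\mathcal A^0_X=-\overline{v_X}$, $\mathcal A^0_{\overline X}=\overline{h_X}$. Let $I_1,I_2,I_3$ be the almost complex structures on $N$ whose $-\mathrm i$-eigenbundle is $\mathrm{Im}\,\mathcal A^\zeta$ for $\zeta=\mathrm i,-1,0$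 respectively. The structure is a *special Joyce structure* if $\mathrm{Im}\,\mathcal A^\zeta$ is involutive for every $\zeta\in\mathbb C^\times$, and $\omega^\nu$ is of type $(1,1)$ with respect to $I_3|_{V_\pi}$. **Theorem.** Let a special Joyce structure over $(M,I,\omega,\nabla)$ be given. There is a unique real 2-form $\omega_3$ on $N$ with $$\omega_3(v_X,\overline{v_Y})=\omega_3(h_Y,\overline{h_X})=-\frac1{4\pi^2}\,\omega^\nu(v_X,\overline{v_Y}),\qquad X,Y\in\pi^*(T^{1,0}M),$$ and with all other pairings between $h_X,\overline{h_X},v_X,\overline{v_X}$ equal to zero. With $g:=\omega_3(-,I_3-)$, the tuple $(N,g,I_1,I_2,I_3)$ is pseudo-hyperkähler: $g$ is a pseudo-Riemannian metric, $I_1,I_2,I_3$ are integrable complex structures that preserve $g$ and satisfy $I_1I_2=I_3$ and $I_iI_j=-I_jI_i$ for $i\ne j$, and the 2-forms $\omega_i=g(I_i-,-)$, $i=1,2,3$, are closed. -/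

import Mathlib

open Bundle
open scoped Manifold ContDiff TensorProduct

noncomputable section

namespace SpecialJoyce

/-! ### Complexification of a real vector space -/

section Complexification

variable {V : Type*} [AddCommGroup V] [Module ℝ V]

/-- Complex conjugation `z ⊗ v ↦ z̄ ⊗ v` on `V ⊗ ℂ`. -/
def conj : ℂ ⊗[ℝ] V →ₛₗ[starRingEnd ℂ] ℂ ⊗[ℝ] V where
  toFun := LinearMap.rTensor V Complex.conjAe.toLinearMap
  map_add' := map_add _
  map_smul' c x := by
    induction x using TensorProduct.induction_on with
    | zero => simp
    | tmul z v => simp [TensorProduct.smul_tmul']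
    | add x y hx hy => simp only [smul_add, map_add, hx, hy]

/-- The real part `V ⊗ ℂ → V`. -/
def rePart : ℂ ⊗[ℝ] V →ₗ[ℝ] V :=
  (TensorProduct.lid ℝ V).toLinearMap ∘ₗ LinearMap.rTensor V Complex.reLm

/-- The imaginary part `V ⊗ ℂ → V`. -/
def imPart : ℂ ⊗[ℝ] V →ₗ[ℝ] V :=
  (TensorProduct.lid ℝ V).toLinearMap ∘ₗ LinearMap.rTensor V Complex.imLm

/-- The complex vector `a + i b`. -/
def mkC (a b : V) : ℂ ⊗[ℝ] V := (1 : ℂ) ⊗ₜ[ℝ] a + Complex.I ⊗ₜ[ℝ] b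

/-- The real endomorphism of `V` whose complexification has `D` as its `-i`-eigenspace and the
conjugate of `D` as its `i`-eigenspace, for `D` with `V ⊗ ℂ = D ⊕ D̄` (and `0` for other `D`):
a real vector is uniquely `d + d̄` with `d ∈ D`, and is sent to `-i d + i d̄ = 2 Im d`. -/
def almostComplexOf (D : Submodule ℂ (ℂ ⊗[ℝ] V)) : V →ₗ[ℝ] V :=
  open scoped Classical in
  if h : IsCompl D (D.map conj) then
    (2 : ℝ) • (imPart ∘ₗ (D.projection (D.map conj) h).restrictScalars ℝ ∘ₗ
      TensorProduct.mk ℝ ℂ V 1)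
  else 0

/-- The `i`-eigenspace `V^{1,0}` of (the complexification of) a real endomorphism. -/
abbrev holPart (I : V →ₗ[ℝ] V) : Submodule ℂ (ℂ ⊗[ℝ] V) :=
  Module.End.eigenspace (I.baseChange ℂ) Complex.I

/-- The projection `(1 - i I) / 2` of `V ⊗ ℂ` onto `V^{1,0}`, for `I² = -1`. -/
def projHol (I : V →ₗ[ℝ] V) (hI : ∀ u, I (I u) = -u) : ℂ ⊗[ℝ] V →ₗ[ℂ] holPart I :=
  LinearMap.codRestrict (holPart I)
    ((1 / 2 : ℂ) • (LinearMap.id - Complex.I • I.baseChange ℂ)) (by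
      intro w
      have h : I.baseChange ℂ (I.baseChange ℂ w) = -w := by
        induction w using TensorProduct.induction_on with
        | zero => simp
        | tmul z v => simp [hI, TensorProduct.tmul_neg]
        | add x y hx hy => simp only [map_add, hx, hy, neg_add]
      rw [Module.End.mem_eigenspace_iff]
      simp only [LinearMap.smul_apply, LinearMap.sub_apply, LinearMap.id_apply, map_smul, map_sub,
        h, smul_sub, smul_neg, smul_smul]
      have h2 : Complex.I * (1 / 2 * Complex.I) = -(1 / 2) := by
        linear_combination (1 / 2 : ℂ) * Complex.I_mul_I
      rw [h2]
      module)

/-- For a nondegenerate form `b` on `V` and a complex covector `ℓ` on `V`, the unique vector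
`u ∈ V ⊗ ℂ` with `ℓ(w) = b(w, u)` for all `w ∈ V`. -/
def sharp [FiniteDimensional ℝ V] (b : LinearMap.BilinForm ℝ V) (hb : b.Nondegenerate)
    (ℓ : V →ₗ[ℝ] ℂ) : ℂ ⊗[ℝ] V :=
  mkC ((b.flip.toDual hb.flip).symm (Complex.reLm ∘ₗ ℓ))
    ((b.flip.toDual hb.flip).symm (Complex.imLm ∘ₗ ℓ))

end Complexification

/-! ### Vector fields and tensors on a manifold

All identities between vector fields and tensors are tested on vector fields which are smooth on
an open set `U`, at the points of `U`. -/

section Tensors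

variable {F : Type*} [NormedAddCommGroup F] [NormedSpace ℝ F]
  {H : Type*} [TopologicalSpace H] (I : ModelWithCorners ℝ F H)
  {X : Type*} [TopologicalSpace X] [ChartedSpace H X] [IsManifold I ∞ X]

/-- The vector field `A` is smooth on `U`. -/
def SmoothField (U : Set X) (A : ∀ p : X, TangentSpace I p) : Prop :=
  ContMDiffOn I I.tangent ∞ (fun p => (⟨p, A p⟩ : TangentBundle I X)) U

/-- A field of endomorphisms of the tangent spaces is smooth: it maps smooth local vector fields
to smooth ones. -/
def SmoothEndo (K : ∀ p : X, TangentSpace I p →ₗ[ℝ] TangentSpace I p) : Prop :=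
  ∀ (U : Set X) (A : ∀ p : X, TangentSpace I p), IsOpen U → SmoothField I U A →
    SmoothField I U (fun p => K p (A p))

/-- A field of bilinear forms on the tangent spaces is smooth: it maps pairs of smooth local
vector fields to smooth functions. -/
def SmoothForm (b : ∀ p : X, LinearMap.BilinForm ℝ (TangentSpace I p)) : Prop :=
  ∀ (U : Set X) (A B : ∀ p : X, TangentSpace I p), IsOpen U → SmoothField I U A →
    SmoothField I U B → ContMDiffOn I 𝓘(ℝ, ℝ) ∞ (fun p => b p (A p) (B p)) U

/-- `b` is a closed 2-form: it is smooth and alternating, and `db(A, B, C) = 0` for all local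
vector fields, where `db(A, B, C) = A b(B,C) - B b(A,C) + C b(A,B) - b([A,B],C) + b([A,C],B)
- b([B,C],A)`. -/
structure IsClosedTwoForm (b : ∀ p : X, LinearMap.BilinForm ℝ (TangentSpace I p)) : Prop where
  smooth : SmoothForm I b
  alt : ∀ p, (b p).IsAlt
  closed : ∀ (U : Set X) (A B C : ∀ p : X, TangentSpace I p), IsOpen U → SmoothField I U A →
    SmoothField I U B → SmoothField I U C → ∀ p ∈ U,
      mvfderiv I (fun q => b q (B q) (C q)) p (A p)
        - mvfderiv I (fun q => b q (A q) (C q)) p (B p)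
        + mvfderiv I (fun q => b q (A q) (B q)) p (C p)
        - b p (VectorField.mlieBracket I A B p) (C p)
        + b p (VectorField.mlieBracket I A C p) (B p)
        - b p (VectorField.mlieBracket I B C p) (A p) = 0

/-- `K` is an integrable almost complex structure: it is smooth, `K² = -1`, and its Nijenhuis
tensor `[KA, KB] - K[KA, B] - K[A, KB] - [A, B]` vanishes. -/
structure IsComplexStructure (K : ∀ p : X, TangentSpace I p →ₗ[ℝ] TangentSpace I p) : Prop where
  smooth : SmoothEndo I K
  sq : ∀ p u, K p (K p u) = -u
  integrable : ∀ (U : Set X) (A B : ∀ p : X, TangentSpace I p), IsOpen U → SmoothField I U A →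
    SmoothField I U B → ∀ p ∈ U,
      VectorField.mlieBracket I (fun q => K q (A q)) (fun q => K q (B q)) p
        - K p (VectorField.mlieBracket I (fun q => K q (A q)) B p)
        - K p (VectorField.mlieBracket I A (fun q => K q (B q)) p)
        - VectorField.mlieBracket I A B p = 0

/-- `(K, σ)` is a pseudo-Kähler structure: `K` is a complex structure and `σ` is a symplectic
form preserved by `K`. The metric `σ(-, K-)` may be indefinite. -/
structure IsPseudoKahler (K : ∀ p : X, TangentSpace I p →ₗ[ℝ] TangentSpace I p)
    (σ : ∀ p : X, LinearMap.BilinForm ℝ (TangentSpace I p)) : Prop where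
  complex : IsComplexStructure I K
  closed : IsClosedTwoForm I σ
  nondegenerate : ∀ p, (σ p).Nondegenerate
  compatible : ∀ p u w, σ p (K p u) (K p w) = σ p u w

/-- `(g, I₁, I₂, I₃)` is a pseudo-hyperkähler structure: `g` is a pseudo-Riemannian metric, the
`Iᵢ` are complex structures which satisfy the quaternion relations and preserve `g`, and the
2-forms `g(Iᵢ-, -)` are closed. -/
structure IsPseudoHyperkahler (g : ∀ p : X, LinearMap.BilinForm ℝ (TangentSpace I p))
    (I₁ I₂ I₃ : ∀ p : X, TangentSpace I p →ₗ[ℝ] TangentSpace I p) : Prop where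
  metric_smooth : SmoothForm I g
  metric_symm : ∀ p u w, g p u w = g p w u
  metric_nondegenerate : ∀ p, (g p).Nondegenerate
  complex₁ : IsComplexStructure I I₁
  complex₂ : IsComplexStructure I I₂
  complex₃ : IsComplexStructure I I₃
  mul_one_two : ∀ p u, I₁ p (I₂ p u) = I₃ p u
  anti_one_two : ∀ p u, I₁ p (I₂ p u) = -I₂ p (I₁ p u)
  anti_two_three : ∀ p u, I₂ p (I₃ p u) = -I₃ p (I₂ p u)
  anti_three_one : ∀ p u, I₃ p (I₁ p u) = -I₁ p (I₃ p u)
  hermitian₁ : ∀ p u w, g p (I₁ p u) (I₁ p w) = g p u w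
  hermitian₂ : ∀ p u w, g p (I₂ p u) (I₂ p w) = g p u w
  hermitian₃ : ∀ p u w, g p (I₃ p u) (I₃ p w) = g p u w
  closed₁ : IsClosedTwoForm I (fun p => (g p).compLeft (I₁ p))
  closed₂ : IsClosedTwoForm I (fun p => (g p).compLeft (I₂ p))
  closed₃ : IsClosedTwoForm I (fun p => (g p).compLeft (I₃ p))

/-- A complex vector field, i.e. a section of `TX ⊗ ℂ`, is smooth on `U`. -/
def SmoothComplexField (U : Set X) (A : ∀ p : X, ℂ ⊗[ℝ] TangentSpace I p) : Prop :=
  SmoothField I U (fun p => rePart (A p)) ∧ SmoothField I U (fun p => imPart (A p))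

/-- The complex-bilinear extension of the Lie bracket to complex vector fields. -/
def complexBracket (A B : ∀ p : X, ℂ ⊗[ℝ] TangentSpace I p) (p : X) :
    ℂ ⊗[ℝ] TangentSpace I p :=
  mkC
    (VectorField.mlieBracket I (fun q => rePart (A q)) (fun q => rePart (B q)) p
      - VectorField.mlieBracket I (fun q => imPart (A q)) (fun q => imPart (B q)) p)
    (VectorField.mlieBracket I (fun q => rePart (A q)) (fun q => imPart (B q)) p
      + VectorField.mlieBracket I (fun q => imPart (A q)) (fun q => rePart (B q)) p)

/-- A complex distribution `D ⊂ TX ⊗ ℂ` is involutive: the bracket of two local sections of `D`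
is a local section of `D`. -/
def IsInvolutive (D : ∀ p : X, Submodule ℂ (ℂ ⊗[ℝ] TangentSpace I p)) : Prop :=
  ∀ (U : Set X) (A B : ∀ p : X, ℂ ⊗[ℝ] TangentSpace I p), IsOpen U →
    SmoothComplexField I U A → SmoothComplexField I U B →
    (∀ p ∈ U, A p ∈ D p) → (∀ p ∈ U, B p ∈ D p) → ∀ p ∈ U, complexBracket I A B p ∈ D p

end Tensors

/-! ### The tangent bundle -/

section TangentBundle

variable {E : Type*} [NormedAddCommGroup E] [NormedSpace ℝ E]
  {M : Type*} [TopologicalSpace M] [ChartedSpace E M]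

instance [FiniteDimensional ℝ E] (p : M) : FiniteDimensional ℝ (TangentSpace 𝓘(ℝ, E) p) :=
  inferInstanceAs (FiniteDimensional ℝ E)

variable [IsManifold 𝓘(ℝ, E) ∞ M]

instance [FiniteDimensional ℝ E] (p : TangentBundle 𝓘(ℝ, E) M) :
    FiniteDimensional ℝ (TangentSpace (𝓘(ℝ, E)).tangent p) :=
  inferInstanceAs (FiniteDimensional ℝ (E × E))

/-- The differential at `V` of the projection `π : TM → M`. -/
def dproj (V : TangentBundle 𝓘(ℝ, E) M) :
    TangentSpace (𝓘(ℝ, E)).tangent V →ₗ[ℝ] TangentSpace 𝓘(ℝ, E) V.proj :=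
  (mfderiv (𝓘(ℝ, E)).tangent 𝓘(ℝ, E) (fun W : TangentBundle 𝓘(ℝ, E) M => W.proj) V).toLinearMap

/-- The vertical space at `V`, the kernel of `dπ`. -/
abbrev vert (V : TangentBundle 𝓘(ℝ, E) M) :
    Submodule ℝ (TangentSpace (𝓘(ℝ, E)).tangent V) :=
  LinearMap.ker (dproj V)

/-- The inclusion of the fibre over `p` into `TM`, with the fibre seen as the model space. -/
def fibreIncl (p : M) (w : E) : TangentBundle 𝓘(ℝ, E) M := ⟨p, w⟩

/-- The vector part of an element of `TM`, seen in the model space. -/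
def vecPart (V : TangentBundle 𝓘(ℝ, E) M) : E := V.2

/-- The differential at `V` of the inclusion of the fibre through `V`, that is, the map which
sends `W` to the velocity at `t = 0` of the curve `V + t W`. -/
def vertLift (V : TangentBundle 𝓘(ℝ, E) M) :
    TangentSpace 𝓘(ℝ, E) V.proj →ₗ[ℝ] TangentSpace (𝓘(ℝ, E)).tangent V :=
  (mfderiv 𝓘(ℝ, E) (𝓘(ℝ, E)).tangent (fibreIncl V.proj) (vecPart V)).toLinearMap

/-- The differential at `p = π(V)` of a local section of `TM` with value `V` at `p`, namely the
one with constant coefficients in the trivialization of `TM` given by the chart at `p`. -/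
def extendDeriv (V : TangentBundle 𝓘(ℝ, E) M) :
    TangentSpace 𝓘(ℝ, E) V.proj →L[ℝ] TangentSpace (𝓘(ℝ, E)).tangent V :=
  mfderiv 𝓘(ℝ, E) (𝓘(ℝ, E)).tangent
    (fun q : M => (⟨q, FiberBundle.extend E V.2 q⟩ : TangentBundle 𝓘(ℝ, E) M)) V.proj

theorem trivializationAt_fibreIncl (p : M) (z : E) :
    ((trivializationAt E (TangentSpace 𝓘(ℝ, E)) p) (fibreIncl p z)).2 = z :=
  (tangentBundleCore 𝓘(ℝ, E) M).coordChange_self (achart E p) p (mem_chart_source E p) z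

theorem contMDiff_fibreIncl (p : M) : ContMDiff 𝓘(ℝ, E) (𝓘(ℝ, E)).tangent ∞
    (fibreIncl p : E → TangentBundle 𝓘(ℝ, E) M) := by
  intro w
  rw [Bundle.contMDiffAt_totalSpace]
  refine ⟨contMDiffAt_const, ?_⟩
  exact contMDiffAt_id.congr_of_eventuallyEq
    (Filter.Eventually.of_forall fun z => trivializationAt_fibreIncl p z)

theorem mdifferentiableAt_trivializationAt (V : TangentBundle 𝓘(ℝ, E) M) :
    MDifferentiableAt (𝓘(ℝ, E)).tangent 𝓘(ℝ, E)
      (fun W : TangentBundle 𝓘(ℝ, E) M =>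
        ((trivializationAt E (TangentSpace 𝓘(ℝ, E)) V.proj) W).2) V :=
  ((Bundle.contMDiffAt_totalSpace (n := ∞) (f := fun W : TangentBundle 𝓘(ℝ, E) M => W)
    (IM := (𝓘(ℝ, E)).tangent)).1 contMDiffAt_id).2.mdifferentiableAt (by simp)

theorem mdifferentiableAt_proj (V : TangentBundle 𝓘(ℝ, E) M) :
    MDifferentiableAt (𝓘(ℝ, E)).tangent 𝓘(ℝ, E)
      (fun W : TangentBundle 𝓘(ℝ, E) M => W.proj) V :=
  (Bundle.contMDiff_proj (n := ∞) (TangentSpace 𝓘(ℝ, E)) V).mdifferentiableAt (by simp)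

theorem dproj_vertLift (V : TangentBundle 𝓘(ℝ, E) M) (w : TangentSpace 𝓘(ℝ, E) V.proj) :
    dproj V (vertLift V w) = 0 := by
  have h2 := ((contMDiff_fibreIncl (E := E) V.proj).contMDiffAt
    (x := vecPart V)).mdifferentiableAt (by simp)
  have h3 : mfderiv 𝓘(ℝ, E) 𝓘(ℝ, E) (fun _ : E => V.proj) (vecPart V) =
      (mfderiv (𝓘(ℝ, E)).tangent 𝓘(ℝ, E)
        (fun W : TangentBundle 𝓘(ℝ, E) M => W.proj) V).comp
      (mfderiv 𝓘(ℝ, E) (𝓘(ℝ, E)).tangent (fibreIncl V.proj) (vecPart V)) :=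
    mfderiv_comp (vecPart V) (mdifferentiableAt_proj V) h2
  rw [mfderiv_const] at h3
  exact (DFunLike.congr_fun h3 w).symm

theorem vertLift_injective (V : TangentBundle 𝓘(ℝ, E) M) :
    Function.Injective (vertLift V) := by
  have h2 := ((contMDiff_fibreIncl (E := E) V.proj).contMDiffAt
    (x := vecPart V)).mdifferentiableAt (by simp)
  have h3 : mfderiv 𝓘(ℝ, E) 𝓘(ℝ, E) (fun z : E =>
      ((trivializationAt E (TangentSpace 𝓘(ℝ, E)) V.proj) (fibreIncl V.proj z)).2) (vecPart V) =
      (mfderiv (𝓘(ℝ, E)).tangent 𝓘(ℝ, E) (fun W : TangentBundle 𝓘(ℝ, E) M =>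
        ((trivializationAt E (TangentSpace 𝓘(ℝ, E)) V.proj) W).2) V).comp
      (mfderiv 𝓘(ℝ, E) (𝓘(ℝ, E)).tangent (fibreIncl V.proj) (vecPart V)) :=
    mfderiv_comp (vecPart V) (mdifferentiableAt_trivializationAt V) h2
  have h5 : (fun z : E => ((trivializationAt E (TangentSpace 𝓘(ℝ, E)) V.proj)
      (fibreIncl V.proj z)).2) = fun z => z := funext fun z => trivializationAt_fibreIncl V.proj z
  have h4 : mfderiv 𝓘(ℝ, E) 𝓘(ℝ, E) (fun z : E => z) (vecPart V) = _ := mfderiv_id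
  refine Function.LeftInverse.injective (g := fun u => mfderiv (𝓘(ℝ, E)).tangent 𝓘(ℝ, E)
    (fun W : TangentBundle 𝓘(ℝ, E) M =>
      ((trivializationAt E (TangentSpace 𝓘(ℝ, E)) V.proj) W).2) V u) ?_
  intro w
  refine (DFunLike.congr_fun h3 w).symm.trans ?_
  rw [h5]
  exact DFunLike.congr_fun h4 w

theorem dproj_extendDeriv (V : TangentBundle 𝓘(ℝ, E) M) (w : TangentSpace 𝓘(ℝ, E) V.proj) :
    dproj V (extendDeriv V w) = w := by
  have h2 := FiberBundle.mdifferentiableAt_extend 𝓘(ℝ, E) E V.2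
  have hV : (⟨V.proj, FiberBundle.extend E V.2 V.proj⟩ : TangentBundle 𝓘(ℝ, E) M) = V := by
    rw [FiberBundle.extend_apply_self]
  have h0 : HasMFDerivAt (𝓘(ℝ, E)).tangent 𝓘(ℝ, E)
      (fun W : TangentBundle 𝓘(ℝ, E) M => W.proj)
      (⟨V.proj, FiberBundle.extend E V.2 V.proj⟩ : TangentBundle 𝓘(ℝ, E) M)
      (mfderiv (𝓘(ℝ, E)).tangent 𝓘(ℝ, E)
        (fun W : TangentBundle 𝓘(ℝ, E) M => W.proj) V) := by
    have key : ∀ W : TangentBundle 𝓘(ℝ, E) M, W = V →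
        HasMFDerivAt (𝓘(ℝ, E)).tangent 𝓘(ℝ, E) (fun W : TangentBundle 𝓘(ℝ, E) M => W.proj) W
          (mfderiv (𝓘(ℝ, E)).tangent 𝓘(ℝ, E)
            (fun W : TangentBundle 𝓘(ℝ, E) M => W.proj) V) := by
      rintro _ rfl
      exact (mdifferentiableAt_proj _).hasMFDerivAt
    exact key _ hV
  have h3 := (h0.comp V.proj h2.hasMFDerivAt).mfderiv
  have h4 : mfderiv 𝓘(ℝ, E) 𝓘(ℝ, E) (fun z : M => z) V.proj = _ := mfderiv_id
  exact (DFunLike.congr_fun (h4.symm.trans h3) w).symm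

theorem range_vertLift [FiniteDimensional ℝ E] (V : TangentBundle 𝓘(ℝ, E) M) :
    LinearMap.range (vertLift V) = vert V := by
  apply Submodule.eq_of_le_of_finrank_eq
  · rintro _ ⟨w, rfl⟩
    exact dproj_vertLift V w
  · have h1 := LinearMap.finrank_range_of_inj (vertLift_injective V)
    have h2 := (dproj V).finrank_range_add_finrank_ker
    have h3 : LinearMap.range (dproj V) = ⊤ :=
      LinearMap.range_eq_top.2 fun w => ⟨_, dproj_extendDeriv V w⟩
    rw [h3, finrank_top] at h2
    have h4 : Module.finrank ℝ (TangentSpace (𝓘(ℝ, E)).tangent V) =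
        Module.finrank ℝ E + Module.finrank ℝ E :=
      Module.finrank_prod (R := ℝ) (M := E) (M' := E)
    have h5 : Module.finrank ℝ (TangentSpace 𝓘(ℝ, E) V.proj) = Module.finrank ℝ E := rfl
    change _ = Module.finrank ℝ (LinearMap.ker (dproj V))
    omega

/-- The canonical identification `ν` of `T_{π(V)} M` with the vertical space at `V`. -/
def nu [FiniteDimensional ℝ E] (V : TangentBundle 𝓘(ℝ, E) M) :
    TangentSpace 𝓘(ℝ, E) V.proj ≃ₗ[ℝ] vert V :=
  (LinearEquiv.ofInjective (vertLift V) (vertLift_injective V)).trans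
    (LinearEquiv.ofEq _ _ (range_vertLift V))

end TangentBundle

/-! ### Affine special Kähler manifolds and special Joyce structures -/

section Main

variable (E : Type*) [NormedAddCommGroup E] [NormedSpace ℝ E] [FiniteDimensional ℝ E]
  (M : Type*) [TopologicalSpace M] [ChartedSpace E M] [IsManifold 𝓘(ℝ, E) ∞ M]

/-- An affine special Kähler structure `(I, ω, ∇)` on `M`. The covariant derivative `∇_A B` at `p`
is `conn B p (A p)`. -/
structure AffineSpecialKahler where
  /-- the complex structure `I` -/
  cx : ∀ p : M, TangentSpace 𝓘(ℝ, E) p →ₗ[ℝ] TangentSpace 𝓘(ℝ, E) p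
  /-- the Kähler form `ω` -/
  form : ∀ p : M, LinearMap.BilinForm ℝ (TangentSpace 𝓘(ℝ, E) p)
  pseudoKahler : IsPseudoKahler 𝓘(ℝ, E) cx form
  /-- the connection `∇` on `TM` -/
  conn : CovariantDerivative 𝓘(ℝ, E) E (TangentSpace 𝓘(ℝ, E) : M → Type _)
  conn_smooth : CovariantDerivative.ContMDiffCovariantDerivative conn ∞
  torsionFree : conn.torsion = 0
  flat : ∀ (U : Set M) (A B C : ∀ p : M, TangentSpace 𝓘(ℝ, E) p), IsOpen U →
    SmoothField 𝓘(ℝ, E) U A → SmoothField 𝓘(ℝ, E) U B → SmoothField 𝓘(ℝ, E) U C → ∀ p ∈ U,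
      conn (fun q => conn C q (B q)) p (A p) - conn (fun q => conn C q (A q)) p (B p)
        - conn C p (VectorField.mlieBracket 𝓘(ℝ, E) A B p) = 0
  /-- `∇ω = 0` -/
  parallel : ∀ (U : Set M) (A B C : ∀ p : M, TangentSpace 𝓘(ℝ, E) p), IsOpen U →
    SmoothField 𝓘(ℝ, E) U A → SmoothField 𝓘(ℝ, E) U B → SmoothField 𝓘(ℝ, E) U C → ∀ p ∈ U,
      mvfderiv 𝓘(ℝ, E) (fun q => form q (B q) (C q)) p (A p)
        = form p (conn B p (A p)) (C p) + form p (B p) (conn C p (A p))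
  /-- `d_∇ I = 0`, where `(d_∇ I)(A, B) = ∇_A (I B) - ∇_B (I A) - I [A, B]` -/
  special : ∀ (U : Set M) (A B : ∀ p : M, TangentSpace 𝓘(ℝ, E) p), IsOpen U →
    SmoothField 𝓘(ℝ, E) U A → SmoothField 𝓘(ℝ, E) U B → ∀ p ∈ U,
      conn (fun q => cx q (B q)) p (A p) - conn (fun q => cx q (A q)) p (B p)
        - cx p (VectorField.mlieBracket 𝓘(ℝ, E) A B p) = 0

variable {E M}

namespace AffineSpecialKahler

variable (S : AffineSpecialKahler E M)

/-- The Ehresmann connection on `TM → M` induced by `∇`. For a local section `s` of `TM` with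
`s(p) = V` it sends `X ∈ T_p M` to `ds(X) - ν(∇_X s)`, which does not depend on `s`. In the
coordinates `(xⁱ, φⁱ)` on `TM` induced by the chart at `p` this is
`Xⁱ (∂/∂xⁱ - Vʲ Γᵏᵢⱼ ∂/∂φᵏ)`, the velocity of parallel transport of `V` in the direction `X`. -/
def horiz (V : TangentBundle 𝓘(ℝ, E) M) :
    TangentSpace 𝓘(ℝ, E) V.proj →ₗ[ℝ] TangentSpace (𝓘(ℝ, E)).tangent V :=
  (extendDeriv V).toLinearMap
    - vertLift V ∘ₗ (S.conn (FiberBundle.extend E V.2) V.proj).toLinearMap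

/-- The symplectic form `ω^ν` on the vertical space at `V`, induced by `ω` through `ν`. -/
def vertForm (V : TangentBundle 𝓘(ℝ, E) M) : LinearMap.BilinForm ℝ (vert V) :=
  (S.form V.proj).comp (nu V).symm.toLinearMap (nu V).symm.toLinearMap

/-- The vertical Hamiltonian vector field at `V` of a complex function `f` on the fibre through
`V`. It is determined by `df(w) = ω^ν(ν w, Ham_f)` for `w` in the fibre. -/
def ham (V : TangentBundle 𝓘(ℝ, E) M) (f : TangentSpace 𝓘(ℝ, E) V.proj → ℂ) :
    ℂ ⊗[ℝ] vert V :=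
  (nu V).toLinearMap.baseChange ℂ
    (sharp (S.form V.proj) (S.pseudoKahler.nondegenerate V.proj) (fderiv ℝ f V.2).toLinearMap)

/-- For `X ∈ T_p M ⊗ ℂ`, the function `Z ↦ ℋ_X J` at `Z`, on the fibre `T_p M`. -/
def horizDeriv (J : TangentBundle 𝓘(ℝ, E) M → ℂ) (p : M)
    (X : ℂ ⊗[ℝ] TangentSpace 𝓘(ℝ, E) p) (Z : TangentSpace 𝓘(ℝ, E) p) : ℂ :=
  LinearMap.liftBaseChange ℂ (mvfderiv (𝓘(ℝ, E)).tangent J ⟨p, Z⟩).toLinearMap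
    ((S.horiz ⟨p, Z⟩).baseChange ℂ X)

end AffineSpecialKahler

/-- For `X ∈ T_p M ⊗ ℂ`, the function `Z ↦ ν_X J` at `Z`, on the fibre `T_p M`. -/
def vertDeriv (J : TangentBundle 𝓘(ℝ, E) M → ℂ) (p : M)
    (X : ℂ ⊗[ℝ] TangentSpace 𝓘(ℝ, E) p) (Z : TangentSpace 𝓘(ℝ, E) p) : ℂ :=
  LinearMap.liftBaseChange ℂ (mvfderiv (𝓘(ℝ, E)).tangent J ⟨p, Z⟩).toLinearMap
    ((vertLift ⟨p, Z⟩).baseChange ℂ X)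

/-- The inclusion of `V_π ⊗ ℂ` into `T(TM) ⊗ ℂ`. -/
def vertIncl (V : TangentBundle 𝓘(ℝ, E) M) :
    ℂ ⊗[ℝ] vert V →ₗ[ℂ] ℂ ⊗[ℝ] TangentSpace (𝓘(ℝ, E)).tangent V :=
  (vert V).subtype.baseChange ℂ

/-- An almost special Joyce structure over an affine special Kähler manifold, given by the maps `h`
and `v` which determine the connections `𝒜^ζ`. -/
structure AlmostSpecialJoyce (S : AffineSpecialKahler E M) where
  /-- the complex-linear bundle map `h : π^*(T^{1,0}M) → T(TM) ⊗ ℂ` -/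
  h : ∀ V : TangentBundle 𝓘(ℝ, E) M,
    holPart (S.cx V.proj) →ₗ[ℂ] ℂ ⊗[ℝ] TangentSpace (𝓘(ℝ, E)).tangent V
  /-- the antilinear bundle map `v : π^*(T^{1,0}M) → V_π ⊗ ℂ` -/
  v : ∀ V : TangentBundle 𝓘(ℝ, E) M,
    holPart (S.cx V.proj) →ₛₗ[starRingEnd ℂ] ℂ ⊗[ℝ] vert V
  /-- `T(TM) ⊗ ℂ = Im h ⊕ Im h̄ ⊕ Im v ⊕ Im v̄` -/
  nondegenerate : ∀ V, DirectSum.IsInternal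
    ![LinearMap.range (h V), (LinearMap.range (h V)).map conj,
      LinearMap.range ((vertIncl V).comp (v V)),
      (LinearMap.range ((vertIncl V).comp (v V))).map conj]
  dproj_h : ∀ V X, (dproj V).baseChange ℂ (h V X) = X
  /-- `h_X = ℋ_X + Ham_{ℋ_X J}` and `v_X = 2πi (ν_X̄ + Ham_{ν_X̄ J})` for some smooth `J` -/
  exists_potential : ∃ J : TangentBundle 𝓘(ℝ, E) M → ℂ,
    ContMDiff (𝓘(ℝ, E)).tangent 𝓘(ℝ, ℂ) ∞ J ∧
    (∀ V X, h V X = (S.horiz V).baseChange ℂ X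
      + vertIncl V (S.ham V (S.horizDeriv J V.proj X))) ∧
    (∀ V X, v V X = (2 * (Real.pi : ℂ) * Complex.I) •
      ((nu V).toLinearMap.baseChange ℂ (conj X.1) + S.ham V (vertDeriv J V.proj (conj X.1))))

namespace AlmostSpecialJoyce

variable {S : AffineSpecialKahler E M} (𝒥 : AlmostSpecialJoyce S)

/-- The map `v` with values in `T(TM) ⊗ ℂ`. -/
def vN (V : TangentBundle 𝓘(ℝ, E) M) :
    holPart (S.cx V.proj) →ₛₗ[starRingEnd ℂ] ℂ ⊗[ℝ] TangentSpace (𝓘(ℝ, E)).tangent V :=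
  (vertIncl V).comp (𝒥.v V)

/-- The projection of `T_p M ⊗ ℂ` to `T^{1,0}_p M`. -/
def toHol (V : TangentBundle 𝓘(ℝ, E) M) :
    ℂ ⊗[ℝ] TangentSpace 𝓘(ℝ, E) V.proj →ₗ[ℂ] holPart (S.cx V.proj) :=
  projHol (S.cx V.proj) (S.pseudoKahler.complex.sq V.proj)

/-- The complexified Ehresmann connection `𝒜^ζ`, for `ζ ≠ 0`: the complex-linear map with
`𝒜^ζ_X = h_X - ζ⁻¹ v̄_X` and `𝒜^ζ_X̄ = h̄_X + ζ v_X` for `X ∈ T^{1,0}M`. -/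
def connection (ζ : ℂ) (V : TangentBundle 𝓘(ℝ, E) M) :
    ℂ ⊗[ℝ] TangentSpace 𝓘(ℝ, E) V.proj →ₗ[ℂ] ℂ ⊗[ℝ] TangentSpace (𝓘(ℝ, E)).tangent V :=
  (𝒥.h V - ζ⁻¹ • conj.comp (𝒥.vN V)).comp (toHol (S := S) V)
    + (conj.comp (𝒥.h V) + ζ • 𝒥.vN V).comp ((toHol (S := S) V).comp conj)

/-- The map `𝒜^0`, with `𝒜^0_X = -v̄_X` and `𝒜^0_X̄ = h̄_X` for `X ∈ T^{1,0}M`. -/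
def connectionZero (V : TangentBundle 𝓘(ℝ, E) M) :
    ℂ ⊗[ℝ] TangentSpace 𝓘(ℝ, E) V.proj →ₗ[ℂ] ℂ ⊗[ℝ] TangentSpace (𝓘(ℝ, E)).tangent V :=
  -(conj.comp (𝒥.vN V)).comp (toHol (S := S) V)
    + (conj.comp (𝒥.h V)).comp ((toHol (S := S) V).comp conj)

/-- `I₁`, the almost complex structure with `-i`-eigenspace `Im 𝒜^ζ` for `ζ = i`. -/
def I₁ (V : TangentBundle 𝓘(ℝ, E) M) :
    TangentSpace (𝓘(ℝ, E)).tangent V →ₗ[ℝ] TangentSpace (𝓘(ℝ, E)).tangent V :=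
  almostComplexOf (LinearMap.range (𝒥.connection Complex.I V))

/-- `I₂`, the almost complex structure with `-i`-eigenspace `Im 𝒜^ζ` for `ζ = -1`. -/
def I₂ (V : TangentBundle 𝓘(ℝ, E) M) :
    TangentSpace (𝓘(ℝ, E)).tangent V →ₗ[ℝ] TangentSpace (𝓘(ℝ, E)).tangent V :=
  almostComplexOf (LinearMap.range (𝒥.connection (-1) V))

/-- `I₃`, the almost complex structure with `-i`-eigenspace `Im 𝒜^ζ` for `ζ = 0`. -/
def I₃ (V : TangentBundle 𝓘(ℝ, E) M) :
    TangentSpace (𝓘(ℝ, E)).tangent V →ₗ[ℝ] TangentSpace (𝓘(ℝ, E)).tangent V :=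
  almostComplexOf (LinearMap.range (𝒥.connectionZero V))

/-- A special Joyce structure: an almost special Joyce structure for which `𝒜^ζ` is flat for each
`ζ ≠ 0`, and for which `ω^ν` is of type (1,1) with respect to the restriction of `I₃` to the
vertical bundle. -/
structure IsSpecialJoyce : Prop where
  flat : ∀ ζ : ℂ, ζ ≠ 0 →
    IsInvolutive (𝓘(ℝ, E)).tangent (fun V => LinearMap.range (𝒥.connection ζ V))
  type_one_one : ∀ V (a b a' b' : vert V),
    (a' : TangentSpace (𝓘(ℝ, E)).tangent V) = 𝒥.I₃ V a →
    (b' : TangentSpace (𝓘(ℝ, E)).tangent V) = 𝒥.I₃ V b →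
      S.vertForm V a' b' = S.vertForm V a b

/-- The complex-bilinear extension of `ω^ν` evaluated on `v_X` and `v̄_Y`, times `-1/(4π²)`. -/
def pairing (V : TangentBundle 𝓘(ℝ, E) M) (X Y : holPart (S.cx V.proj)) : ℂ :=
  -(1 / (4 * (Real.pi : ℂ) ^ 2)) *
    (S.vertForm V).baseChange ℂ (𝒥.v V X) (conj (𝒥.v V Y))

/-- `ω₃` is the real 2-form on `TM` with
`ω₃(v_X, v̄_Y) = ω₃(h_Y, h̄_X) = -1/(4π²) ω^ν(v_X, v̄_Y)`, all other pairings between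
`h`, `h̄`, `v`, `v̄` being zero (those not listed follow by skew-symmetry and conjugation). -/
structure IsOmegaThree
    (ω₃ : ∀ V : TangentBundle 𝓘(ℝ, E) M,
      LinearMap.BilinForm ℝ (TangentSpace (𝓘(ℝ, E)).tangent V)) : Prop where
  alt : ∀ V, (ω₃ V).IsAlt
  v_vbar : ∀ V X Y, (ω₃ V).baseChange ℂ (𝒥.vN V X) (conj (𝒥.vN V Y)) = 𝒥.pairing V X Y
  h_hbar : ∀ V X Y, (ω₃ V).baseChange ℂ (𝒥.h V Y) (conj (𝒥.h V X)) = 𝒥.pairing V X Y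
  h_h : ∀ V X Y, (ω₃ V).baseChange ℂ (𝒥.h V X) (𝒥.h V Y) = 0
  v_v : ∀ V X Y, (ω₃ V).baseChange ℂ (𝒥.vN V X) (𝒥.vN V Y) = 0
  h_v : ∀ V X Y, (ω₃ V).baseChange ℂ (𝒥.h V X) (𝒥.vN V Y) = 0
  h_vbar : ∀ V X Y, (ω₃ V).baseChange ℂ (𝒥.h V X) (conj (𝒥.vN V Y)) = 0

end AlmostSpecialJoyce

end Main

end SpecialJoyce

end

noncomputable section

namespace SpecialJoyce

/-! ### Closed 2-forms in coordinates -/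

section Coordinates

/-! The whole argument is carried out over ℝ. For a real vector w put X = (w - iIw)/2, R_w = 2 Re
h_X and V_w = 2 Re v_X. The decomposition of TN ⊗ ℂ makes (w, w') ↦ R_w + V_{w'} an isomorphism of
two copies of T_pM with the tangent space of N (`split`). Since h is complex-linear and v is
antilinear, 𝒜^i_w = R_w + i V_w and 𝒜^{±1}_w = R_w ± i V_{Iw}, and in the splitting I₁(w,w') = (-w',
w), I₂(w,w') = (-Iw', -Iw), I₃(w,w') = (Iw, -Iw'). With σ(w,u) = -ω^ν(V_w, V_u)/(4π²), the type
condition on ω^ν says that σ is I-invariant, and ω₃ has to be σ(w',u') - σ(w,u). The other two forms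
are ω₂ = σ(w',u) + σ(w,u') and ω₁ = σ(w',Iu) - σ(w,Iu'). Uniqueness of ω₃, the quaternion relations
and the invariance of g are then linear algebra at each point.

The analytic point is closedness. Let w ↦ R_w + i N_w be a complex connection with N_w vertical, and
let Ξ be the complex 2-form on N which restricts to ω^ν on vertical vectors and has the connection
in its kernel. Then dΞ vanishes: on three vertical vectors because ω^ν is constant along each fibre
in linear coordinates; on two vertical vectors and one lift because parallel transport preserves
ω^ν; and as soon as two arguments are lifts because the connection is involutive. Parallel transport
preserves ω^ν because ∇ω = 0, because I is constant along each fibre, and because the remaining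
terms of h and v are fibrewise Hamiltonian, so that their fibre derivatives are Hessians
(`fibreHam_symplectic`, `connRe_symplectic`, `connIm_symplectic`). In the chart of TM, involutivity
becomes two first-order equations (`IsChartConnection.flat`), and the cancellation in dΞ is
`extDerivTwo_real_algebra`.

The form -Ξ/(4π²) is ω₃ - iω₂ for ζ = i and ω₃ - iω₁ for ζ = 1, so all three forms are closed.
Integrability of each complex structure follows from closedness of the other two forms, by the
argument usually attributed to Hitchin (`isComplexStructure_of_closed`). -/

/-- The exterior derivative of the 2-form `β` on a normed space, at the point `z`. -/
def extDerivTwo {F : Type*} [NormedAddCommGroup F] [NormedSpace ℝ F]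
    (β : F → F →L[ℝ] F →L[ℝ] ℝ) (z a b c : F) : ℝ :=
  fderiv ℝ β z a b c - fderiv ℝ β z b a c + fderiv ℝ β z c a b

variable {E : Type*} [NormedAddCommGroup E] [NormedSpace ℝ E]

-- This is dΞ = 0 at one point, split into real and imaginary parts, with every derivative replaced
-- by an independent symbol: `O` stands for the derivative of `Ω` along the base, `R` and `M` for
-- those of `r` and `m`, and `D₁`, `D₂` for those of Re Ξ and Im Ξ. `hR` and `hM` say that parallel
-- transport is symplectic; `h₁` and `h₂` are the real and imaginary parts of the vanishing
-- curvature.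
set_option maxHeartbeats 1000000 in
theorem extDerivTwo_real_algebra (Ω : E →L[ℝ] E →L[ℝ] ℝ) (O : E →L[ℝ] E →L[ℝ] E →L[ℝ] ℝ)
    (r m : E →L[ℝ] E) (R M : E × E →L[ℝ] E →L[ℝ] E)
    (hR : ∀ w v v', O w v v' + Ω (R (0, v) w) v' - Ω (R (0, v') w) v = 0)
    (hM : ∀ w v v', Ω (M (0, v) w) v' = Ω (M (0, v') w) v)
    (h₁ : ∀ w w', R (w, r w) w' - R (w', r w') w = M (0, m w) w' - M (0, m w') w)
    (h₂ : ∀ w w', M (w, r w) w' - R (0, m w') w + R (0, m w) w' - M (w', r w') w = 0)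
    (D₁ D₂ : E × E → E × E → E × E → ℝ)
    (hD₁ : ∀ u a c, D₁ u a c = O u.1 (a.2 - r a.1) (c.2 - r c.1) - O u.1 (m a.1) (m c.1)
      - Ω (R u a.1) (c.2 - r c.1) + Ω (R u c.1) (a.2 - r a.1)
      - Ω (M u a.1) (m c.1) + Ω (M u c.1) (m a.1))
    (hD₂ : ∀ u a c, D₂ u a c = -O u.1 (a.2 - r a.1) (m c.1) - O u.1 (m a.1) (c.2 - r c.1)
      + Ω (R u a.1) (m c.1) + Ω (M u c.1) (a.2 - r a.1)
      - Ω (M u a.1) (c.2 - r c.1) - Ω (R u c.1) (m a.1))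
    (a b c : E × E) :
    D₁ a b c - D₁ b a c + D₁ c a b = 0 ∧ D₂ a b c - D₂ b a c + D₂ c a b = 0 := by
  -- Splitting each direction into its lift by `r` and a vertical rest brings the derivatives into
  -- the form in which they occur in the hypotheses.
  have key : ∀ (T : E × E →L[ℝ] E →L[ℝ] E) (u : E × E),
      T u = T (u.1, r u.1) + T (0, u.2 - r u.1) := fun T u => by
    rw [← map_add]; congr 1; ext <;> simp
  obtain ⟨a1, a2⟩ := a
  obtain ⟨b1, b2⟩ := b
  obtain ⟨c1, c2⟩ := c
  have e₁ : ∀ w w' v, Ω (R (w, r w) w') v - Ω (R (w', r w') w) v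
      = Ω (M (0, m w) w') v - Ω (M (0, m w') w) v := fun w w' v => by
    simpa using congrArg (fun x => Ω x v) (h₁ w w')
  have e₂ : ∀ w w' v, Ω (M (w, r w) w') v - Ω (R (0, m w') w) v + Ω (R (0, m w) w') v
      - Ω (M (w', r w') w) v = 0 := fun w w' v => by
    simpa using congrArg (fun x => Ω x v) (h₂ w w')
  simp only [hD₁, hD₂]
  rw [key R (a1, a2), key R (b1, b2), key R (c1, c2), key M (a1, a2), key M (b1, b2),
    key M (c1, c2)]
  dsimp only
  generalize a2 - r a1 = sa
  generalize b2 - r b1 = sb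
  generalize c2 - r c1 = sc
  simp only [add_apply, map_add]
  constructor
  -- Each hypothesis enters antisymmetrised in the three arguments. The vertical part of a vector
  -- with respect to the complex connection is `s - i m`, so the real part takes `hR` on the pairs
  -- (s, s) and (m, m), and the imaginary part takes it on the mixed pairs.
  · linear_combination hR a1 sb sc - hR b1 sa sc + hR c1 sa sb - hR a1 (m b1) (m c1)
      + hR b1 (m a1) (m c1) - hR c1 (m a1) (m b1) - e₁ a1 b1 sc + e₁ a1 c1 sb - e₁ b1 c1 sa
      - e₂ a1 b1 (m c1) + e₂ a1 c1 (m b1) - e₂ b1 c1 (m a1)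
      + hM a1 (m b1) sc - hM a1 (m c1) sb - hM b1 (m a1) sc + hM b1 (m c1) sa
      + hM c1 (m a1) sb - hM c1 (m b1) sa
  · linear_combination -hR a1 sb (m c1) - hR a1 (m b1) sc + hR b1 sa (m c1) + hR b1 (m a1) sc
      - hR c1 sa (m b1) - hR c1 (m a1) sb
      + e₁ a1 b1 (m c1) - e₁ a1 c1 (m b1) + e₁ b1 c1 (m a1)
      - e₂ a1 b1 sc + e₂ a1 c1 sb - e₂ b1 c1 sa
      + hM a1 sb sc - hM a1 (m b1) (m c1) - hM b1 sa sc + hM b1 (m a1) (m c1)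
      + hM c1 sa sb - hM c1 (m a1) (m b1)

/-- In finite dimension a choice of basis identifies `F →L[ℝ] G` with a finite power of `G`, so
smoothness may be checked on values. -/
theorem contDiffAt_clm_of_apply {D F G : Type*} [NormedAddCommGroup D] [NormedSpace ℝ D]
    [NormedAddCommGroup F] [NormedSpace ℝ F] [FiniteDimensional ℝ F]
    [NormedAddCommGroup G] [NormedSpace ℝ G] {n : ℕ∞ω} {f : D → F →L[ℝ] G} {z : D}
    (h : ∀ y, ContDiffAt ℝ n (fun x => f x y) z) : ContDiffAt ℝ n f z := by
  let d := Module.finrank ℝ F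
  let e₁ := ContinuousLinearEquiv.ofFinrankEq (𝕜 := ℝ) (Module.finrank_fin_fun ℝ (n := d)).symm
  let e₂ := (e₁.arrowCongr (1 : G ≃L[ℝ] G)).trans (ContinuousLinearEquiv.piRing (Fin d))
  rw [← Function.id_comp f, ← e₂.symm_comp_self]
  exact e₂.symm.contDiff.contDiffAt.comp z (contDiffAt_pi.mpr fun i => h _)

variable (Ω : E → E →L[ℝ] E →L[ℝ] ℝ) (r m : E × E → E →L[ℝ] E)

/-- The vertical part of a tangent vector with respect to the connection `w ↦ (w, r w)`. -/
def vertPart (r : E →L[ℝ] E) : E × E →L[ℝ] E :=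
  ContinuousLinearMap.snd ℝ E E - r.comp (ContinuousLinearMap.fst ℝ E E)

/-- The real part of the 2-form which restricts to `Ω` on the fibres and has the vectors
`(w, r w + i m w)` in its kernel. -/
def connFormRe (z : E × E) : E × E →L[ℝ] E × E →L[ℝ] ℝ :=
  (Ω z.1).bilinearComp (vertPart (r z)) (vertPart (r z))
    - (Ω z.1).bilinearComp ((m z).comp (ContinuousLinearMap.fst ℝ E E))
      ((m z).comp (ContinuousLinearMap.fst ℝ E E))

/-- The imaginary part of the 2-form which restricts to `Ω` on the fibres and has the vectors
`(w, r w + i m w)` in its kernel. -/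
def connFormIm (z : E × E) : E × E →L[ℝ] E × E →L[ℝ] ℝ :=
  -(Ω z.1).bilinearComp (vertPart (r z)) ((m z).comp (ContinuousLinearMap.fst ℝ E E))
    - (Ω z.1).bilinearComp ((m z).comp (ContinuousLinearMap.fst ℝ E E)) (vertPart (r z))

theorem connFormRe_apply (z a c : E × E) : connFormRe Ω r m z a c =
    Ω z.1 (a.2 - r z a.1) (c.2 - r z c.1) - Ω z.1 (m z a.1) (m z c.1) := rfl

theorem connFormIm_apply (z a c : E × E) : connFormIm Ω r m z a c =
    -Ω z.1 (a.2 - r z a.1) (m z c.1) - Ω z.1 (m z a.1) (c.2 - r z c.1) := rfl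

variable {Ω r m} [FiniteDimensional ℝ E] {z : E × E}

theorem contDiffAt_connFormRe {n : ℕ∞ω} (hΩ : ContDiffAt ℝ n Ω z.1) (hr : ContDiffAt ℝ n r z)
    (hm : ContDiffAt ℝ n m z) : ContDiffAt ℝ n (connFormRe Ω r m) z := by
  refine contDiffAt_clm_of_apply fun a => contDiffAt_clm_of_apply fun c => ?_
  simp only [connFormRe_apply]
  have hΩ' : ContDiffAt ℝ n (fun z : E × E => Ω z.1) z := hΩ.comp z contDiffAt_fst
  fun_prop

theorem contDiffAt_connFormIm {n : ℕ∞ω} (hΩ : ContDiffAt ℝ n Ω z.1) (hr : ContDiffAt ℝ n r z)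
    (hm : ContDiffAt ℝ n m z) : ContDiffAt ℝ n (connFormIm Ω r m) z := by
  refine contDiffAt_clm_of_apply fun a => contDiffAt_clm_of_apply fun c => ?_
  simp only [connFormIm_apply]
  have hΩ' : ContDiffAt ℝ n (fun z : E × E => Ω z.1) z := hΩ.comp z contDiffAt_fst
  fun_prop

theorem fderiv_clm_apply_apply {F : Type*} [NormedAddCommGroup F] [NormedSpace ℝ F]
    {β : F → F →L[ℝ] F →L[ℝ] ℝ} {z : F} (h : DifferentiableAt ℝ β z) (u a c : F) :
    fderiv ℝ β z u a c = fderiv ℝ (fun z => β z a c) z u := by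
  rw [(((h.hasFDerivAt.clm_apply (hasFDerivAt_const a z)).clm_apply
    (hasFDerivAt_const c z))).fderiv]
  simp

omit [FiniteDimensional ℝ E] in
theorem hasFDerivAt_comp_fst {G : Type*} [NormedAddCommGroup G] [NormedSpace ℝ G] {f : E → G}
    {z : E × E} (h : DifferentiableAt ℝ f z.1) : HasFDerivAt (fun z : E × E => f z.1)
      ((fderiv ℝ f z.1).comp (ContinuousLinearMap.fst ℝ E E)) z :=
  h.hasFDerivAt.comp z hasFDerivAt_fst

omit [FiniteDimensional ℝ E] in
set_option synthInstance.maxHeartbeats 400000 in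
set_option maxHeartbeats 1000000 in
/-- The 2-form which restricts to a form `Ω` on the fibres, and has an involutive complex
connection in its kernel whose parallel transport preserves `Ω`, is closed. -/
theorem extDerivTwo_connForm (hΩ : DifferentiableAt ℝ Ω z.1) (hr : DifferentiableAt ℝ r z)
    (hm : DifferentiableAt ℝ m z) (h1 : DifferentiableAt ℝ (connFormRe Ω r m) z)
    (h2 : DifferentiableAt ℝ (connFormIm Ω r m) z)
    (skew : ∀ v v', Ω z.1 v v' = -Ω z.1 v' v)
    (hR : ∀ w v v', fderiv ℝ Ω z.1 w v v' + Ω z.1 (fderiv ℝ r z (0, v) w) v'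
      + Ω z.1 v (fderiv ℝ r z (0, v') w) = 0)
    (hM : ∀ w v v', Ω z.1 (fderiv ℝ m z (0, v) w) v' + Ω z.1 v (fderiv ℝ m z (0, v') w) = 0)
    (h₁ : ∀ w w', fderiv ℝ r z (w, r z w) w' - fderiv ℝ r z (w', r z w') w
      = fderiv ℝ m z (0, m z w) w' - fderiv ℝ m z (0, m z w') w)
    (h₂ : ∀ w w', fderiv ℝ m z (w, r z w) w' - fderiv ℝ r z (0, m z w') w
      + fderiv ℝ r z (0, m z w) w' - fderiv ℝ m z (w', r z w') w = 0) (a b c : E × E) :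
    extDerivTwo (connFormRe Ω r m) z a b c = 0 ∧ extDerivTwo (connFormIm Ω r m) z a b c = 0 := by
  have hΩ' := hasFDerivAt_comp_fst (G := E →L[ℝ] E →L[ℝ] ℝ) hΩ
  have dr : ∀ w, HasFDerivAt (fun z => r z w) _ z :=
    fun w => hr.hasFDerivAt.clm_apply (hasFDerivAt_const w z)
  have dm : ∀ w, HasFDerivAt (fun z => m z w) _ z :=
    fun w => hm.hasFDerivAt.clm_apply (hasFDerivAt_const w z)
  have ds : ∀ a : E × E, HasFDerivAt (fun z => a.2 - r z a.1) _ z := fun a => (dr a.1).const_sub a.2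
  refine extDerivTwo_real_algebra (Ω z.1) (fderiv ℝ Ω z.1) (r z) (m z) (fderiv ℝ r z)
    (fderiv ℝ m z) (fun w v v' => ?_) (fun w v v' => ?_) h₁ h₂
    (fun u a c => fderiv ℝ (connFormRe Ω r m) z u a c)
    (fun u a c => fderiv ℝ (connFormIm Ω r m) z u a c) (fun u a c => ?_) (fun u a c => ?_) a b c
  · linear_combination hR w v v' - skew v (fderiv ℝ r z (0, v') w)
  · linear_combination hM w v v' - skew v (fderiv ℝ m z (0, v') w)
  · rw [fderiv_clm_apply_apply h1]
    simp only [connFormRe_apply]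
    rw [(((hΩ'.clm_apply (ds a)).clm_apply (ds c)).fun_sub
      ((hΩ'.clm_apply (dm a.1)).clm_apply (dm c.1))).fderiv]
    simp only [map_sub, add_apply, neg_apply, sub_apply, ContinuousLinearMap.comp_apply,
      ContinuousLinearMap.flip_apply, zero_apply, map_zero, ContinuousLinearMap.coe_fst', map_add,
      map_neg]
    linear_combination skew (r z a.1) (fderiv ℝ r z u c.1) - skew a.2 (fderiv ℝ r z u c.1)
      - skew (m z a.1) (fderiv ℝ m z u c.1)
  · rw [fderiv_clm_apply_apply h2]
    simp only [connFormIm_apply]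
    rw [(((hΩ'.clm_apply (ds a)).clm_apply (dm c.1)).fun_neg.fun_sub
      ((hΩ'.clm_apply (dm a.1)).clm_apply (ds c))).fderiv]
    simp only [map_sub, add_apply, neg_apply, sub_apply, ContinuousLinearMap.comp_apply,
      ContinuousLinearMap.flip_apply, zero_apply, map_zero, ContinuousLinearMap.coe_fst', map_add,
      map_neg]
    linear_combination skew (r z a.1) (fderiv ℝ m z u c.1) - skew a.2 (fderiv ℝ m z u c.1)
      + skew (m z a.1) (fderiv ℝ r z u c.1)

end Coordinates

/-! ### Tensors in charts -/

section Charts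

open VectorField Filter Topology

variable {F : Type*} [NormedAddCommGroup F] [NormedSpace ℝ F]
  {H : Type*} [TopologicalSpace H] (I : ModelWithCorners ℝ F H)
  {X : Type*} [TopologicalSpace X] [ChartedSpace H X] [IsManifold I ∞ X]

/-- The differential at `q` of the chart at `p`. -/
def chartDeriv (p q : X) : TangentSpace I q →L[ℝ] F :=
  (trivializationAt F (TangentSpace I) p).continuousLinearMapAt ℝ q

/-- The inverse of the differential at `q` of the chart at `p`. -/
def chartDerivSymm (p q : X) : F →L[ℝ] TangentSpace I q :=
  (trivializationAt F (TangentSpace I) p).symmL ℝ q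

/-- A vector field in the chart at `p`. -/
def chartField (p : X) (A : ∀ q : X, TangentSpace I q) (z : F) : F :=
  chartDeriv I p ((extChartAt I p).symm z) (A ((extChartAt I p).symm z))

variable {I} {p q : X}

theorem chartDeriv_symm (hq : q ∈ (chartAt H p).source) (a : F) :
    chartDeriv I p q (chartDerivSymm I p q a) = a :=
  (trivializationAt F (TangentSpace I) p).continuousLinearMapAt_symmL hq a

theorem chartDerivSymm_deriv (hq : q ∈ (chartAt H p).source) (v : TangentSpace I q) :
    chartDerivSymm I p q (chartDeriv I p q v) = v :=
  (trivializationAt F (TangentSpace I) p).symmL_continuousLinearMapAt hq v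

theorem chartDeriv_eq_mfderiv (hq : q ∈ (chartAt H p).source) :
    chartDeriv I p q = mfderiv I 𝓘(ℝ, F) (extChartAt I p) q :=
  TangentBundle.continuousLinearMapAt_trivializationAt hq

theorem chartDeriv_apply (hq : q ∈ (chartAt H p).source) (v : TangentSpace I q) :
    chartDeriv I p q v = ((trivializationAt F (TangentSpace I) p) ⟨q, v⟩).2 := by
  rw [chartDeriv, Trivialization.continuousLinearMapAt_apply,
    Trivialization.coe_linearMapAt_of_mem _ (by exact hq)]

theorem chartDeriv_self (v : TangentSpace I p) : chartDeriv I p p v = v := by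
  rw [chartDeriv_eq_mfderiv (mem_chart_source H p), mfderiv_extChartAt_self]
  rfl

theorem chartDerivSymm_self (v : F) : chartDerivSymm I p p v = v := by
  conv_rhs => rw [← chartDeriv_symm (I := I) (mem_chart_source H p) v]
  rw [chartDeriv_self]

theorem chartField_extChartAt (A : ∀ q : X, TangentSpace I q) (hq : q ∈ (chartAt H p).source) :
    chartField I p A (extChartAt I p q) = chartDeriv I p q (A q) := by
  rw [chartField, (extChartAt I p).left_inv (by rwa [extChartAt_source])]

theorem smoothField_contMDiffAt {U : Set X} {A : ∀ q : X, TangentSpace I q} (hU : IsOpen U)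
    (hA : SmoothField I U A) (hq : q ∈ U) (hp : q ∈ (chartAt H p).source) :
    ContMDiffAt I 𝓘(ℝ, F) ∞ (fun q => chartDeriv I p q (A q)) q := by
  have h := (hA q hq).contMDiffAt (hU.mem_nhds hq)
  rw [(trivializationAt F (TangentSpace I) p).contMDiffAt_section_iff (by exact hp)] at h
  refine h.congr_of_eventuallyEq ?_
  filter_upwards [(chartAt H p).open_source.mem_nhds hp] with x hx
  exact chartDeriv_apply hx _

theorem smoothField_of_contMDiffAt {U : Set X} {A : ∀ q : X, TangentSpace I q}
    (h : ∀ q ∈ U, ∃ p, q ∈ (chartAt H p).source ∧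
      ContMDiffAt I 𝓘(ℝ, F) ∞ (fun q => chartDeriv I p q (A q)) q) : SmoothField I U A := by
  intro q hq
  obtain ⟨p, hp, h⟩ := h q hq
  refine ContMDiffAt.contMDiffWithinAt ?_
  rw [(trivializationAt F (TangentSpace I) p).contMDiffAt_section_iff (by exact hp)]
  refine h.congr_of_eventuallyEq ?_
  filter_upwards [(chartAt H p).open_source.mem_nhds hp] with x hx
  exact (chartDeriv_apply hx _).symm

variable [I.Boundaryless]

theorem contDiffAt_comp_extChartAt_symm {G : Type*} [NormedAddCommGroup G] [NormedSpace ℝ G]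
    {f : X → G} (hp : q ∈ (chartAt H p).source) (hf : ContMDiffAt I 𝓘(ℝ, G) ∞ f q) :
    ContDiffAt ℝ ∞ (f ∘ (extChartAt I p).symm) (extChartAt I p q) := by
  have h1 := contMDiffOn_extChartAt_symm (I := I) (n := ∞) p
  have hq : q ∈ (extChartAt I p).source := by rwa [extChartAt_source]
  have h2 := (h1 _ ((extChartAt I p).map_source hq)).contMDiffAt
    (extChartAt_target_mem_nhds' ((extChartAt I p).map_source hq))
  rw [← contMDiffAt_iff_contDiffAt]
  refine ContMDiffAt.comp _ ?_ h2
  rwa [(extChartAt I p).left_inv hq]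

omit [I.Boundaryless] in
theorem contMDiffAt_of_contDiffAt {G : Type*} [NormedAddCommGroup G] [NormedSpace ℝ G]
    {f : X → G} {g : F → G} (hp : q ∈ (chartAt H p).source)
    (hg : ContDiffAt ℝ ∞ g (extChartAt I p q))
    (hfg : ∀ᶠ x in 𝓝 q, f x = g (extChartAt I p x)) : ContMDiffAt I 𝓘(ℝ, G) ∞ f q :=
  (hg.contMDiffAt.comp q (contMDiffAt_extChartAt' hp)).congr_of_eventuallyEq hfg

theorem contDiffAt_chartField {U : Set X} {A : ∀ q : X, TangentSpace I q} (hU : IsOpen U)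
    (hA : SmoothField I U A) (hq : q ∈ U) (hp : q ∈ (chartAt H p).source) :
    ContDiffAt ℝ ∞ (chartField I p A) (extChartAt I p q) :=
  contDiffAt_comp_extChartAt_symm hp (smoothField_contMDiffAt hU hA hq hp)

omit [I.Boundaryless] in
theorem mvfderiv_eq_fderiv {G : Type*} [NormedAddCommGroup G] [NormedSpace ℝ G]
    {f : X → G} {g : F → G} (hp : q ∈ (chartAt H p).source)
    (hg : DifferentiableAt ℝ g (extChartAt I p q))
    (hfg : ∀ᶠ x in 𝓝 q, f x = g (extChartAt I p x)) (v : TangentSpace I q) :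
    mvfderiv I f q v = fderiv ℝ g (extChartAt I p q) (chartDeriv I p q v) := by
  have h1 : HasMFDerivAt I 𝓘(ℝ, G) (fun x => g (extChartAt I p x)) q _ :=
    HasMFDerivAt.comp q hg.hasFDerivAt.hasMFDerivAt
      (mdifferentiableAt_extChartAt hp).hasMFDerivAt
  have h2 := (h1.congr_of_eventuallyEq hfg).mfderiv
  rw [mvfderiv, h2, chartDeriv_eq_mfderiv hp]
  rfl

/-- The manifold bracket is the bracket of the pullbacks to the chart, carried back by the inverse
differential of the chart. The pullbacks agree with `chartField` near the centre, and at the centre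
of the chart that differential is the identity. -/
theorem mlieBracket_eq_lieBracket (A B : ∀ q : X, TangentSpace I q) :
    mlieBracket I A B p =
      lieBracket ℝ (chartField I p A) (chartField I p B) (extChartAt I p p) := by
  have key : ∀ A : ∀ q : X, TangentSpace I q,
      mpullbackWithin 𝓘(ℝ, F) I (extChartAt I p).symm A (Set.range I)
        =ᶠ[𝓝 (extChartAt I p p)] chartField I p A := fun A => by
    filter_upwards [extChartAt_target_mem_nhds (I := I) p] with z hz
    have hz' : (extChartAt I p).symm z ∈ (chartAt H p).source := by
      rw [← extChartAt_source I]; exact (extChartAt I p).map_target hz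
    have h := TangentBundle.symmL_trivializationAt (I := I) hz'
    rw [(extChartAt I p).right_inv hz] at h
    have h' : (chartDerivSymm I p ((extChartAt I p).symm z)).inverse =
        chartDeriv I p ((extChartAt I p).symm z) :=
      ContinuousLinearMap.inverse_eq (by ext v; exact chartDerivSymm_deriv hz' v)
        (by ext v; exact chartDeriv_symm hz' v)
    have h'' : (mfderivWithin 𝓘(ℝ, F) I (extChartAt I p).symm (Set.range I) z).inverse =
        chartDeriv I p ((extChartAt I p).symm z) := by
      rw [← h']; exact congrArg ContinuousLinearMap.inverse h.symm
    exact DFunLike.congr_fun h'' _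
  have h : (mfderiv I 𝓘(ℝ, F) (extChartAt I p) p).inverse = ContinuousLinearMap.id ℝ F := by
    rw [mfderiv_extChartAt_self]; exact ContinuousLinearMap.inverse_id
  have h3 : ∀ A B C D : F → F, A =ᶠ[𝓝 (extChartAt I p p)] C → B =ᶠ[𝓝 (extChartAt I p p)] D →
      lieBracketWithin ℝ A B ((extChartAt I p).symm ⁻¹' Set.univ ∩ Set.range I)
        (extChartAt I p p) = lieBracket ℝ C D (extChartAt I p p) := fun A B C D hA hB => by
    rw [Set.preimage_univ, Set.univ_inter, I.range_eq_univ, lieBracketWithin_univ]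
    exact hA.lieBracket_vectorField_eq hB
  rw [← mlieBracketWithin_univ, mlieBracketWithin_apply]
  exact (DFunLike.congr_fun h _).trans (h3 _ _ _ _ (key A) (key B))

theorem fderiv_bilin_apply {β : F → F →L[ℝ] F →L[ℝ] ℝ} {A B : F → F} {z : F}
    (hβ : DifferentiableAt ℝ β z) (hA : DifferentiableAt ℝ A z) (hB : DifferentiableAt ℝ B z)
    (v : F) : fderiv ℝ (fun z => β z (A z) (B z)) z v =
      fderiv ℝ β z v (A z) (B z) + β z (fderiv ℝ A z v) (B z) + β z (A z) (fderiv ℝ B z v) := by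
  rw [((hβ.hasFDerivAt.clm_apply hA.hasFDerivAt).clm_apply hB.hasFDerivAt).fderiv]
  simp only [add_apply, ContinuousLinearMap.comp_apply, ContinuousLinearMap.flip_apply]
  abel

/-- By the product rule the left side contains derivatives of the vector fields; they pair off with
the bracket terms by skew-symmetry and cancel. -/
theorem extDerivTwo_eq_lieBracket {β : F → F →L[ℝ] F →L[ℝ] ℝ} {A B C : F → F} {z : F}
    (hβ : DifferentiableAt ℝ β z) (hA : DifferentiableAt ℝ A z) (hB : DifferentiableAt ℝ B z)
    (hC : DifferentiableAt ℝ C z) (skew : ∀ a c, β z a c = -β z c a) :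
    fderiv ℝ (fun z => β z (B z) (C z)) z (A z) - fderiv ℝ (fun z => β z (A z) (C z)) z (B z)
      + fderiv ℝ (fun z => β z (A z) (B z)) z (C z) - β z (lieBracket ℝ A B z) (C z)
      + β z (lieBracket ℝ A C z) (B z) - β z (lieBracket ℝ B C z) (A z)
      = extDerivTwo β z (A z) (B z) (C z) := by
  rw [fderiv_bilin_apply hβ hB hC, fderiv_bilin_apply hβ hA hC, fderiv_bilin_apply hβ hA hB,
    lieBracket_eq, lieBracket_eq, lieBracket_eq, extDerivTwo]
  simp only [map_sub, sub_apply]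
  linear_combination skew (B z) (fderiv ℝ C z (A z)) - skew (A z) (fderiv ℝ C z (B z))
    + skew (A z) (fderiv ℝ B z (C z))

/-- A 2-form which is smooth and closed in charts is a smooth closed 2-form. -/
theorem isClosedTwoForm_of_charts
    {b : ∀ p : X, LinearMap.BilinForm ℝ (TangentSpace I p)}
    (alt : ∀ p, (b p).IsAlt)
    (h : ∀ p : X, ∃ β : F → F →L[ℝ] F →L[ℝ] ℝ, ContDiffAt ℝ ∞ β (extChartAt I p p) ∧
      (∀ᶠ q in 𝓝 p, ∀ a c, b q a c = β (extChartAt I p q) (chartDeriv I p q a)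
        (chartDeriv I p q c)) ∧ ∀ a c d, extDerivTwo β (extChartAt I p p) a c d = 0) :
    IsClosedTwoForm I b := by
  have key : ∀ (p : X) (β : F → F →L[ℝ] F →L[ℝ] ℝ) (U : Set X)
      (A B : ∀ p : X, TangentSpace I p), IsOpen U → SmoothField I U A → SmoothField I U B →
      p ∈ U → ContDiffAt ℝ ∞ β (extChartAt I p p) →
      (∀ᶠ q in 𝓝 p, ∀ a c, b q a c = β (extChartAt I p q) (chartDeriv I p q a)
        (chartDeriv I p q c)) →
      ContDiffAt ℝ ∞ (fun z => β z (chartField I p A z) (chartField I p B z))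
        (extChartAt I p p) ∧ ∀ᶠ q in 𝓝 p, b q (A q) (B q) =
          (fun z => β z (chartField I p A z) (chartField I p B z)) (extChartAt I p q) := by
    intro p β U A B hU hA hB hp hβ hb
    refine ⟨(hβ.clm_apply (contDiffAt_chartField hU hA hp (mem_chart_source H p))).clm_apply
      (contDiffAt_chartField hU hB hp (mem_chart_source H p)), ?_⟩
    filter_upwards [hb, (chartAt H p).open_source.mem_nhds (mem_chart_source H p)] with q h1 h2
    rw [h1, chartField_extChartAt _ h2, chartField_extChartAt _ h2]
  refine ⟨fun U A B hU hA hB p hp => ?_, alt, fun U A B C hU hA hB hC p hp => ?_⟩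
  · obtain ⟨β, h1, h2, -⟩ := h p
    obtain ⟨h3, h4⟩ := key p β U A B hU hA hB hp h1 h2
    exact (contMDiffAt_of_contDiffAt (mem_chart_source H p) h3 h4).contMDiffWithinAt
  · obtain ⟨β, h1, h2, h5⟩ := h p
    have hs := mem_chart_source H p
    have e : ∀ (A B D : ∀ p : X, TangentSpace I p), SmoothField I U A →
        SmoothField I U B → mvfderiv I (fun q => b q (A q) (B q)) p (D p) =
          fderiv ℝ (fun z => β z (chartField I p A z) (chartField I p B z)) (extChartAt I p p)
            (chartField I p D (extChartAt I p p)) := by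
      intro A B D hA hB
      obtain ⟨h3, h4⟩ := key p β U A B hU hA hB hp h1 h2
      rw [mvfderiv_eq_fderiv hs (h3.differentiableAt (by simp)) h4, chartField_extChartAt _ hs]
    -- The brackets live in the tangent space and their coordinate expressions in the model space.
    -- At the centre of the chart these are the same space, and `v = a` passes between the two
    -- types.
    have hb : ∀ (v : TangentSpace I p) (a : F) (D : ∀ p : X, TangentSpace I p), v = a →
        b p v (D p) = β (extChartAt I p p) a (chartField I p D (extChartAt I p p)) := by
      rintro v _ D rfl
      rw [h2.self_of_nhds, chartDeriv_self, chartField_extChartAt _ hs]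
    have hskew : ∀ a c : F, β (extChartAt I p p) a c = -β (extChartAt I p p) c a := fun a c => by
      have h6 : ∀ a c : TangentSpace I p, b p a c = β (extChartAt I p p) a c := fun a c => by
        rw [h2.self_of_nhds, chartDeriv_self, chartDeriv_self]
      exact (h6 a c).symm.trans (((alt p).neg_eq c a).symm.trans (congrArg Neg.neg (h6 c a)))
    have d : ∀ A : ∀ p : X, TangentSpace I p, SmoothField I U A →
        DifferentiableAt ℝ (chartField I p A) (extChartAt I p p) := fun A hA =>
      (contDiffAt_chartField hU hA hp hs).differentiableAt (by simp)
    rw [e B C A hB hC, e A C B hA hC, e A B C hA hB, hb _ _ C (mlieBracket_eq_lieBracket A B),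
      hb _ _ B (mlieBracket_eq_lieBracket A C), hb _ _ A (mlieBracket_eq_lieBracket B C),
      extDerivTwo_eq_lieBracket (h1.differentiableAt (by simp)) (d A hA) (d B hB) (d C hC) hskew]
    exact h5 _ _ _

theorem smoothEndo_of_charts {K : ∀ p : X, TangentSpace I p →ₗ[ℝ] TangentSpace I p}
    (h : ∀ p : X, ∃ L : F → F →L[ℝ] F, ContDiffAt ℝ ∞ L (extChartAt I p p) ∧
      ∀ᶠ q in 𝓝 p, ∀ a, chartDeriv I p q (K q a) = L (extChartAt I p q) (chartDeriv I p q a)) :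
    SmoothEndo I K := by
  intro U A hU hA
  refine smoothField_of_contMDiffAt fun p hp => ⟨p, mem_chart_source H p, ?_⟩
  obtain ⟨L, h1, h2⟩ := h p
  refine contMDiffAt_of_contDiffAt (mem_chart_source H p)
    (h1.clm_apply (contDiffAt_chartField hU hA hp (mem_chart_source H p))) ?_
  filter_upwards [h2, (chartAt H p).open_source.mem_nhds (mem_chart_source H p)] with q h3 h4
  rw [h3, chartField_extChartAt _ h4]

omit [I.Boundaryless] in
theorem SmoothEndo.comp {K L : ∀ p : X, TangentSpace I p →ₗ[ℝ] TangentSpace I p}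
    (hK : SmoothEndo I K) (hL : SmoothEndo I L) : SmoothEndo I (fun p => K p ∘ₗ L p) :=
  fun U _ hU hA => hK U _ hU (hL U _ hU hA)

omit [I.Boundaryless] in
theorem SmoothForm.compRight {K : ∀ p : X, TangentSpace I p →ₗ[ℝ] TangentSpace I p}
    {b : ∀ p : X, LinearMap.BilinForm ℝ (TangentSpace I p)} (hb : SmoothForm I b)
    (hK : SmoothEndo I K) : SmoothForm I (fun p => (b p).compRight (K p)) :=
  fun U _ _ hU hA hB => hb U _ _ hU hA (hK U _ hU hB)

omit [I.Boundaryless] in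
variable (I) in
theorem smoothField_chartDerivSymm (p : X) (v : F) :
    SmoothField I (chartAt H p).source (fun q => chartDerivSymm I p q v) := by
  refine smoothField_of_contMDiffAt fun q hq => ⟨p, hq, ?_⟩
  refine (contMDiffAt_const (c := v)).congr_of_eventuallyEq ?_
  filter_upwards [(chartAt H p).open_source.mem_nhds hq] with x hx
  exact chartDeriv_symm hx _

-- This allows a pointwise identity of tensors to be deduced from identities that are stated for
-- local vector fields.
omit [I.Boundaryless] in
theorem exists_smoothField (p : X) (v : TangentSpace I p) :
    ∃ (U : Set X) (A : ∀ q : X, TangentSpace I q), IsOpen U ∧ p ∈ U ∧ SmoothField I U A ∧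
      A p = v :=
  ⟨(chartAt H p).source, fun q => chartDerivSymm (F := F) I p q v, (chartAt H p).open_source,
    mem_chart_source H p, smoothField_chartDerivSymm (F := F) I p v, chartDerivSymm_self (F := F) v⟩

omit [I.Boundaryless] in
/-- An almost complex structure `K` such that `τ(-, -) = -σ(K-, -)` for two closed nondegenerate
2-forms `σ` and `τ` is integrable: its eigenspaces are the kernels of the closed complex forms
`σ ± i τ`. -/
theorem isComplexStructure_of_closed
    {K : ∀ p : X, TangentSpace I p →ₗ[ℝ] TangentSpace I p}
    {σ τ : ∀ p : X, LinearMap.BilinForm ℝ (TangentSpace I p)}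
    (smooth : SmoothEndo I K) (sq : ∀ p u, K p (K p u) = -u)
    (hσ : IsClosedTwoForm I σ) (hτ : IsClosedTwoForm I τ)
    (nondeg : ∀ p, (σ p).Nondegenerate)
    (h : ∀ p u w, τ p u w = -σ p (K p u) w) : IsComplexStructure I K := by
  refine ⟨smooth, sq, fun U A B hU hA hB p hp => ?_⟩
  have hKA := smooth U A hU hA
  have hKB := smooth U B hU hB
  set a := mlieBracket I A B p - mlieBracket I (fun q => K q (A q)) (fun q => K q (B q)) p with ha
  set b := mlieBracket I (fun q => K q (A q)) B p + mlieBracket I A (fun q => K q (B q)) p with hb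
  -- This is the real part of d(σ + iτ)(A + iKA, B + iKB, C) = 0. The vectors A + iKA and B + iKB
  -- lie in the kernel of σ + iτ, so only the term with their bracket survives. Nondegeneracy of σ
  -- then gives a = -Kb, which is the vanishing of the Nijenhuis tensor.
  have key : σ p a = τ p b := by
    ext c
    obtain ⟨W, C, hW, hpW, hC, rfl⟩ := exists_smoothField p c
    have hUW := hU.inter hW
    have m : ∀ {D : ∀ q : X, TangentSpace I q} {S : Set X}, U ∩ W ⊆ S → SmoothField I S D →
      SmoothField I (U ∩ W) D := fun hS hD => hD.mono hS
    have sA := m Set.inter_subset_left hA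
    have sB := m Set.inter_subset_left hB
    have sKA := m Set.inter_subset_left hKA
    have sKB := m Set.inter_subset_left hKB
    have sC := m Set.inter_subset_right hC
    have e1 := hσ.closed _ _ _ _ hUW sA sB sC p ⟨hp, hpW⟩
    have e2 := hσ.closed _ _ _ _ hUW sKA sKB sC p ⟨hp, hpW⟩
    have e3 := hτ.closed _ _ _ _ hUW sKA sB sC p ⟨hp, hpW⟩
    have e4 := hτ.closed _ _ _ _ hUW sA sKB sC p ⟨hp, hpW⟩
    have h' : ∀ q u w, τ q (K q u) w = σ q u w := fun q u w => by
      rw [h, sq, map_neg, LinearMap.neg_apply, neg_neg]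
    have skew : ∀ q u w, σ q u w = -σ q w u := fun q u w => ((hσ.alt q).neg_eq w u).symm
    have skew' : ∀ q u w, τ q u w = -τ q w u := fun q u w => ((hτ.alt q).neg_eq w u).symm
    have h'' : ∀ q u w, σ q (K q u) w = -τ q u w := fun q u w => by rw [h, neg_neg]
    have r : ∀ q u w, τ q u (K q w) = σ q u w := fun q u w => by
      rw [skew', h', ← skew]
    have r' : ∀ q u w, σ q u (K q w) = -τ q u w := fun q u w => by
      rw [skew, h'', neg_neg, skew']
    have n : ∀ (f : X → ℝ) (v : TangentSpace I p),
        mvfderiv I (fun q => -f q) p v = -mvfderiv I f p v := fun f v => by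
      rw [mvfderiv_fun_neg]; rfl
    simp only [h', h'', r, r', n] at e1 e2 e3 e4
    rw [ha, hb, map_sub, map_add, LinearMap.sub_apply, LinearMap.add_apply]
    linear_combination -e1 + e2 + e3 + e4
  have hKab : a = -K p b := by
    refine LinearMap.ker_eq_bot.1 (LinearMap.separatingLeft_iff_ker_eq_bot.1 (nondeg p).1) ?_
    rw [key]
    ext w
    rw [h, map_neg, LinearMap.neg_apply]
  rw [ha, hb, map_add] at hKab
  rw [sub_sub, sub_sub, ← add_assoc, sub_eq_zero]
  rw [sub_eq_iff_eq_add] at hKab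
  rw [hKab]; abel

end Charts

/-! ### The chart of the tangent bundle -/

section TangentChart

open VectorField Filter Topology

variable {E : Type*} [NormedAddCommGroup E] [NormedSpace ℝ E]
  {M : Type*} [TopologicalSpace M] [ChartedSpace E M] [IsManifold 𝓘(ℝ, E) ∞ M]

/-- The vector field which is constant in the chart at `p`. -/
def constField (p : M) (b : E) (q : M) : TangentSpace 𝓘(ℝ, E) q :=
  chartDerivSymm 𝓘(ℝ, E) p q b

variable {V₀ V : TangentBundle 𝓘(ℝ, E) M} {p q : M}

theorem smoothField_constField (p : M) (b : E) :
    SmoothField 𝓘(ℝ, E) (chartAt E p).source (constField p b) :=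
  smoothField_chartDerivSymm 𝓘(ℝ, E) p b

theorem mdifferentiableAt_constField (hq : q ∈ (chartAt E p).source) (b : E) :
    MDifferentiableAt 𝓘(ℝ, E) (𝓘(ℝ, E)).tangent
      (fun q => (⟨q, constField p b q⟩ : TangentBundle 𝓘(ℝ, E) M)) q :=
  ((smoothField_constField p b q hq).contMDiffAt
    ((chartAt E p).open_source.mem_nhds hq)).mdifferentiableAt (by simp)

theorem tangent_mem_source (hV : V.proj ∈ (chartAt E V₀.proj).source) :
    V ∈ (chartAt (ModelProd E E) V₀).source :=
  (TangentBundle.mem_chart_source_iff V V₀).2 hV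

theorem extChartAt_tangent (hV : V.proj ∈ (chartAt E V₀.proj).source) :
    extChartAt (𝓘(ℝ, E)).tangent V₀ V =
      (extChartAt 𝓘(ℝ, E) V₀.proj V.proj, chartDeriv 𝓘(ℝ, E) V₀.proj V.proj V.2) := by
  have h : extChartAt (𝓘(ℝ, E)).tangent V₀ = _ :=
    FiberBundle.extChartAt (IB := 𝓘(ℝ, E)) (F := E) V₀
  rw [h, chartDeriv_apply hV]
  rfl

theorem chartDeriv_tangent_mfderiv {G N : Type*} [NormedAddCommGroup G] [NormedSpace ℝ G]
    [TopologicalSpace N] [ChartedSpace G N] {f : N → TangentBundle 𝓘(ℝ, E) M} {x : N}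
    (hf : MDifferentiableAt 𝓘(ℝ, G) (𝓘(ℝ, E)).tangent f x)
    (hx : (f x).proj ∈ (chartAt E V₀.proj).source) (w : TangentSpace 𝓘(ℝ, G) x) :
    chartDeriv (𝓘(ℝ, E)).tangent V₀ (f x) (mfderiv 𝓘(ℝ, G) (𝓘(ℝ, E)).tangent f x w) =
      mvfderiv 𝓘(ℝ, G) (fun y => extChartAt (𝓘(ℝ, E)).tangent V₀ (f y)) x w := by
  rw [chartDeriv_eq_mfderiv (tangent_mem_source hx)]
  have h := mfderiv_comp x (mdifferentiableAt_extChartAt (tangent_mem_source hx)) hf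
  exact (DFunLike.congr_fun h w).symm

theorem chartDeriv_tangent_fst (hV : V.proj ∈ (chartAt E V₀.proj).source)
    (a : TangentSpace (𝓘(ℝ, E)).tangent V) :
    (chartDeriv (𝓘(ℝ, E)).tangent V₀ V a).1 = chartDeriv 𝓘(ℝ, E) V₀.proj V.proj (dproj V a) := by
  rw [chartDeriv_eq_mfderiv (tangent_mem_source hV), chartDeriv_eq_mfderiv hV]
  have h1 : HasMFDerivAt (𝓘(ℝ, E)).tangent 𝓘(ℝ, E) (fun W : TangentBundle 𝓘(ℝ, E) M =>
      (extChartAt (𝓘(ℝ, E)).tangent V₀ W).1) V _ :=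
    HasMFDerivAt.comp V (hasFDerivAt_fst (𝕜 := ℝ) (E := E) (F := E)).hasMFDerivAt
      (mdifferentiableAt_extChartAt (tangent_mem_source hV)).hasMFDerivAt
  have h2 : HasMFDerivAt (𝓘(ℝ, E)).tangent 𝓘(ℝ, E) (fun W : TangentBundle 𝓘(ℝ, E) M =>
      extChartAt 𝓘(ℝ, E) V₀.proj W.proj) V _ :=
    HasMFDerivAt.comp V (mdifferentiableAt_extChartAt hV).hasMFDerivAt
      (mdifferentiableAt_proj V).hasMFDerivAt
  have h3 : (fun W : TangentBundle 𝓘(ℝ, E) M => (extChartAt (𝓘(ℝ, E)).tangent V₀ W).1)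
      =ᶠ[𝓝 V] fun W => extChartAt 𝓘(ℝ, E) V₀.proj W.proj := by
    filter_upwards [(chartAt (ModelProd E E) V₀).open_source.mem_nhds (tangent_mem_source hV)]
      with W hW
    rw [extChartAt_tangent ((TangentBundle.mem_chart_source_iff W V₀).1 hW)]
  exact DFunLike.congr_fun (hasMFDerivAt_unique h1 (h2.congr_of_eventuallyEq h3)) a

theorem chartDeriv_tangent_vertLift (hV : V.proj ∈ (chartAt E V₀.proj).source)
    (w : TangentSpace 𝓘(ℝ, E) V.proj) :
    chartDeriv (𝓘(ℝ, E)).tangent V₀ V (vertLift V w) =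
      (0, chartDeriv 𝓘(ℝ, E) V₀.proj V.proj w) := by
  have h := chartDeriv_tangent_mfderiv (V₀ := V₀)
    (((contMDiff_fibreIncl (E := E) V.proj).contMDiffAt
    (x := vecPart V)).mdifferentiableAt (by simp)) hV w
  refine h.trans ?_
  have h2 : (fun y : E => extChartAt (𝓘(ℝ, E)).tangent V₀ (fibreIncl V.proj y)) = fun y =>
      (extChartAt 𝓘(ℝ, E) V₀.proj V.proj, (chartDeriv 𝓘(ℝ, E) V₀.proj V.proj : E →L[ℝ] E) y) :=
    funext fun y => extChartAt_tangent (V := fibreIncl V.proj y) hV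
  rw [h2]
  have h3 : HasFDerivAt (fun y : E => (extChartAt 𝓘(ℝ, E) V₀.proj V.proj,
      (chartDeriv 𝓘(ℝ, E) V₀.proj V.proj : E →L[ℝ] E) y)) _ (vecPart V) :=
    (hasFDerivAt_const _ _).prodMk (ContinuousLinearMap.hasFDerivAt _)
  exact DFunLike.congr_fun h3.hasMFDerivAt.mfderiv w

theorem mdifferentiableAt_chartDeriv {s : ∀ q : M, TangentSpace 𝓘(ℝ, E) q}
    (hq : q ∈ (chartAt E p).source) (hs : MDifferentiableAt 𝓘(ℝ, E) (𝓘(ℝ, E)).tangent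
      (fun q => (⟨q, s q⟩ : TangentBundle 𝓘(ℝ, E) M)) q) :
    MDifferentiableAt 𝓘(ℝ, E) 𝓘(ℝ, E) (fun q => chartDeriv 𝓘(ℝ, E) p q (s q)) q := by
  have h := ((trivializationAt E (TangentSpace 𝓘(ℝ, E)) p).mdifferentiableAt_section_iff 𝓘(ℝ, E) s
    hq).1 hs
  refine h.congr_of_eventuallyEq ?_
  filter_upwards [(chartAt E p).open_source.mem_nhds hq] with x hx
  exact chartDeriv_apply hx _

/-- The vector part, in the chart, of the differential of a section of the tangent bundle. -/
theorem chartDeriv_tangent_section {s : ∀ q : M, TangentSpace 𝓘(ℝ, E) q}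
    (hq : q ∈ (chartAt E V₀.proj).source)
    (hs : MDifferentiableAt 𝓘(ℝ, E) (𝓘(ℝ, E)).tangent
      (fun q => (⟨q, s q⟩ : TangentBundle 𝓘(ℝ, E) M)) q) (w : TangentSpace 𝓘(ℝ, E) q) :
    chartDeriv (𝓘(ℝ, E)).tangent V₀ ⟨q, s q⟩ (mfderiv 𝓘(ℝ, E) (𝓘(ℝ, E)).tangent
      (fun q => (⟨q, s q⟩ : TangentBundle 𝓘(ℝ, E) M)) q w) =
      (chartDeriv 𝓘(ℝ, E) V₀.proj q w,
        mvfderiv 𝓘(ℝ, E) (fun q => chartDeriv 𝓘(ℝ, E) V₀.proj q (s q)) q w) := by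
  rw [chartDeriv_tangent_mfderiv hs hq]
  have h : HasMFDerivAt 𝓘(ℝ, E) 𝓘(ℝ, E × E) (fun y => (extChartAt 𝓘(ℝ, E) V₀.proj y,
      chartDeriv 𝓘(ℝ, E) V₀.proj y (s y))) q _ :=
    ⟨(mdifferentiableAt_extChartAt hq).hasMFDerivAt.1.prodMk
      (mdifferentiableAt_chartDeriv hq hs).hasMFDerivAt.1,
      (mdifferentiableAt_extChartAt hq).hasMFDerivAt.2.prodMk
      (mdifferentiableAt_chartDeriv hq hs).hasMFDerivAt.2⟩
  have h2 : (fun y => extChartAt (𝓘(ℝ, E)).tangent V₀ (⟨y, s y⟩ : TangentBundle 𝓘(ℝ, E) M))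
      =ᶠ[𝓝 q] fun y => (extChartAt 𝓘(ℝ, E) V₀.proj y, chartDeriv 𝓘(ℝ, E) V₀.proj y (s y)) := by
    filter_upwards [(chartAt E V₀.proj).open_source.mem_nhds hq] with y hy
    exact extChartAt_tangent (V := ⟨y, s y⟩) hy
  refine (DFunLike.congr_fun (h.congr_of_eventuallyEq h2).mfderiv w).trans ?_
  rw [chartDeriv_eq_mfderiv hq]
  rfl

/-! ### Christoffel symbols and the horizontal lift in a chart. -/

variable (D : CovariantDerivative 𝓘(ℝ, E) E (TangentSpace 𝓘(ℝ, E) : M → Type _))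

/-- The Christoffel symbols of a connection in the chart at `p`: the covariant derivative at `q`,
in the direction `a`, of the constant vector field `b`. -/
def christoffel (p q : M) (b : E) : E →L[ℝ] E :=
  (chartDeriv 𝓘(ℝ, E) p q).comp ((D (constField p b) q).comp (chartDerivSymm 𝓘(ℝ, E) p q))

theorem christoffel_add (hq : q ∈ (chartAt E p).source) (b c : E) :
    christoffel D p q (b + c) = christoffel D p q b + christoffel D p q c := by
  have h : constField p (b + c) = constField p b + constField p c :=
    funext fun x => map_add (chartDerivSymm 𝓘(ℝ, E) p x) b c
  have h2 := D.isCovariantDerivativeOnUniv.add (mdifferentiableAt_constField hq b)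
    (mdifferentiableAt_constField hq c)
  ext a
  simp only [christoffel, h, h2, ContinuousLinearMap.comp_apply, add_apply, map_add]

theorem christoffel_smul (hq : q ∈ (chartAt E p).source) (t : ℝ) (b : E) :
    christoffel D p q (t • b) = t • christoffel D p q b := by
  have h : constField p (t • b) = t • constField p b :=
    funext fun x => map_smul (chartDerivSymm 𝓘(ℝ, E) p x) t b
  have h2 := D.isCovariantDerivativeOnUniv.smul_const t (mdifferentiableAt_constField hq b)
  ext a
  simp only [christoffel, h, h2, ContinuousLinearMap.comp_apply, smul_apply, map_smul]

/-- The difference between ∇ and the coordinate derivative is tensorial in the section, so `s` may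
be replaced by the constant field with the same value at `q`. The coordinate derivative of that
field vanishes, and what is left is the Christoffel symbol. -/
theorem chartDeriv_conn [FiniteDimensional ℝ E] {s : ∀ q : M, TangentSpace 𝓘(ℝ, E) q}
    (hq : q ∈ (chartAt E p).source) (hs : MDifferentiableAt 𝓘(ℝ, E) (𝓘(ℝ, E)).tangent
      (fun q => (⟨q, s q⟩ : TangentBundle 𝓘(ℝ, E) M)) q) (w : TangentSpace 𝓘(ℝ, E) q) :
    chartDeriv 𝓘(ℝ, E) p q (D s q w) =
      mvfderiv 𝓘(ℝ, E) (fun x => chartDeriv 𝓘(ℝ, E) p x (s x)) q w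
      + christoffel D p q (chartDeriv 𝓘(ℝ, E) p q (s q)) (chartDeriv 𝓘(ℝ, E) p q w) := by
  let Φ : (∀ q : M, TangentSpace 𝓘(ℝ, E) q) → E := fun s => chartDeriv 𝓘(ℝ, E) p q (D s q w)
    - mvfderiv 𝓘(ℝ, E) (fun x => chartDeriv 𝓘(ℝ, E) p x (s x)) q w
  have hΦ : TensorialAt 𝓘(ℝ, E) E Φ q := by
    refine ⟨fun {f σ} hf hσ => ?_, fun {σ σ'} hσ hσ' => ?_⟩
    · have h1 := D.isCovariantDerivativeOnUniv.leibniz hσ hf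
      have h2 : (fun x => chartDeriv 𝓘(ℝ, E) p x ((f • σ) x)) =
        f • fun x => chartDeriv 𝓘(ℝ, E) p x (σ x) := funext fun x => map_smul _ _ _
      simp only [Φ, h1, h2]
      rw [mvfderiv_smul hf (mdifferentiableAt_chartDeriv hq hσ)]
      simp [smul_sub]
    · have h1 := D.isCovariantDerivativeOnUniv.add hσ hσ'
      have h2 : (fun x => chartDeriv 𝓘(ℝ, E) p x ((σ + σ') x)) =
        (fun x => chartDeriv 𝓘(ℝ, E) p x (σ x)) + fun x => chartDeriv 𝓘(ℝ, E) p x (σ' x) :=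
        funext fun x => map_add _ _ _
      simp only [Φ, h1, h2]
      rw [mvfderiv_add (mdifferentiableAt_chartDeriv hq hσ) (mdifferentiableAt_chartDeriv hq hσ')]
      simp only [add_apply, map_add]
      abel
  have h1 := hΦ.pointwise hs (mdifferentiableAt_constField hq (chartDeriv 𝓘(ℝ, E) p q (s q)))
    (chartDerivSymm_deriv hq (s q)).symm
  have h2 : mvfderiv 𝓘(ℝ, E) (fun x => chartDeriv 𝓘(ℝ, E) p x
      (constField p (chartDeriv 𝓘(ℝ, E) p q (s q)) x)) q w = 0 := by
    rw [mvfderiv_eq_fderiv hq (g := fun _ => chartDeriv 𝓘(ℝ, E) p q (s q))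
      (differentiableAt_const _)]
    · simp
    · filter_upwards [(chartAt E p).open_source.mem_nhds hq] with x hx
      exact chartDeriv_symm hx _
  simp only [Φ, h2, sub_zero] at h1
  rw [sub_eq_iff_eq_add'.1 h1, christoffel]
  simp only [ContinuousLinearMap.comp_apply, chartDerivSymm_deriv hq]

/-- In `horiz` the coordinate derivative of the auxiliary section occurs once in its differential
and once in its covariant derivative; the two cancel and leave a formula without the section. -/
theorem chartDeriv_tangent_horiz [FiniteDimensional ℝ E]
    (hV : V.proj ∈ (chartAt E V₀.proj).source) (S : AffineSpecialKahler E M)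
    (w : TangentSpace 𝓘(ℝ, E) V.proj) :
    chartDeriv (𝓘(ℝ, E)).tangent V₀ V (S.horiz V w) =
      (chartDeriv 𝓘(ℝ, E) V₀.proj V.proj w,
        -christoffel S.conn V₀.proj V.proj (chartDeriv 𝓘(ℝ, E) V₀.proj V.proj V.2)
          (chartDeriv 𝓘(ℝ, E) V₀.proj V.proj w)) := by
  have hs := FiberBundle.mdifferentiableAt_extend 𝓘(ℝ, E) E V.2
  have h1 := chartDeriv_tangent_section (V₀ := V₀) hV hs w
  have h2 := chartDeriv_conn S.conn hV hs w
  rw [FiberBundle.extend_apply_self] at h1 h2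
  have h3 : S.horiz V w = extendDeriv V w
    - vertLift V (S.conn (FiberBundle.extend E V.2) V.proj w) := rfl
  have h4 : chartDeriv (𝓘(ℝ, E)).tangent V₀ V (extendDeriv V w) = _ := h1
  rw [h3, map_sub, h4, chartDeriv_tangent_vertLift hV, h2]
  ext <;> simp

/-- Constant fields are smooth only over the chart domain, whereas smoothness of the connection is
applied to global sections; a bump function joins the two. -/
theorem exists_smooth_extension [FiniteDimensional ℝ E] [T2Space M]
    (hq : q ∈ (chartAt E p).source) (b : E) :
    ∃ s : ∀ q : M, TangentSpace 𝓘(ℝ, E) q, ContMDiff 𝓘(ℝ, E) (𝓘(ℝ, E)).tangent ∞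
      (fun q => (⟨q, s q⟩ : TangentBundle 𝓘(ℝ, E) M)) ∧ ∀ᶠ x in 𝓝 q, s x = constField p b x := by
  obtain ⟨ψ, -, hψ⟩ := (SmoothBumpFunction.nhds_basis_tsupport (I := 𝓘(ℝ, E)) q).mem_iff.1
    ((chartAt E p).open_source.mem_nhds hq)
  refine ⟨(ψ : M → ℝ) • constField p b, ContMDiffOn.smul_section_of_tsupport
    ψ.contMDiff.contMDiffOn (chartAt E p).open_source hψ (smoothField_constField p b), ?_⟩
  filter_upwards [ψ.eventuallyEq_one] with x hx
  simp [hx]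

theorem contMDiffAt_christoffel [FiniteDimensional ℝ E] [T2Space M]
    (hD : CovariantDerivative.ContMDiffCovariantDerivative D ∞)
    (hq : q ∈ (chartAt E p).source) (b a : E) :
    ContMDiffAt 𝓘(ℝ, E) 𝓘(ℝ, E) ∞ (fun x => christoffel D p x b a) q := by
  obtain ⟨s, hs, hsb⟩ := exists_smooth_extension hq b
  have h1 := hD.contMDiff.contMDiff (σ := s) (by exact hs.contMDiffOn) q (Set.mem_univ q)
  have h2 := ((smoothField_constField p a q hq).contMDiffAt
    ((chartAt E p).open_source.mem_nhds hq))
  have h3 := (h1.contMDiffAt Filter.univ_mem).clm_bundle_apply h2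
  have h4 : ContMDiffAt 𝓘(ℝ, E) (𝓘(ℝ, E)).tangent ∞
    (fun x => (⟨x, D s x (constField p a x)⟩ : TangentBundle 𝓘(ℝ, E) M)) q := h3
  rw [(trivializationAt E (TangentSpace 𝓘(ℝ, E)) p).contMDiffAt_section_iff (by exact hq)] at h4
  refine h4.congr_of_eventuallyEq ?_
  filter_upwards [(chartAt E p).open_source.mem_nhds hq, hsb.eventually_nhds] with x hx hx'
  rw [← chartDeriv_apply hx, christoffel, ContinuousLinearMap.comp_apply,
    ContinuousLinearMap.comp_apply]
  rw [D.isCovariantDerivativeOnUniv.congr_of_eventuallyEq (mdifferentiableAt_constField hx b)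
    ((hs x).mdifferentiableAt (by simp)) Filter.univ_mem (hx'.mono fun y hy => hy.symm)]
  rfl

end TangentChart

/-! ### Fibrewise Hamiltonian vector fields in coordinates -/

section FibreHam

open Filter Topology

variable {E : Type*} [NormedAddCommGroup E] [NormedSpace ℝ E]

/-- For a family `H` of functions depending linearly on `w`, the fibrewise Hamiltonian vector field
of `H w` with respect to the form `Ω` on the fibre. -/
def fibreHam (Ω : E → E →L[ℝ] E →L[ℝ] ℝ) (H : E × E → E →L[ℝ] ℝ) (z : E × E) : E →L[ℝ] E :=
  (Ω z.1).flip.inverse.comp ((fderiv ℝ H z).comp (ContinuousLinearMap.inr ℝ E E)).flip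

variable {Ω : E → E →L[ℝ] E →L[ℝ] ℝ} {H : E × E → E →L[ℝ] ℝ} {z : E × E}

theorem apply_fibreHam (hΩ : (Ω z.1).flip.IsInvertible) (v w : E) :
    Ω z.1 v (fibreHam Ω H z w) = fderiv ℝ H z (0, v) w := by
  have h := hΩ.self_apply_inverse
    (((fderiv ℝ H z).comp (ContinuousLinearMap.inr ℝ E E)).flip w)
  exact DFunLike.congr_fun h v

theorem contDiffAt_flip [FiniteDimensional ℝ E] {f : E × E → E →L[ℝ] E →L[ℝ] ℝ}
    (h : ContDiffAt ℝ ∞ f z) : ContDiffAt ℝ ∞ (fun z => (f z).flip) z :=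
  contDiffAt_clm_of_apply fun _ => contDiffAt_clm_of_apply fun _ =>
    (h.clm_apply contDiffAt_const).clm_apply contDiffAt_const

/-- Operator inversion is smooth at an invertible operator. -/
theorem contDiffAt_fibreHam [FiniteDimensional ℝ E] (hΩ : ContDiffAt ℝ ∞ Ω z.1)
    (hinv : (Ω z.1).flip.IsInvertible) (hH : ContDiffAt ℝ ∞ H z) :
    ContDiffAt ℝ ∞ (fibreHam Ω H) z := by
  have : CompleteSpace E := FiniteDimensional.complete ℝ E
  have h1 : ContDiffAt ℝ ∞ (fun z : E × E => (Ω z.1).flip) z :=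
    contDiffAt_flip (ContDiffAt.comp (g := Ω) z hΩ contDiffAt_fst)
  obtain ⟨e, he⟩ := hinv
  have h2 : ContDiffAt ℝ ∞ (fun z : E × E => (Ω z.1).flip.inverse) z := by
    refine ContDiffAt.comp (g := ContinuousLinearMap.inverse) z ?_ h1
    rw [← he]
    exact contDiffAt_map_inverse e
  have h3 : ContDiffAt ℝ ∞ (fderiv ℝ H) z := hH.fderiv_right (by simp)
  refine contDiffAt_clm_of_apply fun w => h2.clm_apply ?_
  exact contDiffAt_clm_of_apply fun v =>
    (h3.clm_apply contDiffAt_const).clm_apply contDiffAt_const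

set_option synthInstance.maxHeartbeats 400000 in
set_option maxHeartbeats 1000000 in
/-- The derivative along the fibres of a fibrewise Hamiltonian vector field is an infinitesimal
symplectic map. -/
theorem fibreHam_symplectic (hΩ : DifferentiableAt ℝ Ω z.1)
    (hinv : ∀ᶠ z' in 𝓝 z, (Ω z'.1).flip.IsInvertible) (hH : ContDiffAt ℝ ∞ H z)
    (hd : DifferentiableAt ℝ (fibreHam Ω H) z) (v v' w : E) :
    Ω z.1 v (fderiv ℝ (fibreHam Ω H) z (0, v') w) =
      Ω z.1 v' (fderiv ℝ (fibreHam Ω H) z (0, v) w) := by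
  have hf : ContDiffAt ℝ ∞ (fun z => H z w) z := hH.clm_apply contDiffAt_const
  have hsymm := hf.isSymmSndFDerivAt (by
    simp [minSmoothness_of_isRCLikeNormedField]; exact ENat.LEInfty.out)
  have hev : ∀ᶠ z' in 𝓝 z, DifferentiableAt ℝ H z' :=
    ((hH.of_le (m := 1) (by simp)).eventually (by simp)).mono fun z' h =>
      h.differentiableAt (by simp)
  -- Along the fibre `Ω` is constant, so differentiating the defining equation of the Hamiltonian
  -- field in the direction `(0, v')` yields the second derivative of `H w`, which is symmetric.
  have key : ∀ v v' : E, Ω z.1 v (fderiv ℝ (fibreHam Ω H) z (0, v') w) =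
      fderiv ℝ (fderiv ℝ fun z => H z w) z (0, v') (0, v) := fun v v' => by
    have hΩ' := hasFDerivAt_comp_fst (G := E →L[ℝ] E →L[ℝ] ℝ) hΩ
    have h1 := (hΩ'.clm_apply (hasFDerivAt_const v z)).clm_apply
      (hd.hasFDerivAt.clm_apply (hasFDerivAt_const w z))
    have h2 : DifferentiableAt ℝ (fderiv ℝ fun z => H z w) z :=
      (hf.fderiv_right (m := ∞) (by simp)).differentiableAt (by simp)
    have h3 := h2.hasFDerivAt.clm_apply (hasFDerivAt_const ((0 : E), v) z)
    have h4 : (fun z' => Ω z'.1 v (fibreHam Ω H z' w)) =ᶠ[𝓝 z]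
        fun z' => fderiv ℝ (fun z => H z w) z' (0, v) := by
      filter_upwards [hinv, hev] with z' h5 h6
      rw [apply_fibreHam h5, (h6.hasFDerivAt.clm_apply (hasFDerivAt_const w z')).fderiv]
      simp
    have h5 := DFunLike.congr_fun (h1.unique (h3.congr_of_eventuallyEq h4)) ((0 : E), v')
    simpa using h5
  rw [key, key, hsymm]

end FibreHam

/-! ### The connection in coordinates -/

section ConnCoordinates

open Filter Topology

variable {E : Type*} [NormedAddCommGroup E] [NormedSpace ℝ E]
  (Ω : E → E →L[ℝ] E →L[ℝ] ℝ) (Γ : E → E →L[ℝ] E →L[ℝ] E) (K : E → E →L[ℝ] E) (J : E × E → ℂ)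

/-- The horizontal lift of a connection with Christoffel symbols `Γ`. -/
def horizLift (z : E × E) : E →L[ℝ] E × E :=
  (ContinuousLinearMap.id ℝ E).prod (-Γ z.1 z.2)

/-- The function `2 ℋ_X J` for `X = (w - i K w) / 2`. -/
def horizPot (z : E × E) : E →L[ℝ] ℂ :=
  (fderiv ℝ J z).comp (horizLift Γ z)
    - Complex.I • ((fderiv ℝ J z).comp (horizLift Γ z)).comp (K z.1)

/-- The function `2 ν_X̄ J` for `X = (w - i K w) / 2`. -/
def vertPot (z : E × E) : E →L[ℝ] ℂ :=
  (fderiv ℝ J z).comp (ContinuousLinearMap.inr ℝ E E)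
    + Complex.I • ((fderiv ℝ J z).comp (ContinuousLinearMap.inr ℝ E E)).comp (K z.1)

/-- The vertical part of `2 Re h_X` for `X = (w - i K w) / 2`. -/
def connRe (z : E × E) : E →L[ℝ] E :=
  -Γ z.1 z.2 + fibreHam Ω (fun z => Complex.reCLM.comp (horizPot Γ K J z)) z

/-- The vector `2 Re v_X` for `X = (w - i K w) / 2`. -/
def connIm (z : E × E) : E →L[ℝ] E :=
  -- For a complex vector Z one has 2 Re(2πi Z) = -2π · 2 Im Z. For Z = X̄ = (w + iKw)/2 the vector
  -- 2 Im Z is K w, and for the Hamiltonian term it is the field of Im(2 ν_X̄ J).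
  (-2 * Real.pi) • (K z.1 + fibreHam Ω (fun z => Complex.imCLM.comp (vertPot K J z)) z)

variable {Ω Γ K J} {z : E × E} [FiniteDimensional ℝ E]

theorem contDiffAt_horizLift (hΓ : ContDiffAt ℝ ∞ Γ z.1) : ContDiffAt ℝ ∞ (horizLift Γ) z := by
  have hΓ' : ContDiffAt ℝ ∞ (fun z : E × E => Γ z.1) z :=
    ContDiffAt.comp (g := Γ) z hΓ contDiffAt_fst
  exact contDiffAt_clm_of_apply fun w => contDiffAt_const.prodMk
    ((hΓ'.clm_apply contDiffAt_snd).clm_apply contDiffAt_const).neg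

theorem contDiffAt_horizPot (hΓ : ContDiffAt ℝ ∞ Γ z.1) (hK : ContDiffAt ℝ ∞ K z.1)
    (hJ : ContDiffAt ℝ ∞ J z) : ContDiffAt ℝ ∞ (horizPot Γ K J) z := by
  have hL := contDiffAt_horizLift hΓ
  have hJ' : ContDiffAt ℝ ∞ (fderiv ℝ J) z := hJ.fderiv_right (by simp)
  have hK' : ContDiffAt ℝ ∞ (fun z : E × E => K z.1) z := hK.comp z contDiffAt_fst
  exact contDiffAt_clm_of_apply fun w => (hJ'.clm_apply (hL.clm_apply contDiffAt_const)).sub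
    ((hJ'.clm_apply (hL.clm_apply (hK'.clm_apply contDiffAt_const))).const_smul Complex.I)

theorem contDiffAt_vertPot (hK : ContDiffAt ℝ ∞ K z.1)
    (hJ : ContDiffAt ℝ ∞ J z) : ContDiffAt ℝ ∞ (vertPot K J) z := by
  have hJ' : ContDiffAt ℝ ∞ (fderiv ℝ J) z := hJ.fderiv_right (by simp)
  have hK' : ContDiffAt ℝ ∞ (fun z : E × E => K z.1) z := hK.comp z contDiffAt_fst
  exact contDiffAt_clm_of_apply fun w => (hJ'.clm_apply contDiffAt_const).add
    ((hJ'.clm_apply (contDiffAt_const.prodMk (hK'.clm_apply contDiffAt_const))).const_smul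
      Complex.I)

theorem contDiffAt_reHorizPot (hΓ : ContDiffAt ℝ ∞ Γ z.1) (hK : ContDiffAt ℝ ∞ K z.1)
    (hJ : ContDiffAt ℝ ∞ J z) :
    ContDiffAt ℝ ∞ (fun z => Complex.reCLM.comp (horizPot Γ K J z)) z :=
  contDiffAt_clm_of_apply fun _ => Complex.reCLM.contDiff.contDiffAt.comp z
    ((contDiffAt_horizPot hΓ hK hJ).clm_apply contDiffAt_const)

theorem contDiffAt_imVertPot (hK : ContDiffAt ℝ ∞ K z.1) (hJ : ContDiffAt ℝ ∞ J z) :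
    ContDiffAt ℝ ∞ (fun z => Complex.imCLM.comp (vertPot K J z)) z :=
  contDiffAt_clm_of_apply fun _ => Complex.imCLM.contDiff.contDiffAt.comp z
    ((contDiffAt_vertPot hK hJ).clm_apply contDiffAt_const)

theorem contDiffAt_connRe (hΩ : ContDiffAt ℝ ∞ Ω z.1) (hinv : (Ω z.1).flip.IsInvertible)
    (hΓ : ContDiffAt ℝ ∞ Γ z.1) (hK : ContDiffAt ℝ ∞ K z.1) (hJ : ContDiffAt ℝ ∞ J z) :
    ContDiffAt ℝ ∞ (connRe Ω Γ K J) z := by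
  have hΓ' : ContDiffAt ℝ ∞ (fun z : E × E => Γ z.1) z :=
    ContDiffAt.comp (g := Γ) z hΓ contDiffAt_fst
  exact (hΓ'.clm_apply contDiffAt_snd).neg.add
    (contDiffAt_fibreHam hΩ hinv (contDiffAt_reHorizPot hΓ hK hJ))

theorem contDiffAt_connIm (hΩ : ContDiffAt ℝ ∞ Ω z.1) (hinv : (Ω z.1).flip.IsInvertible)
    (hK : ContDiffAt ℝ ∞ K z.1) (hJ : ContDiffAt ℝ ∞ J z) :
    ContDiffAt ℝ ∞ (connIm Ω K J) z := by
  have hK' : ContDiffAt ℝ ∞ (fun z : E × E => K z.1) z := hK.comp z contDiffAt_fst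
  exact (hK'.add (contDiffAt_fibreHam hΩ hinv (contDiffAt_imVertPot hK hJ))).const_smul _

-- The fibre derivative of the linear term `-Γ` cancels the derivative of `Ω`, because `Ω` is
-- parallel (`hpar`); the Hamiltonian term contributes nothing by `fibreHam_symplectic`.
set_option synthInstance.maxHeartbeats 400000 in
set_option maxHeartbeats 1000000 in
theorem connRe_symplectic (hΩ : ContDiffAt ℝ ∞ Ω z.1)
    (hinv : ∀ᶠ z' in 𝓝 z, (Ω z'.1).flip.IsInvertible)
    (hΓ : ContDiffAt ℝ ∞ Γ z.1) (hK : ContDiffAt ℝ ∞ K z.1) (hJ : ContDiffAt ℝ ∞ J z)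
    (skew : ∀ v v', Ω z.1 v v' = -Ω z.1 v' v)
    (hpar : ∀ a b c, fderiv ℝ Ω z.1 a b c = Ω z.1 (Γ z.1 b a) c + Ω z.1 b (Γ z.1 c a))
    (w v v' : E) :
    fderiv ℝ Ω z.1 w v v' + Ω z.1 (fderiv ℝ (connRe Ω Γ K J) z (0, v) w) v'
      + Ω z.1 v (fderiv ℝ (connRe Ω Γ K J) z (0, v') w) = 0 := by
  have hH := contDiffAt_reHorizPot hΓ hK hJ
  have hd := (contDiffAt_fibreHam hΩ hinv.self_of_nhds hH).differentiableAt (by simp)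
  have hs := fibreHam_symplectic (hΩ.differentiableAt (by simp)) hinv hH hd v v' w
  have hΓ' : HasFDerivAt (fun z : E × E => Γ z.1) _ z :=
    hasFDerivAt_comp_fst (G := E →L[ℝ] E →L[ℝ] E) (hΓ.differentiableAt (by simp))
  have h1 := (hΓ'.clm_apply hasFDerivAt_snd).neg.add hd.hasFDerivAt
  have h2 : ∀ v : E, fderiv ℝ (connRe Ω Γ K J) z (0, v) w = -Γ z.1 v w
      + fderiv ℝ (fibreHam Ω (fun z => Complex.reCLM.comp (horizPot Γ K J z))) z (0, v) w := by
    intro v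
    have h3 : HasFDerivAt (connRe Ω Γ K J) _ z := h1
    rw [h3.fderiv]
    simp
  rw [h2, h2, hpar]
  simp only [map_add, map_neg, add_apply, neg_apply]
  linear_combination hs + skew _ v'

-- The term `K` does not depend on the fibre coordinate, so only the derivative of the Hamiltonian
-- term remains.
set_option synthInstance.maxHeartbeats 400000 in
set_option maxHeartbeats 1000000 in
theorem connIm_symplectic (hΩ : ContDiffAt ℝ ∞ Ω z.1)
    (hinv : ∀ᶠ z' in 𝓝 z, (Ω z'.1).flip.IsInvertible)
    (hK : ContDiffAt ℝ ∞ K z.1) (hJ : ContDiffAt ℝ ∞ J z)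
    (skew : ∀ v v', Ω z.1 v v' = -Ω z.1 v' v) (w v v' : E) :
    Ω z.1 (fderiv ℝ (connIm Ω K J) z (0, v) w) v'
      + Ω z.1 v (fderiv ℝ (connIm Ω K J) z (0, v') w) = 0 := by
  have hH := contDiffAt_imVertPot hK hJ
  have hd := (contDiffAt_fibreHam hΩ hinv.self_of_nhds hH).differentiableAt (by simp)
  have hs := fibreHam_symplectic (hΩ.differentiableAt (by simp)) hinv hH hd v v' w
  have hK' : HasFDerivAt (fun z : E × E => K z.1) _ z :=
    hasFDerivAt_comp_fst (hK.differentiableAt (by simp))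
  have h1 := (hK'.add hd.hasFDerivAt).const_smul (-2 * Real.pi)
  have h2 : ∀ v : E, fderiv ℝ (connIm Ω K J) z (0, v) w = (-2 * Real.pi) •
      fderiv ℝ (fibreHam Ω (fun z => Complex.imCLM.comp (vertPot K J z))) z (0, v) w := by
    intro v
    have h3 : HasFDerivAt (connIm Ω K J) _ z := h1
    rw [h3.fderiv]
    simp
  rw [h2, h2]
  simp only [map_smul, smul_apply, smul_eq_mul]
  linear_combination (-2 * Real.pi) * hs + (-2 * Real.pi) * skew _ v'

end ConnCoordinates

/-! ### The affine special Kähler structure in coordinates -/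

namespace AffineSpecialKahler

open Filter Topology

variable {E : Type*} [NormedAddCommGroup E] [NormedSpace ℝ E] [FiniteDimensional ℝ E]
  {M : Type*} [TopologicalSpace M] [ChartedSpace E M] [IsManifold 𝓘(ℝ, E) ∞ M]
  (S : AffineSpecialKahler E M) (p : M)

/-- The symplectic form in the chart at `p`. -/
def formChart (x : E) : E →L[ℝ] E →L[ℝ] ℝ :=
  LinearMap.toContinuousLinearMap (LinearMap.toContinuousLinearMap.toLinearMap ∘ₗ
    LinearMap.compl₁₂ (S.form ((extChartAt 𝓘(ℝ, E) p).symm x))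
      (chartDerivSymm 𝓘(ℝ, E) p ((extChartAt 𝓘(ℝ, E) p).symm x)).toLinearMap
      (chartDerivSymm 𝓘(ℝ, E) p ((extChartAt 𝓘(ℝ, E) p).symm x)).toLinearMap)

/-- The complex structure in the chart at `p`. -/
def cxChart (x : E) : E →L[ℝ] E :=
  LinearMap.toContinuousLinearMap
    ((chartDeriv 𝓘(ℝ, E) p ((extChartAt 𝓘(ℝ, E) p).symm x)).toLinearMap ∘ₗ
      S.cx ((extChartAt 𝓘(ℝ, E) p).symm x) ∘ₗ
      (chartDerivSymm 𝓘(ℝ, E) p ((extChartAt 𝓘(ℝ, E) p).symm x)).toLinearMap)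

/-- The Christoffel symbols in the chart at `p`. -/
def christoffelChart (x : E) : E →L[ℝ] E →L[ℝ] E :=
  -- Linearity in the differentiated vector is available only over the chart domain. Expanding in a
  -- basis gives a linear map at every `x`, which agrees with `christoffel` where that matters.
  ∑ i, ((Module.finBasis ℝ E).coord i).toContinuousLinearMap.smulRight
    (christoffel S.conn p ((extChartAt 𝓘(ℝ, E) p).symm x) (Module.finBasis ℝ E i))

variable {S p} {q : M} (hq : q ∈ (chartAt E p).source)
include hq

omit [FiniteDimensional ℝ E] [IsManifold 𝓘(ℝ, E) ∞ M] in
theorem extChartAt_symm_self : (extChartAt 𝓘(ℝ, E) p).symm (extChartAt 𝓘(ℝ, E) p q) = q :=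
  (extChartAt 𝓘(ℝ, E) p).left_inv (by rwa [extChartAt_source])

theorem formChart_apply (a c : E) : S.formChart p (extChartAt 𝓘(ℝ, E) p q) a c =
    S.form q (constField p a q) (constField p c q) := by
  have h : S.formChart p (extChartAt 𝓘(ℝ, E) p q) a c = (fun q =>
      S.form q (constField p a q) (constField p c q))
        ((extChartAt 𝓘(ℝ, E) p).symm (extChartAt 𝓘(ℝ, E) p q)) := rfl
  rw [h, extChartAt_symm_self hq]

theorem form_eq_formChart (a c : TangentSpace 𝓘(ℝ, E) q) : S.form q a c =
    S.formChart p (extChartAt 𝓘(ℝ, E) p q) (chartDeriv 𝓘(ℝ, E) p q a)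
      (chartDeriv 𝓘(ℝ, E) p q c) := by
  rw [formChart_apply hq]
  simp only [constField, chartDerivSymm_deriv hq]

theorem chartDeriv_cx (a : TangentSpace 𝓘(ℝ, E) q) : chartDeriv 𝓘(ℝ, E) p q (S.cx q a) =
    S.cxChart p (extChartAt 𝓘(ℝ, E) p q) (chartDeriv 𝓘(ℝ, E) p q a) := by
  have h : ∀ b : E, S.cxChart p (extChartAt 𝓘(ℝ, E) p q) b = (fun q =>
      chartDeriv 𝓘(ℝ, E) p q (S.cx q (constField p b q)))
        ((extChartAt 𝓘(ℝ, E) p).symm (extChartAt 𝓘(ℝ, E) p q)) := fun _ => rfl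
  rw [h, extChartAt_symm_self hq]
  simp only [constField, chartDerivSymm_deriv hq]

theorem christoffelChart_apply (b a : E) : S.christoffelChart p (extChartAt 𝓘(ℝ, E) p q) b a =
    christoffel S.conn p q b a := by
  let L : E →ₗ[ℝ] E →L[ℝ] E :=
    { toFun := christoffel S.conn p q
      map_add' := christoffel_add S.conn hq
      map_smul' := christoffel_smul S.conn hq }
  have h : christoffel S.conn p q b = L (∑ i, (Module.finBasis ℝ E).repr b i •
      Module.finBasis ℝ E i) := by rw [(Module.finBasis ℝ E).sum_repr]; rfl
  rw [h, map_sum, christoffelChart, extChartAt_symm_self hq]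
  simp [L]

theorem contDiffAt_formChart : ContDiffAt ℝ ∞ (S.formChart p) (extChartAt 𝓘(ℝ, E) p q) := by
  refine contDiffAt_clm_of_apply fun a => contDiffAt_clm_of_apply fun c => ?_
  exact contDiffAt_comp_extChartAt_symm hq
    ((S.pseudoKahler.closed.smooth _ _ _ (chartAt E p).open_source (smoothField_constField p a)
      (smoothField_constField p c) q hq).contMDiffAt ((chartAt E p).open_source.mem_nhds hq))

theorem contDiffAt_cxChart : ContDiffAt ℝ ∞ (S.cxChart p) (extChartAt 𝓘(ℝ, E) p q) := by
  refine contDiffAt_clm_of_apply fun a => ?_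
  exact contDiffAt_chartField (chartAt E p).open_source
    (S.pseudoKahler.complex.smooth _ _ (chartAt E p).open_source (smoothField_constField p a)) hq hq

theorem contDiffAt_christoffelChart [T2Space M] :
    ContDiffAt ℝ ∞ (S.christoffelChart p) (extChartAt 𝓘(ℝ, E) p q) := by
  refine contDiffAt_clm_of_apply fun b => contDiffAt_clm_of_apply fun a => ?_
  simp only [christoffelChart, sum_apply, ContinuousLinearMap.smulRight_apply,
    smul_apply]
  exact ContDiffAt.sum fun i _ => (contDiffAt_comp_extChartAt_symm hq
    (contMDiffAt_christoffel S.conn S.conn_smooth hq _ a)).const_smul _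

theorem formChart_skew (a c : E) : S.formChart p (extChartAt 𝓘(ℝ, E) p q) a c =
    -S.formChart p (extChartAt 𝓘(ℝ, E) p q) c a := by
  rw [formChart_apply hq, formChart_apply hq]
  exact (LinearMap.IsAlt.neg (S.pseudoKahler.closed.alt q) _ _).symm

/-- Nondegeneracy gives injectivity, and a finite-dimensional space has the dimension of its dual.
-/
theorem isInvertible_formChart_flip :
    (S.formChart p (extChartAt 𝓘(ℝ, E) p q)).flip.IsInvertible := by
  have hinj : Function.Injective (S.formChart p (extChartAt 𝓘(ℝ, E) p q)).flip := by
    rw [injective_iff_map_eq_zero]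
    intro c hc
    have h1 : constField p c q = 0 := by
      refine (S.pseudoKahler.nondegenerate q).2 _ fun a => ?_
      rw [form_eq_formChart hq]
      have h2 := DFunLike.congr_fun hc (chartDeriv 𝓘(ℝ, E) p q a)
      rw [constField, chartDeriv_symm hq]
      exact h2
    rw [← chartDeriv_symm (I := 𝓘(ℝ, E)) hq c]
    exact (congrArg (chartDeriv 𝓘(ℝ, E) p q) h1).trans (map_zero _)
  have hfin : Module.finrank ℝ E = Module.finrank ℝ (E →L[ℝ] ℝ) := by
    rw [← (LinearMap.toContinuousLinearMap (𝕜 := ℝ) (E := E) (F' := ℝ)).finrank_eq]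
    exact (Subspace.dual_finrank_eq (K := ℝ) (V := E)).symm
  exact ⟨(LinearEquiv.ofInjectiveOfFinrankEq
    ((S.formChart p (extChartAt 𝓘(ℝ, E) p q)).flip.toLinearMap) hinj
      hfin).toContinuousLinearEquiv, rfl⟩

/-- This is ∇ω = 0, tested on the constant fields of the chart. -/
theorem fderiv_formChart (a b c : E) :
    fderiv ℝ (S.formChart p) (extChartAt 𝓘(ℝ, E) p q) a b c =
      S.formChart p (extChartAt 𝓘(ℝ, E) p q)
        (S.christoffelChart p (extChartAt 𝓘(ℝ, E) p q) b a) c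
      + S.formChart p (extChartAt 𝓘(ℝ, E) p q) b
        (S.christoffelChart p (extChartAt 𝓘(ℝ, E) p q) c a) := by
  have hd := (contDiffAt_formChart (S := S) hq).differentiableAt (by simp)
  have h := S.parallel _ (constField p a) (constField p b) (constField p c)
    (chartAt E p).open_source (smoothField_constField p a) (smoothField_constField p b)
    (smoothField_constField p c) q hq
  have h1 := mvfderiv_eq_fderiv (I := 𝓘(ℝ, E))
    (f := fun q => S.form q (constField p b q) (constField p c q))
    (g := fun x => S.formChart p x b c) hq
    ((hd.clm_apply (differentiableAt_const b)).clm_apply (differentiableAt_const c))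
    (by filter_upwards [(chartAt E p).open_source.mem_nhds hq] with x hx
        exact (formChart_apply hx b c).symm) (constField p a q)
  have h2 : fderiv ℝ (fun x => S.formChart p x b c) (extChartAt 𝓘(ℝ, E) p q) a =
      fderiv ℝ (S.formChart p) (extChartAt 𝓘(ℝ, E) p q) a b c := by
    rw [((hd.hasFDerivAt.clm_apply (hasFDerivAt_const b _)).clm_apply
      (hasFDerivAt_const c _)).fderiv]
    simp
  have h3 : ∀ b, chartDeriv 𝓘(ℝ, E) p q (constField p b q) = b := chartDeriv_symm hq
  have h4 : ∀ b, chartDeriv 𝓘(ℝ, E) p q (S.conn (constField p b) q (constField p a q)) =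
      S.christoffelChart p (extChartAt 𝓘(ℝ, E) p q) b a := fun b => by
    rw [christoffelChart_apply hq]; rfl
  rw [h3, h2] at h1
  rw [← h1, h, form_eq_formChart hq, form_eq_formChart hq, h3, h3, h4, h4]

end AffineSpecialKahler

/-! ### Complexification -/

section Complexification

variable {V W : Type*} [AddCommGroup V] [Module ℝ V] [AddCommGroup W] [Module ℝ W]

@[simp] theorem rePart_tmul (z : ℂ) (a : V) : rePart (z ⊗ₜ[ℝ] a) = z.re • a := by simp [rePart]

@[simp] theorem imPart_tmul (z : ℂ) (a : V) : imPart (z ⊗ₜ[ℝ] a) = z.im • a := by simp [imPart]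

@[simp] theorem conj_tmul (z : ℂ) (a : V) :
    conj (z ⊗ₜ[ℝ] a) = (starRingEnd ℂ z) ⊗ₜ[ℝ] a := by simp [conj]

@[simp] theorem rePart_mkC (a b : V) : rePart (mkC a b) = a := by simp [mkC]

@[simp] theorem imPart_mkC (a b : V) : imPart (mkC a b) = b := by simp [mkC]

@[simp] theorem conj_mkC (a b : V) : conj (mkC a b) = mkC a (-b) := by
  simp [mkC, TensorProduct.neg_tmul, TensorProduct.tmul_neg]

theorem mkC_add (a b a' b' : V) : mkC a b + mkC a' b' = mkC (a + a') (b + b') := by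
  simp only [mkC, TensorProduct.tmul_add]; abel

theorem mkC_neg (a b : V) : -mkC a b = mkC (-a) (-b) := by
  simp only [mkC, TensorProduct.tmul_neg]; abel

theorem mkC_sub (a b a' b' : V) : mkC a b - mkC a' b' = mkC (a - a') (b - b') := by
  rw [sub_eq_add_neg, mkC_neg, mkC_add, sub_eq_add_neg, sub_eq_add_neg]

theorem smul_mkC (z : ℂ) (a b : V) :
    z • mkC a b = mkC (z.re • a - z.im • b) (z.im • a + z.re • b) := by
  have h1 : z ⊗ₜ[ℝ] a = mkC (z.re • a) (z.im • a) := by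
    conv_lhs => rw [← Complex.re_add_im z]
    rw [mkC, TensorProduct.add_tmul, TensorProduct.tmul_smul, TensorProduct.tmul_smul,
      TensorProduct.smul_tmul', TensorProduct.smul_tmul']
    simp
  have h2 : (z * Complex.I) ⊗ₜ[ℝ] b = mkC (-z.im • b) (z.re • b) := by
    have h3 : z * Complex.I = (-z.im : ℝ) • (1 : ℂ) + z.re • Complex.I := by
      apply Complex.ext <;> simp
    rw [h3, mkC, TensorProduct.add_tmul, TensorProduct.tmul_smul, TensorProduct.tmul_smul,
      TensorProduct.smul_tmul', TensorProduct.smul_tmul']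
  rw [mkC, smul_add, TensorProduct.smul_tmul', TensorProduct.smul_tmul', smul_eq_mul, smul_eq_mul,
    mul_one, h1, h2, mkC_add, neg_smul, sub_eq_add_neg]

theorem mkC_rePart_imPart (x : ℂ ⊗[ℝ] V) : mkC (rePart x) (imPart x) = x := by
  induction x using TensorProduct.induction_on with
  | zero => simp [mkC]
  | tmul z v =>
    have h : z ⊗ₜ[ℝ] v = z • mkC v 0 := by
      simp [mkC, TensorProduct.smul_tmul']
    rw [h, smul_mkC]
    simp
  | add x y hx hy => rw [map_add, map_add, ← mkC_add, hx, hy]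

theorem complexification_ext {x y : ℂ ⊗[ℝ] V} (h₁ : rePart x = rePart y)
    (h₂ : imPart x = imPart y) : x = y := by
  rw [← mkC_rePart_imPart x, h₁, h₂, mkC_rePart_imPart]

@[simp] theorem baseChange_mkC (f : V →ₗ[ℝ] W) (a b : V) :
    f.baseChange ℂ (mkC a b) = mkC (f a) (f b) := by simp [mkC]

theorem rePart_baseChange (f : V →ₗ[ℝ] W) (x : ℂ ⊗[ℝ] V) :
    rePart (f.baseChange ℂ x) = f (rePart x) := by
  rw [← mkC_rePart_imPart x]; simp

@[simp] theorem rePart_conj (x : ℂ ⊗[ℝ] V) : rePart (conj x) = rePart x := by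
  rw [← mkC_rePart_imPart x]; simp

@[simp] theorem imPart_conj (x : ℂ ⊗[ℝ] V) : imPart (conj x) = -imPart x := by
  rw [← mkC_rePart_imPart x]; simp

theorem rePart_smul (z : ℂ) (x : ℂ ⊗[ℝ] V) :
    rePart (z • x) = z.re • rePart x - z.im • imPart x := by
  conv_lhs => rw [← mkC_rePart_imPart x, smul_mkC, rePart_mkC]

theorem imPart_smul (z : ℂ) (x : ℂ ⊗[ℝ] V) :
    imPart (z • x) = z.im • rePart x + z.re • imPart x := by
  conv_lhs => rw [← mkC_rePart_imPart x, smul_mkC, imPart_mkC]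

theorem baseChange_bilin_mkC (B : LinearMap.BilinForm ℝ V) (a b c d : V) :
    B.baseChange ℂ (mkC a b) (mkC c d) =
      ((B a c - B b d : ℝ) : ℂ) + ((B a d + B b c : ℝ) : ℂ) * Complex.I := by
  simp only [mkC, map_add, LinearMap.add_apply, LinearMap.BilinForm.baseChange_tmul]
  apply Complex.ext <;> simp <;> ring

/-- A complex subspace which is the graph of a real endomorphism `K` with `K² = -1` is the
`-i`-eigenspace of `K`. -/
theorem almostComplexOf_eq {D : Submodule ℂ (ℂ ⊗[ℝ] V)} {K : V →ₗ[ℝ] V} (hK : ∀ u, K (K u) = -u)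
    (hD : ∀ x, x ∈ D ↔ imPart x = K (rePart x)) : almostComplexOf D = K := by
  have hmem : ∀ x ∈ D.map conj, imPart x = -K (rePart x) := by
    rintro _ ⟨y, hy, rfl⟩
    rw [rePart_conj, imPart_conj, (hD y).1 hy]
  have hdec : ∀ x : ℂ ⊗[ℝ] V, ∃ d ∈ D, ∃ d' ∈ D.map conj, x = d + d' ∧
      imPart d = (1 / 2 : ℝ) • (K (rePart x) + imPart x) := by
    intro x
    -- The component of x in the -i-eigenspace is (x + iKx)/2, and its complement is (x - iKx)/2,
    -- written as the conjugate of an element of `D`.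
    refine ⟨mkC ((1 / 2 : ℝ) • (rePart x - K (imPart x)))
        ((1 / 2 : ℝ) • (K (rePart x) + imPart x)), ?_,
      conj (mkC ((1 / 2 : ℝ) • (rePart x + K (imPart x)))
        ((1 / 2 : ℝ) • (K (rePart x) - imPart x))), ⟨_, ?_, rfl⟩, ?_, by simp⟩
    · rw [hD]; simp [hK]
    · rw [SetLike.mem_coe, hD]; simp [hK, sub_eq_add_neg]
    · conv_lhs => rw [← mkC_rePart_imPart x]
      rw [conj_mkC, mkC_add]
      congr 1 <;> module
  have hc : IsCompl D (D.map conj) := by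
    refine IsCompl.of_le ?_ ?_
    · rintro x ⟨h1, h2⟩
      have h3 := (hD x).1 h1
      have h4 := hmem x h2
      have h5 : K (rePart x) = 0 := by
        have h6 : (2 : ℝ) • K (rePart x) = 0 := by
          rw [two_smul]
          nth_rewrite 1 [h3.symm.trans h4]
          exact neg_add_cancel _
        exact (smul_eq_zero.1 h6).resolve_left two_ne_zero
      have h6 : rePart x = 0 := by
        rw [← neg_eq_zero, ← hK, h5, map_zero]
      rw [Submodule.mem_bot, ← mkC_rePart_imPart x, h3, h5, h6]
      simp [mkC]
    · rintro x -
      obtain ⟨d, hd, d', hd', rfl, -⟩ := hdec x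
      exact Submodule.add_mem_sup hd hd'
  ext u
  rw [almostComplexOf, dif_pos hc]
  obtain ⟨d, hd, d', hd', hx, him⟩ := hdec ((1 : ℂ) ⊗ₜ[ℝ] u)
  have h1 : D.projection (D.map conj) hc ((1 : ℂ) ⊗ₜ[ℝ] u) = d := by
    rw [hx, map_add, Submodule.projection_apply_of_mem_left hc hd,
      Submodule.projection_apply_of_mem_right hc hd', add_zero]
  simp only [LinearMap.smul_apply, LinearMap.comp_apply, LinearMap.restrictScalars_apply,
    TensorProduct.mk_apply, h1, him]
  simp

/-- The almost complex structure defined by the range of a complex-linear map. -/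
theorem almostComplexOf_range {A : ℂ ⊗[ℝ] W →ₗ[ℂ] ℂ ⊗[ℝ] V} {K : V →ₗ[ℝ] V} {P Q : W →ₗ[ℝ] V}
    (hA : ∀ w, A ((1 : ℂ) ⊗ₜ[ℝ] w) = mkC (P w) (Q w)) (hP : ∀ w, K (P w) = Q w)
    (hQ : ∀ w, K (Q w) = -P w) (hs : ∀ u, ∃ a b, P a - Q b = u) :
    almostComplexOf (LinearMap.range A) = K := by
  have hA' : ∀ a b, A (mkC a b) = mkC (P a - Q b) (Q a + P b) := fun a b => by
    have h : mkC a b = (1 : ℂ) ⊗ₜ[ℝ] a + Complex.I • ((1 : ℂ) ⊗ₜ[ℝ] b) := by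
      simp [mkC, TensorProduct.smul_tmul']
    rw [h, map_add, map_smul, hA, hA, smul_mkC, mkC_add]
    simp [sub_eq_add_neg]
  refine almostComplexOf_eq (fun u => ?_) fun x => ⟨?_, fun hx => ?_⟩
  · obtain ⟨a, b, rfl⟩ := hs u
    simp only [map_sub, hP, hQ, map_neg]
    abel
  · rintro ⟨y, rfl⟩
    rw [← mkC_rePart_imPart y, hA']
    simp [hP, hQ]
  -- A point of the graph of `K` is determined by its real part, so it is enough to hit the real
  -- part.
  · obtain ⟨a, b, h⟩ := hs (rePart x)
    refine ⟨mkC a b, ?_⟩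
    rw [hA', ← mkC_rePart_imPart x, hx, ← h]
    simp [hP, hQ]

theorem coe_projHol_tmul {I : V →ₗ[ℝ] V} (hI : ∀ u, I (I u) = -u) (w : V) :
    (projHol I hI ((1 : ℂ) ⊗ₜ[ℝ] w) : ℂ ⊗[ℝ] V) = mkC ((1 / 2 : ℝ) • w) (-(1 / 2 : ℝ) • I w) := by
  have h : (projHol I hI ((1 : ℂ) ⊗ₜ[ℝ] w) : ℂ ⊗[ℝ] V) =
    (1 / 2 : ℂ) • ((1 : ℂ) ⊗ₜ[ℝ] w - Complex.I • (I.baseChange ℂ ((1 : ℂ) ⊗ₜ[ℝ] w))) := rfl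
  refine h.trans (complexification_ext ?_ ?_)
  · simp [rePart_smul]
  · simp [imPart_smul, rePart_smul]

/-- A vector of type (1,0) is determined by its real part. This lets statements about T^{1,0}M be
tested on real vectors. -/
theorem holPart_eq_projHol {I : V →ₗ[ℝ] V} (hI : ∀ u, I (I u) = -u) (X : holPart I) :
    X = projHol I hI ((1 : ℂ) ⊗ₜ[ℝ] ((2 : ℝ) • rePart (X : ℂ ⊗[ℝ] V))) := by
  have h := Module.End.mem_eigenspace_iff.1 X.2
  have h1 := congrArg rePart h
  rw [rePart_baseChange, rePart_smul] at h1
  ext1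
  rw [coe_projHol_tmul]
  refine complexification_ext ?_ ?_
  · simp
  · simp [h1]

theorem projHol_complex {I : V →ₗ[ℝ] V} (hI : ∀ u, I (I u) = -u) (w : V) :
    projHol I hI ((1 : ℂ) ⊗ₜ[ℝ] I w) = Complex.I • projHol I hI ((1 : ℂ) ⊗ₜ[ℝ] w) := by
  ext1
  rw [Submodule.coe_smul, coe_projHol_tmul, coe_projHol_tmul, smul_mkC]
  simp [hI]

end Complexification

/-! ### The real splitting defined by a special Joyce structure -/

namespace AlmostSpecialJoyce

variable {E : Type*} [NormedAddCommGroup E] [NormedSpace ℝ E] [FiniteDimensional ℝ E]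
  {M : Type*} [TopologicalSpace M] [ChartedSpace E M] [IsManifold 𝓘(ℝ, E) ∞ M]
  {S : AffineSpecialKahler E M} (𝒥 : AlmostSpecialJoyce S) (V : TangentBundle 𝓘(ℝ, E) M)

variable (S) in
/-- The vector `(w - i I w) / 2` for a real vector `w`. -/
def hol : TangentSpace 𝓘(ℝ, E) V.proj →ₗ[ℝ] holPart (S.cx V.proj) :=
  (toHol (S := S) V).restrictScalars ℝ ∘ₗ TensorProduct.mk ℝ ℂ _ 1

variable (S) in
theorem hol_coe (w : TangentSpace 𝓘(ℝ, E) V.proj) :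
    (hol S V w : ℂ ⊗[ℝ] TangentSpace 𝓘(ℝ, E) V.proj) =
      mkC ((1 / 2 : ℝ) • w) (-(1 / 2 : ℝ) • S.cx V.proj w) :=
  coe_projHol_tmul (S.pseudoKahler.complex.sq V.proj) w

variable (S) in
theorem hol_cx (w : TangentSpace 𝓘(ℝ, E) V.proj) :
    hol S V (S.cx V.proj w) = Complex.I • hol S V w :=
  projHol_complex (S.pseudoKahler.complex.sq V.proj) w

theorem exists_hol (X : holPart (S.cx V.proj)) : ∃ w, X = hol S V w :=
  ⟨_, holPart_eq_projHol (S.pseudoKahler.complex.sq V.proj) X⟩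

/-- The real vector `2 Re h_X` for `X = (w - i I w) / 2`. -/
def realH : TangentSpace 𝓘(ℝ, E) V.proj →ₗ[ℝ] TangentSpace (𝓘(ℝ, E)).tangent V :=
  (2 : ℝ) • (rePart ∘ₗ (𝒥.h V).restrictScalars ℝ ∘ₗ hol S V)

/-- The real vertical vector `2 Re v_X` for `X = (w - i I w) / 2`. -/
def realV : TangentSpace 𝓘(ℝ, E) V.proj →ₗ[ℝ] vert V where
  toFun w := (2 : ℝ) • rePart (𝒥.v V (hol S V w))
  map_add' a b := by simp only [map_add, smul_add]
  map_smul' t a := by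
    have h : hol S V (t • a) = (t : ℂ) • hol S V a := by
      rw [map_smul]; rfl
    rw [h, map_smulₛₗ, rePart_smul]
    simp only [Complex.ofReal_re, Complex.ofReal_im, Complex.conj_ofReal, zero_smul, sub_zero]
    exact smul_comm _ _ _

/-- Replacing w by Iw multiplies X by i. Complex-linearity of h therefore expresses Im h_X through
the real part at Iw; for the antilinear v the sign is opposite, as in `v_hol`. -/
theorem h_hol (w : TangentSpace 𝓘(ℝ, E) V.proj) : 𝒥.h V (hol S V w) =
    mkC ((1 / 2 : ℝ) • 𝒥.realH V w) (-(1 / 2 : ℝ) • 𝒥.realH V (S.cx V.proj w)) := by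
  have h1 : ∀ w, 𝒥.realH V w = (2 : ℝ) • rePart (𝒥.h V (hol S V w)) := fun _ => rfl
  refine complexification_ext ?_ ?_
  · simp [h1]
  · rw [imPart_mkC, h1, hol_cx, map_smul, rePart_smul]
    simp

theorem v_hol (w : TangentSpace 𝓘(ℝ, E) V.proj) : 𝒥.v V (hol S V w) =
    mkC ((1 / 2 : ℝ) • 𝒥.realV V w) ((1 / 2 : ℝ) • 𝒥.realV V (S.cx V.proj w)) := by
  have h1 : ∀ w, 𝒥.realV V w = (2 : ℝ) • rePart (𝒥.v V (hol S V w)) := fun _ => rfl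
  refine complexification_ext ?_ ?_
  · simp [h1]
  · rw [imPart_mkC, h1, hol_cx, map_smulₛₗ, rePart_smul]
    simp

theorem vN_hol (w : TangentSpace 𝓘(ℝ, E) V.proj) : 𝒥.vN V (hol S V w) =
    mkC ((1 / 2 : ℝ) • (𝒥.realV V w : TangentSpace (𝓘(ℝ, E)).tangent V))
      ((1 / 2 : ℝ) • (𝒥.realV V (S.cx V.proj w) : TangentSpace (𝓘(ℝ, E)).tangent V)) := by
  have h : 𝒥.vN V (hol S V w) = vertIncl V (𝒥.v V (hol S V w)) := rfl
  rw [h, v_hol, vertIncl, baseChange_mkC]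
  simp

theorem dproj_realH (w : TangentSpace 𝓘(ℝ, E) V.proj) : dproj V (𝒥.realH V w) = w := by
  have h1 : 𝒥.realH V w = (2 : ℝ) • rePart (𝒥.h V (hol S V w)) := rfl
  rw [h1, map_smul, ← rePart_baseChange, 𝒥.dproj_h, hol_coe, rePart_mkC]
  simp

/-- The map `(w, w') ↦ 2 Re (h_X + v_X')` for `X = (w - i I w) / 2`, `X' = (w' - i I w') / 2`. -/
def splitMap : TangentSpace 𝓘(ℝ, E) V.proj × TangentSpace 𝓘(ℝ, E) V.proj →ₗ[ℝ]
    TangentSpace (𝓘(ℝ, E)).tangent V :=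
  (𝒥.realH V).coprod ((vert V).subtype ∘ₗ 𝒥.realV V)

/-- A real vector is a sum of elements of the four images, and the real part of each of them is a
multiple of some R_w or V_w. Injectivity then follows by counting dimensions. -/
theorem splitMap_surjective : Function.Surjective (𝒥.splitMap V) := by
  rw [← LinearMap.range_eq_top, eq_top_iff]
  rintro t -
  have hH : ∀ w, 𝒥.realH V w ∈ LinearMap.range (𝒥.splitMap V) := fun w => ⟨(w, 0), by
    simp [splitMap]⟩
  have hV : ∀ w, (𝒥.realV V w : TangentSpace (𝓘(ℝ, E)).tangent V) ∈
    LinearMap.range (𝒥.splitMap V) := fun w => ⟨(0, w), by simp [splitMap]⟩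
  have hh : ∀ X, rePart (𝒥.h V X) ∈ LinearMap.range (𝒥.splitMap V) := fun X => by
    obtain ⟨w, rfl⟩ := exists_hol V X
    rw [h_hol, rePart_mkC]
    exact Submodule.smul_mem _ _ (hH w)
  have hv : ∀ X, rePart (𝒥.vN V X) ∈ LinearMap.range (𝒥.splitMap V) := fun X => by
    obtain ⟨w, rfl⟩ := exists_hol V X
    rw [vN_hol, rePart_mkC]
    exact Submodule.smul_mem _ _ (hV w)
  have htop := (𝒥.nondegenerate V).submodule_iSup_eq_top
  have hmem : (1 : ℂ) ⊗ₜ[ℝ] t ∈ iSup ![LinearMap.range (𝒥.h V),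
      (LinearMap.range (𝒥.h V)).map conj, LinearMap.range ((vertIncl V).comp (𝒥.v V)),
      (LinearMap.range ((vertIncl V).comp (𝒥.v V))).map conj] := htop ▸ Submodule.mem_top
  have key : rePart ((1 : ℂ) ⊗ₜ[ℝ] t) ∈ LinearMap.range (𝒥.splitMap V) := by
    refine Submodule.iSup_induction _
      (motive := fun x => rePart x ∈ LinearMap.range (𝒥.splitMap V)) hmem ?_ (by simp) ?_
    · intro i x hx
      fin_cases i
      · obtain ⟨X, rfl⟩ := hx
        exact hh X
      · obtain ⟨_, ⟨X, rfl⟩, rfl⟩ := hx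
        rw [rePart_conj]
        exact hh X
      · obtain ⟨X, rfl⟩ := hx
        exact hv X
      · obtain ⟨_, ⟨X, rfl⟩, rfl⟩ := hx
        rw [rePart_conj]
        exact hv X
    · intro x y hx hy
      rw [map_add]
      exact Submodule.add_mem _ hx hy
  simpa using key

theorem splitMap_injective : Function.Injective (𝒥.splitMap V) := by
  have h : Module.finrank ℝ (TangentSpace 𝓘(ℝ, E) V.proj × TangentSpace 𝓘(ℝ, E) V.proj) =
      Module.finrank ℝ (TangentSpace (𝓘(ℝ, E)).tangent V) := rfl
  exact (LinearMap.injective_iff_surjective_of_finrank_eq_finrank h).2 (𝒥.splitMap_surjective V)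

/-- The isomorphism of `T_V N` with two copies of `T_π(V) M` given by `Re h` and `Re v`. -/
def split : (TangentSpace 𝓘(ℝ, E) V.proj × TangentSpace 𝓘(ℝ, E) V.proj) ≃ₗ[ℝ]
    TangentSpace (𝓘(ℝ, E)).tangent V :=
  LinearEquiv.ofBijective (𝒥.splitMap V) ⟨𝒥.splitMap_injective V, 𝒥.splitMap_surjective V⟩

theorem split_apply (w w' : TangentSpace 𝓘(ℝ, E) V.proj) : 𝒥.split V (w, w') =
    𝒥.realH V w + (𝒥.realV V w' : TangentSpace (𝓘(ℝ, E)).tangent V) := by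
  simp [split, splitMap]

/-- As dπ(R_w) = w and V_{w'} is vertical, a vertical vector has no R-component in the splitting. -/
theorem realV_bijective : Function.Bijective (𝒥.realV V) := by
  refine ⟨fun a b h => ?_, fun u => ?_⟩
  · have h1 : 𝒥.split V (0, a) = 𝒥.split V (0, b) := by rw [split_apply, split_apply, h]
    exact congrArg Prod.snd ((𝒥.split V).injective h1)
  · obtain ⟨⟨w, w'⟩, h⟩ := (𝒥.split V).surjective u
    rw [split_apply] at h
    have h1 := congrArg (dproj V) h
    rw [map_add, dproj_realH, LinearMap.mem_ker.1 (𝒥.realV V w').2, LinearMap.mem_ker.1 u.2,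
      add_zero] at h1
    refine ⟨w', Subtype.ext ?_⟩
    rw [← h, h1, map_zero, zero_add]

/-! ### The connections 𝒜^ζ and the three complex structures in the splitting. -/

theorem connection_tmul (ζ : ℂ) (w : TangentSpace 𝓘(ℝ, E) V.proj) :
    𝒥.connection ζ V ((1 : ℂ) ⊗ₜ[ℝ] w) = 𝒥.h V (hol S V w) - ζ⁻¹ • conj (𝒥.vN V (hol S V w))
      + (conj (𝒥.h V (hol S V w)) + ζ • 𝒥.vN V (hol S V w)) := by
  simp [connection, hol]

/-- For ζ = i one has -ζ⁻¹ = ζ = i, so a real vector w is sent to (h + h̄) + i(v + v̄). -/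
theorem connection_I (w : TangentSpace 𝓘(ℝ, E) V.proj) :
    𝒥.connection Complex.I V ((1 : ℂ) ⊗ₜ[ℝ] w) =
      mkC (𝒥.realH V w) (𝒥.realV V w : TangentSpace (𝓘(ℝ, E)).tangent V) := by
  rw [connection_tmul, h_hol, vN_hol, conj_mkC, conj_mkC, smul_mkC, smul_mkC, mkC_sub, mkC_add,
    mkC_add]
  simp only [Complex.inv_I, Complex.neg_re, Complex.neg_im, Complex.I_re, Complex.I_im]
  congr 1 <;> module

/-- Here v - v̄ = 2i Im v appears, and antilinearity turns 2 Im v into V_{Iw}. On real vectors the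
connection for ζ = 1 is conjugate to that for ζ = -1, which defines I₂; it is the one that will
produce ω₁. -/
theorem connection_one (w : TangentSpace 𝓘(ℝ, E) V.proj) :
    𝒥.connection 1 V ((1 : ℂ) ⊗ₜ[ℝ] w) = mkC (𝒥.realH V w)
      (𝒥.realV V (S.cx V.proj w) : TangentSpace (𝓘(ℝ, E)).tangent V) := by
  rw [connection_tmul, h_hol, vN_hol, conj_mkC, conj_mkC, smul_mkC, smul_mkC, mkC_sub, mkC_add,
    mkC_add]
  simp only [inv_one, Complex.one_re, Complex.one_im]
  congr 1 <;> module

theorem connection_neg_one (w : TangentSpace 𝓘(ℝ, E) V.proj) :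
    𝒥.connection (-1) V ((1 : ℂ) ⊗ₜ[ℝ] w) = mkC (𝒥.realH V w)
      (-(𝒥.realV V (S.cx V.proj w) : TangentSpace (𝓘(ℝ, E)).tangent V)) := by
  rw [connection_tmul, h_hol, vN_hol, conj_mkC, conj_mkC, smul_mkC, smul_mkC, mkC_sub, mkC_add,
    mkC_add]
  have h : (-1 : ℂ)⁻¹ = -1 := by norm_num
  simp only [h, Complex.neg_re, Complex.neg_im, Complex.one_re, Complex.one_im]
  congr 1 <;> module

theorem connectionZero_tmul (w : TangentSpace 𝓘(ℝ, E) V.proj) :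
    𝒥.connectionZero V ((1 : ℂ) ⊗ₜ[ℝ] w) =
      mkC ((1 / 2 : ℝ) • (𝒥.realH V w - (𝒥.realV V w : TangentSpace (𝓘(ℝ, E)).tangent V)))
        ((1 / 2 : ℝ) • (𝒥.realH V (S.cx V.proj w)
          + (𝒥.realV V (S.cx V.proj w) : TangentSpace (𝓘(ℝ, E)).tangent V))) := by
  have h : 𝒥.connectionZero V ((1 : ℂ) ⊗ₜ[ℝ] w) =
      -conj (𝒥.vN V (hol S V w)) + conj (𝒥.h V (hol S V w)) := by
    simp [connectionZero, hol]
  rw [h, h_hol, vN_hol, conj_mkC, conj_mkC, mkC_neg, mkC_add]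
  congr 1 <;> module

/-- A linear endomorphism of `T_V N` in terms of the splitting. -/
def endoOfSplit (L : TangentSpace 𝓘(ℝ, E) V.proj × TangentSpace 𝓘(ℝ, E) V.proj →ₗ[ℝ]
    TangentSpace 𝓘(ℝ, E) V.proj × TangentSpace 𝓘(ℝ, E) V.proj) :
    TangentSpace (𝓘(ℝ, E)).tangent V →ₗ[ℝ] TangentSpace (𝓘(ℝ, E)).tangent V :=
  (𝒥.split V).toLinearMap ∘ₗ L ∘ₗ (𝒥.split V).symm.toLinearMap

theorem endoOfSplit_split (L : TangentSpace 𝓘(ℝ, E) V.proj × TangentSpace 𝓘(ℝ, E) V.proj →ₗ[ℝ]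
    TangentSpace 𝓘(ℝ, E) V.proj × TangentSpace 𝓘(ℝ, E) V.proj)
    (a : TangentSpace 𝓘(ℝ, E) V.proj × TangentSpace 𝓘(ℝ, E) V.proj) :
    𝒥.endoOfSplit V L (𝒥.split V a) = 𝒥.split V (L a) := by
  simp [endoOfSplit]

theorem realH_eq_split (w : TangentSpace 𝓘(ℝ, E) V.proj) : 𝒥.realH V w = 𝒥.split V (w, 0) := by
  simp [split_apply]

theorem realV_eq_split (w : TangentSpace 𝓘(ℝ, E) V.proj) :
    (𝒥.realV V w : TangentSpace (𝓘(ℝ, E)).tangent V) = 𝒥.split V (0, w) := by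
  simp [split_apply]

/-- The -i-eigenspace is spanned by the vectors R_w + i V_w, so I₁ sends R_w to V_w. I₂ is found in
the same way from R_w - i V_{Iw}. -/
theorem I₁_split (w w' : TangentSpace 𝓘(ℝ, E) V.proj) :
    𝒥.I₁ V (𝒥.split V (w, w')) = 𝒥.split V (-w', w) := by
  have h : 𝒥.I₁ V = 𝒥.endoOfSplit V ((-LinearMap.snd ℝ _ _).prod (LinearMap.fst ℝ _ _)) := by
    refine almostComplexOf_range (P := 𝒥.realH V) (Q := (vert V).subtype ∘ₗ 𝒥.realV V)
      (𝒥.connection_I V) (fun w => ?_) (fun w => ?_) (fun u => ?_)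
    · simp [realH_eq_split, realV_eq_split, endoOfSplit_split]
    · simp only [LinearMap.comp_apply, Submodule.subtype_apply]
      rw [realH_eq_split, realV_eq_split, endoOfSplit_split, ← map_neg]
      simp
    · obtain ⟨⟨a, b⟩, rfl⟩ := (𝒥.split V).surjective u
      exact ⟨a, -b, by simp [split_apply]⟩
  rw [h, endoOfSplit_split]
  simp

theorem I₂_split (w w' : TangentSpace 𝓘(ℝ, E) V.proj) :
    𝒥.I₂ V (𝒥.split V (w, w')) = 𝒥.split V (-S.cx V.proj w', -S.cx V.proj w) := by
  have hsq := S.pseudoKahler.complex.sq V.proj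
  have h : 𝒥.I₂ V = 𝒥.endoOfSplit V
      ((-(S.cx V.proj) ∘ₗ LinearMap.snd ℝ _ _).prod (-(S.cx V.proj) ∘ₗ LinearMap.fst ℝ _ _)) := by
    refine almostComplexOf_range (P := 𝒥.realH V)
      (Q := -((vert V).subtype ∘ₗ 𝒥.realV V ∘ₗ S.cx V.proj))
      (𝒥.connection_neg_one V) (fun w => ?_) (fun w => ?_) (fun u => ?_)
    · simp only [LinearMap.comp_apply, Submodule.subtype_apply, LinearMap.neg_apply]
      rw [realH_eq_split, realV_eq_split, endoOfSplit_split, ← map_neg]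
      simp
    · simp only [LinearMap.comp_apply, Submodule.subtype_apply, LinearMap.neg_apply]
      rw [realH_eq_split, realV_eq_split, map_neg, endoOfSplit_split]
      exact congrArg (fun x => -(𝒥.split V x)) (Prod.ext (by simp [hsq]) (by simp))
    · obtain ⟨⟨a, b⟩, rfl⟩ := (𝒥.split V).surjective u
      exact ⟨a, -S.cx V.proj b, by simp [split_apply, hsq]⟩
  rw [h, endoOfSplit_split]
  simp

/-- Im 𝒜^0 is the sum of the images of h̄ and v̄, so h_X and v_X are of type (1,0) for I₃.
Multiplying them by i amounts to w ↦ Iw for the complex-linear h and to w ↦ -Iw for the antilinear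
v. -/
theorem I₃_split (w w' : TangentSpace 𝓘(ℝ, E) V.proj) :
    𝒥.I₃ V (𝒥.split V (w, w')) = 𝒥.split V (S.cx V.proj w, -S.cx V.proj w') := by
  have hsq := S.pseudoKahler.complex.sq V.proj
  have h : 𝒥.I₃ V = 𝒥.endoOfSplit V
      ((S.cx V.proj ∘ₗ LinearMap.fst ℝ _ _).prod (-(S.cx V.proj) ∘ₗ LinearMap.snd ℝ _ _)) := by
    refine almostComplexOf_range
      (P := (1 / 2 : ℝ) • (𝒥.realH V - (vert V).subtype ∘ₗ 𝒥.realV V))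
      (Q := (1 / 2 : ℝ) • (𝒥.realH V ∘ₗ S.cx V.proj +
        (vert V).subtype ∘ₗ 𝒥.realV V ∘ₗ S.cx V.proj))
      (𝒥.connectionZero_tmul V) (fun w => ?_) (fun w => ?_) (fun u => ?_)
    · simp only [LinearMap.comp_apply, Submodule.subtype_apply, LinearMap.smul_apply,
        LinearMap.sub_apply, LinearMap.add_apply, map_smul]
      rw [realH_eq_split, realV_eq_split, realH_eq_split, realV_eq_split, ← map_sub,
        endoOfSplit_split, ← map_add]
      simp
    · simp only [LinearMap.comp_apply, Submodule.subtype_apply, LinearMap.smul_apply,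
        LinearMap.sub_apply, LinearMap.add_apply, map_smul]
      rw [realH_eq_split, realV_eq_split, realH_eq_split, realV_eq_split, ← map_sub,
        ← map_add, endoOfSplit_split, ← smul_neg, ← map_neg]
      simp [hsq]
    · obtain ⟨⟨a, b⟩, rfl⟩ := (𝒥.split V).surjective u
      -- In the splitting P x = (x, -x)/2 and Q y = (Iy, Iy)/2; the witnesses solve P x - Q y = (a,
      -- b).
      refine ⟨a - b, S.cx V.proj (a + b), ?_⟩
      simp only [LinearMap.comp_apply, Submodule.subtype_apply, LinearMap.smul_apply,
        LinearMap.sub_apply, LinearMap.add_apply, hsq]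
      rw [realH_eq_split, realV_eq_split, realH_eq_split, realV_eq_split, ← map_sub, ← map_add,
        ← map_smul, ← map_smul, ← map_sub]
      congr 1
      ext1 <;> simp <;> module
  rw [h, endoOfSplit_split]
  simp

end AlmostSpecialJoyce

/-! ### The form `ω₃` and the pointwise hyperkähler relations -/

theorem nondegenerate_of_isAlt {W : Type*} [AddCommGroup W] [Module ℝ W]
    {B : LinearMap.BilinForm ℝ W} (hB : B.IsAlt) (h : ∀ a, (∀ b, B a b = 0) → a = 0) :
    B.Nondegenerate :=
  (LinearMap.IsRefl.nondegenerate_iff_separatingLeft (LinearMap.IsAlt.isRefl hB)).2 h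

namespace AlmostSpecialJoyce

variable {E : Type*} [NormedAddCommGroup E] [NormedSpace ℝ E] [FiniteDimensional ℝ E]
  {M : Type*} [TopologicalSpace M] [ChartedSpace E M] [IsManifold 𝓘(ℝ, E) ∞ M]
  {S : AffineSpecialKahler E M} (𝒥 : AlmostSpecialJoyce S) (V : TangentBundle 𝓘(ℝ, E) M)

theorem vertForm_alt : (S.vertForm V).IsAlt := fun u =>
  S.pseudoKahler.closed.alt V.proj ((nu V).symm u)

theorem vertForm_separatingLeft : (S.vertForm V).SeparatingLeft := fun u hu => by
  have h := (S.pseudoKahler.nondegenerate V.proj).1 ((nu V).symm u) fun w => by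
    have := hu (nu V w)
    rwa [AffineSpecialKahler.vertForm, LinearMap.BilinForm.comp_apply, LinearEquiv.coe_coe,
      LinearEquiv.symm_apply_apply] at this
  exact (nu V).symm.map_eq_zero_iff.1 h

/-- The form `-1/(4π²) ω^ν` in terms of `Re v`. -/
def sigma : LinearMap.BilinForm ℝ (TangentSpace 𝓘(ℝ, E) V.proj) :=
  (-(1 / (4 * Real.pi ^ 2))) • (S.vertForm V).comp (𝒥.realV V) (𝒥.realV V)

theorem sigma_apply (w u : TangentSpace 𝓘(ℝ, E) V.proj) : 𝒥.sigma V w u =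
    -(1 / (4 * Real.pi ^ 2)) * S.vertForm V (𝒥.realV V w) (𝒥.realV V u) := rfl

theorem sigma_self (w : TangentSpace 𝓘(ℝ, E) V.proj) : 𝒥.sigma V w w = 0 := by
  rw [sigma_apply, vertForm_alt, mul_zero]

theorem sigma_swap (w u : TangentSpace 𝓘(ℝ, E) V.proj) :
    𝒥.sigma V w u = -𝒥.sigma V u w :=
  (LinearMap.IsAlt.neg (B := 𝒥.sigma V) (𝒥.sigma_self V) u w).symm

theorem sigma_separatingLeft : (𝒥.sigma V).SeparatingLeft := fun w hw => by
  have hpi := Real.pi_ne_zero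
  refine (𝒥.realV_bijective V).1 ((vertForm_separatingLeft (S := S) V _ fun u => ?_).trans
    (map_zero _).symm)
  obtain ⟨u, rfl⟩ := (𝒥.realV_bijective V).2 u
  refine (mul_eq_zero.1 (hw u)).resolve_left (neg_ne_zero.2 (one_div_ne_zero ?_))
  positivity

/-- The 2-form `ω₃`. -/
def omegaThree : LinearMap.BilinForm ℝ (TangentSpace (𝓘(ℝ, E)).tangent V) :=
  (𝒥.sigma V).comp (LinearMap.snd ℝ _ _ ∘ₗ (𝒥.split V).symm.toLinearMap)
      (LinearMap.snd ℝ _ _ ∘ₗ (𝒥.split V).symm.toLinearMap)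
    - (𝒥.sigma V).comp (LinearMap.fst ℝ _ _ ∘ₗ (𝒥.split V).symm.toLinearMap)
      (LinearMap.fst ℝ _ _ ∘ₗ (𝒥.split V).symm.toLinearMap)

theorem omegaThree_split (w w' u u' : TangentSpace 𝓘(ℝ, E) V.proj) :
    𝒥.omegaThree V (𝒥.split V (w, w')) (𝒥.split V (u, u')) = 𝒥.sigma V w' u' - 𝒥.sigma V w u := by
  simp [omegaThree]

theorem omegaThree_alt : (𝒥.omegaThree V).IsAlt := fun a => by
  obtain ⟨⟨w, w'⟩, rfl⟩ := (𝒥.split V).surjective a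
  rw [omegaThree_split, sigma_self, sigma_self, sub_zero]

theorem omegaThree_separatingLeft : (𝒥.omegaThree V).SeparatingLeft := fun a ha => by
  obtain ⟨⟨w, w'⟩, rfl⟩ := (𝒥.split V).surjective a
  have h1 : w = 0 := 𝒥.sigma_separatingLeft V w fun u => by
    simpa [omegaThree_split] using ha (𝒥.split V (u, 0))
  have h2 : w' = 0 := 𝒥.sigma_separatingLeft V w' fun u => by
    simpa [omegaThree_split] using ha (𝒥.split V (0, u))
  rw [h1, h2]
  exact map_zero _

variable {𝒥} (h𝒥 : 𝒥.IsSpecialJoyce)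
include h𝒥

/-- On vertical vectors I₃ V_w = -V_{Iw}, so the type (1,1) condition on ω^ν is the invariance of σ
under I. -/
theorem IsSpecialJoyce.sigma_cx (w u : TangentSpace 𝓘(ℝ, E) V.proj) :
    𝒥.sigma V (S.cx V.proj w) (S.cx V.proj u) = 𝒥.sigma V w u := by
  have h : ∀ w, ((-𝒥.realV V (S.cx V.proj w) : vert V) :
      TangentSpace (𝓘(ℝ, E)).tangent V) = 𝒥.I₃ V (𝒥.realV V w) := fun w => by
    rw [realV_eq_split, I₃_split, map_zero, Submodule.coe_neg, realV_eq_split, ← map_neg]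
    simp
  have h1 := h𝒥.type_one_one V (𝒥.realV V w) (𝒥.realV V u) _ _ (h w) (h u)
  rw [map_neg, map_neg, LinearMap.neg_apply, neg_neg] at h1
  rw [sigma_apply, sigma_apply, h1]

theorem IsSpecialJoyce.sigma_cx_right (w u : TangentSpace 𝓘(ℝ, E) V.proj) :
    𝒥.sigma V w (S.cx V.proj u) = -𝒥.sigma V (S.cx V.proj w) u := by
  rw [← h𝒥.sigma_cx V w, S.pseudoKahler.complex.sq V.proj, map_neg]

/-- Expanding v_X and v̄_Y gives two terms with coefficient 1/4 in each of the real and imaginary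
parts; they coincide by the invariance of σ. -/
theorem IsSpecialJoyce.pairing_hol (w u : TangentSpace 𝓘(ℝ, E) V.proj) :
    𝒥.pairing V (hol S V w) (hol S V u) = ((1 / 2 * 𝒥.sigma V w u : ℝ) : ℂ)
      + ((1 / 2 * 𝒥.sigma V (S.cx V.proj w) u : ℝ) : ℂ) * Complex.I := by
  have h1 := h𝒥.sigma_cx V w u
  have h2 := h𝒥.sigma_cx_right V w u
  simp only [sigma_apply] at h1 h2 ⊢
  have h3 : -(1 / (4 * (Real.pi : ℂ) ^ 2)) = ((-(1 / (4 * Real.pi ^ 2)) : ℝ) : ℂ) := by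
    push_cast; ring
  rw [pairing, v_hol, v_hol, conj_mkC, baseChange_bilin_mkC, h3]
  generalize -(1 / (4 * Real.pi ^ 2)) = k at h1 h2 ⊢
  simp only [map_smul, map_neg, LinearMap.smul_apply, smul_eq_mul]
  rw [mul_add, ← mul_assoc (k : ℂ), ← Complex.ofReal_mul, ← Complex.ofReal_mul]
  congr 2
  · linear_combination (1 / 4 : ℝ) * h1
  · congr 1
    linear_combination (-1 / 4 : ℝ) * h2

/-- The pairings of h with h and of v with v vanish because σ is of type (1,1), and the mixed ones
because ω₃ is block diagonal in the splitting. The interchange of X and Y between the two nonzero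
pairings accounts for the minus sign on the R-components. -/
theorem IsSpecialJoyce.isOmegaThree : 𝒥.IsOmegaThree 𝒥.omegaThree where
  alt := 𝒥.omegaThree_alt
  v_vbar V X Y := by
    obtain ⟨w, rfl⟩ := exists_hol V X
    obtain ⟨u, rfl⟩ := exists_hol V Y
    have h1 := h𝒥.sigma_cx V w u
    have h2 := h𝒥.sigma_cx_right V w u
    rw [h𝒥.pairing_hol, vN_hol, vN_hol, conj_mkC, baseChange_bilin_mkC]
    simp only [map_smul, map_neg, LinearMap.smul_apply, smul_eq_mul, realV_eq_split,
      omegaThree_split, map_zero, sub_zero]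
    congr 2
    · linear_combination (1 / 4 : ℝ) * h1
    · congr 1; linear_combination (-1 / 4 : ℝ) * h2
  h_hbar V X Y := by
    obtain ⟨w, rfl⟩ := exists_hol V X
    obtain ⟨u, rfl⟩ := exists_hol V Y
    have h1 := h𝒥.sigma_cx V w u
    have h2 := h𝒥.sigma_cx_right V w u
    have h3 := 𝒥.sigma_swap V w u
    have h4 := 𝒥.sigma_swap V (S.cx V.proj w) u
    have h5 := 𝒥.sigma_swap V w (S.cx V.proj u)
    have h6 := 𝒥.sigma_swap V (S.cx V.proj w) (S.cx V.proj u)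
    rw [h𝒥.pairing_hol, h_hol, h_hol, conj_mkC, baseChange_bilin_mkC]
    simp only [map_smul, map_neg, LinearMap.smul_apply, smul_eq_mul, realH_eq_split,
      omegaThree_split, map_zero, zero_sub]
    congr 2
    · linarith
    · congr 1; linarith
  h_h V X Y := by
    obtain ⟨w, rfl⟩ := exists_hol V X
    obtain ⟨u, rfl⟩ := exists_hol V Y
    have h1 := h𝒥.sigma_cx V w u
    have h2 := h𝒥.sigma_cx_right V w u
    rw [h_hol, h_hol, baseChange_bilin_mkC]
    simp only [map_smul, LinearMap.smul_apply, smul_eq_mul, realH_eq_split,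
      omegaThree_split, map_zero, zero_sub, h1, h2]
    simp
  v_v V X Y := by
    obtain ⟨w, rfl⟩ := exists_hol V X
    obtain ⟨u, rfl⟩ := exists_hol V Y
    have h1 := h𝒥.sigma_cx V w u
    have h2 := h𝒥.sigma_cx_right V w u
    rw [vN_hol, vN_hol, baseChange_bilin_mkC]
    simp only [map_smul, LinearMap.smul_apply, smul_eq_mul, realV_eq_split,
      omegaThree_split, map_zero, sub_zero, h1, h2]
    simp
  h_v V X Y := by
    obtain ⟨w, rfl⟩ := exists_hol V X
    obtain ⟨u, rfl⟩ := exists_hol V Y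
    rw [h_hol, vN_hol, baseChange_bilin_mkC]
    simp [realV_eq_split, realH_eq_split, omegaThree_split]
  h_vbar V X Y := by
    obtain ⟨w, rfl⟩ := exists_hol V X
    obtain ⟨u, rfl⟩ := exists_hol V Y
    rw [h_hol, vN_hol, conj_mkC, baseChange_bilin_mkC]
    simp [realV_eq_split, realH_eq_split, omegaThree_split]

theorem IsSpecialJoyce.omegaThree_unique {σ : ∀ V : TangentBundle 𝓘(ℝ, E) M,
    LinearMap.BilinForm ℝ (TangentSpace (𝓘(ℝ, E)).tangent V)} (hσ : 𝒥.IsOmegaThree σ) :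
    σ = 𝒥.omegaThree := by
  have h := h𝒥.isOmegaThree
  funext V
  have re : ∀ {a b c d : ℝ}, (a : ℂ) + b * Complex.I = (c : ℂ) + d * Complex.I → a = c :=
    fun h => by simpa using congrArg Complex.re h
  -- Since h_Y + h̄_Y = R_u, adding the real parts of the pairings of h_X with h_Y and with h̄_Y
  -- recovers half the value on (R_w, R_u). The other blocks are treated alike.
  have hHH : ∀ w u, σ V (𝒥.realH V w) (𝒥.realH V u) =
      𝒥.omegaThree V (𝒥.realH V w) (𝒥.realH V u) := fun w u => by
    have h1 := (hσ.h_h V (hol S V w) (hol S V u)).trans (h.h_h V (hol S V w) (hol S V u)).symm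
    have h2 := (hσ.h_hbar V (hol S V u) (hol S V w)).trans
      (h.h_hbar V (hol S V u) (hol S V w)).symm
    simp only [h_hol, conj_mkC, baseChange_bilin_mkC] at h1 h2
    have h3 := re h1
    have h4 := re h2
    simp only [map_smul, map_neg, LinearMap.smul_apply, smul_eq_mul] at h3 h4
    linarith
  have hVV : ∀ w u, σ V (𝒥.realV V w) (𝒥.realV V u) =
      𝒥.omegaThree V (𝒥.realV V w) (𝒥.realV V u) := fun w u => by
    have h1 := (hσ.v_v V (hol S V w) (hol S V u)).trans (h.v_v V (hol S V w) (hol S V u)).symm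
    have h2 := (hσ.v_vbar V (hol S V w) (hol S V u)).trans
      (h.v_vbar V (hol S V w) (hol S V u)).symm
    simp only [vN_hol, conj_mkC, baseChange_bilin_mkC] at h1 h2
    have h3 := re h1
    have h4 := re h2
    simp only [map_smul, map_neg, LinearMap.smul_apply, smul_eq_mul] at h3 h4
    linarith
  have hHV : ∀ w u, σ V (𝒥.realH V w) (𝒥.realV V u) =
      𝒥.omegaThree V (𝒥.realH V w) (𝒥.realV V u) := fun w u => by
    have h1 := (hσ.h_v V (hol S V w) (hol S V u)).trans (h.h_v V (hol S V w) (hol S V u)).symm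
    have h2 := (hσ.h_vbar V (hol S V w) (hol S V u)).trans
      (h.h_vbar V (hol S V w) (hol S V u)).symm
    simp only [h_hol, vN_hol, conj_mkC, baseChange_bilin_mkC] at h1 h2
    have h3 := re h1
    have h4 := re h2
    simp only [map_smul, map_neg, LinearMap.smul_apply, smul_eq_mul] at h3 h4
    linarith
  have hVH : ∀ w u, σ V (𝒥.realV V w) (𝒥.realH V u) =
      𝒥.omegaThree V (𝒥.realV V w) (𝒥.realH V u) := fun w u => by
    rw [← LinearMap.IsAlt.neg (hσ.alt V), ← LinearMap.IsAlt.neg (h.alt V), hHV]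
  ext a b
  obtain ⟨⟨w, w'⟩, rfl⟩ := (𝒥.split V).surjective a
  obtain ⟨⟨u, u'⟩, rfl⟩ := (𝒥.split V).surjective b
  simp only [split_apply, map_add, LinearMap.add_apply, hHH, hVV, hHV, hVH]

/-! ### The quaternion relations. -/

omit h𝒥

theorem I₁_sq (a : TangentSpace (𝓘(ℝ, E)).tangent V) : 𝒥.I₁ V (𝒥.I₁ V a) = -a := by
  obtain ⟨⟨w, w'⟩, rfl⟩ := (𝒥.split V).surjective a
  rw [I₁_split, I₁_split, ← map_neg, Prod.neg_mk]

theorem I₂_sq (a : TangentSpace (𝓘(ℝ, E)).tangent V) : 𝒥.I₂ V (𝒥.I₂ V a) = -a := by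
  obtain ⟨⟨w, w'⟩, rfl⟩ := (𝒥.split V).surjective a
  rw [I₂_split, I₂_split, ← map_neg (𝒥.split V)]
  refine congrArg (𝒥.split V) (Prod.ext ?_ ?_) <;> simp [S.pseudoKahler.complex.sq V.proj]

theorem I₁_I₂ (a : TangentSpace (𝓘(ℝ, E)).tangent V) :
    𝒥.I₁ V (𝒥.I₂ V a) = 𝒥.I₃ V a := by
  obtain ⟨⟨w, w'⟩, rfl⟩ := (𝒥.split V).surjective a
  rw [I₂_split, I₁_split, I₃_split, neg_neg]

theorem I₂_I₁ (a : TangentSpace (𝓘(ℝ, E)).tangent V) :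
    𝒥.I₂ V (𝒥.I₁ V a) = -𝒥.I₃ V a := by
  obtain ⟨⟨w, w'⟩, rfl⟩ := (𝒥.split V).surjective a
  rw [I₁_split, I₂_split, I₃_split, ← map_neg (𝒥.split V)]
  refine congrArg (𝒥.split V) (Prod.ext ?_ ?_) <;> simp

theorem I₂_I₃ (a : TangentSpace (𝓘(ℝ, E)).tangent V) : 𝒥.I₂ V (𝒥.I₃ V a) = 𝒥.I₁ V a := by
  rw [← neg_neg (𝒥.I₃ V a), ← I₂_I₁, map_neg, I₂_sq, neg_neg]

theorem I₃_I₂ (a : TangentSpace (𝓘(ℝ, E)).tangent V) : 𝒥.I₃ V (𝒥.I₂ V a) = -𝒥.I₁ V a := by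
  rw [← I₁_I₂, I₂_sq, map_neg]

theorem I₁_I₃ (a : TangentSpace (𝓘(ℝ, E)).tangent V) : 𝒥.I₁ V (𝒥.I₃ V a) = -𝒥.I₂ V a := by
  rw [← I₁_I₂, I₁_sq]

theorem I₃_I₁ (a : TangentSpace (𝓘(ℝ, E)).tangent V) : 𝒥.I₃ V (𝒥.I₁ V a) = 𝒥.I₂ V a := by
  rw [← neg_neg (𝒥.I₃ V _), ← I₂_I₁, I₁_sq, map_neg, neg_neg]

theorem I₃_sq (a : TangentSpace (𝓘(ℝ, E)).tangent V) : 𝒥.I₃ V (𝒥.I₃ V a) = -a := by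
  rw [← I₁_I₂, I₂_I₃, I₁_sq]

/-! ### The metric and its three 2-forms in the splitting. -/

variable (𝒥) in
/-- The metric `ω₃(-, I₃ -)`. -/
def metric : LinearMap.BilinForm ℝ (TangentSpace (𝓘(ℝ, E)).tangent V) :=
  (𝒥.omegaThree V).compRight (𝒥.I₃ V)

theorem metric_split (w w' u u' : TangentSpace 𝓘(ℝ, E) V.proj) :
    𝒥.metric V (𝒥.split V (w, w')) (𝒥.split V (u, u')) =
      -𝒥.sigma V w (S.cx V.proj u) - 𝒥.sigma V w' (S.cx V.proj u') := by
  rw [metric, LinearMap.BilinForm.compRight_apply, I₃_split, omegaThree_split, map_neg]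
  ring

theorem omegaOne_split (w w' u u' : TangentSpace 𝓘(ℝ, E) V.proj) :
    (𝒥.metric V).compLeft (𝒥.I₁ V) (𝒥.split V (w, w')) (𝒥.split V (u, u')) =
      𝒥.sigma V w' (S.cx V.proj u) - 𝒥.sigma V w (S.cx V.proj u') := by
  rw [LinearMap.BilinForm.compLeft_apply, I₁_split, metric_split, map_neg, LinearMap.neg_apply,
    neg_neg]

include h𝒥

theorem IsSpecialJoyce.omegaTwo_split (w w' u u' : TangentSpace 𝓘(ℝ, E) V.proj) :
    (𝒥.metric V).compLeft (𝒥.I₂ V) (𝒥.split V (w, w')) (𝒥.split V (u, u')) =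
      𝒥.sigma V w' u + 𝒥.sigma V w u' := by
  rw [LinearMap.BilinForm.compLeft_apply, I₂_split, metric_split, map_neg, LinearMap.neg_apply,
    map_neg, LinearMap.neg_apply, h𝒥.sigma_cx, h𝒥.sigma_cx]
  ring

omit h𝒥 in
theorem metric_I₁ (a b : TangentSpace (𝓘(ℝ, E)).tangent V) :
    𝒥.metric V (𝒥.I₁ V a) (𝒥.I₁ V b) = 𝒥.metric V a b := by
  obtain ⟨⟨w, w'⟩, rfl⟩ := (𝒥.split V).surjective a
  obtain ⟨⟨u, u'⟩, rfl⟩ := (𝒥.split V).surjective b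
  simp only [I₁_split, metric_split, map_neg, LinearMap.neg_apply]
  ring

theorem IsSpecialJoyce.metric_I₃ (a b : TangentSpace (𝓘(ℝ, E)).tangent V) :
    𝒥.metric V (𝒥.I₃ V a) (𝒥.I₃ V b) = 𝒥.metric V a b := by
  obtain ⟨⟨w, w'⟩, rfl⟩ := (𝒥.split V).surjective a
  obtain ⟨⟨u, u'⟩, rfl⟩ := (𝒥.split V).surjective b
  simp only [I₃_split, metric_split, map_neg, LinearMap.neg_apply, h𝒥.sigma_cx]
  ring

theorem IsSpecialJoyce.metric_I₂ (a b : TangentSpace (𝓘(ℝ, E)).tangent V) :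
    𝒥.metric V (𝒥.I₂ V a) (𝒥.I₂ V b) = 𝒥.metric V a b := by
  rw [← I₃_I₁, ← I₃_I₁, h𝒥.metric_I₃, metric_I₁]

theorem IsSpecialJoyce.metric_symm (a b : TangentSpace (𝓘(ℝ, E)).tangent V) :
    𝒥.metric V a b = 𝒥.metric V b a := by
  obtain ⟨⟨w, w'⟩, rfl⟩ := (𝒥.split V).surjective a
  obtain ⟨⟨u, u'⟩, rfl⟩ := (𝒥.split V).surjective b
  simp only [metric_split, h𝒥.sigma_cx_right, neg_neg]
  rw [𝒥.sigma_swap V _ u, 𝒥.sigma_swap V _ u', h𝒥.sigma_cx_right, h𝒥.sigma_cx_right]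
  ring

/-- An isometry with square -1 satisfies g(Ka, a) = g(K²a, Ka) = -g(a, Ka), and g is symmetric. -/
theorem IsSpecialJoyce.metric_skew {K : TangentSpace (𝓘(ℝ, E)).tangent V →ₗ[ℝ]
    TangentSpace (𝓘(ℝ, E)).tangent V} (hK : ∀ a, K (K a) = -a)
    (hg : ∀ a b, 𝒥.metric V (K a) (K b) = 𝒥.metric V a b) :
    ((𝒥.metric V).compLeft K).IsAlt := fun a => by
  have h1 := hg (K a) a
  rw [hK, map_neg, LinearMap.neg_apply, h𝒥.metric_symm] at h1
  rw [LinearMap.BilinForm.compLeft_apply]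
  linarith

omit h𝒥 in
theorem metric_separatingLeft : (𝒥.metric V).SeparatingLeft := fun a ha => by
  refine 𝒥.omegaThree_separatingLeft V a fun b => ?_
  have h := ha (-𝒥.I₃ V b)
  rwa [metric, LinearMap.BilinForm.compRight_apply, map_neg, I₃_sq, neg_neg] at h

theorem IsSpecialJoyce.metric_nondegenerate : (𝒥.metric V).Nondegenerate :=
  (LinearMap.IsRefl.nondegenerate_iff_separatingLeft
    (fun a b h => (h𝒥.metric_symm V b a).trans h)).2 (metric_separatingLeft V)

theorem IsSpecialJoyce.form_nondegenerate {K : TangentSpace (𝓘(ℝ, E)).tangent V →ₗ[ℝ]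
    TangentSpace (𝓘(ℝ, E)).tangent V} (hK : ∀ a, K (K a) = -a)
    (hg : ∀ a b, 𝒥.metric V (K a) (K b) = 𝒥.metric V a b) :
    ((𝒥.metric V).compLeft K).Nondegenerate := by
  have h1 : ∀ a, (∀ b, (𝒥.metric V).compLeft K a b = 0) → a = 0 := fun a ha => by
    have h : K a = 0 := metric_separatingLeft V (K a) fun b =>
      (LinearMap.BilinForm.compLeft_apply (𝒥.metric V) K a b).symm.trans (ha b)
    have h2 := hK a
    rw [h, map_zero] at h2
    exact neg_eq_zero.1 h2.symm
  exact nondegenerate_of_isAlt (h𝒥.metric_skew V hK hg) h1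

/-- The metric is ω₃(-, I₃-), so this is the I₃-invariance of ω₃, which comes from the I-invariance
of σ. -/
theorem IsSpecialJoyce.omegaThree_eq : (𝒥.metric V).compLeft (𝒥.I₃ V) = 𝒥.omegaThree V := by
  ext a b
  obtain ⟨⟨w, w'⟩, rfl⟩ := (𝒥.split V).surjective a
  obtain ⟨⟨u, u'⟩, rfl⟩ := (𝒥.split V).surjective b
  rw [LinearMap.BilinForm.compLeft_apply, I₃_split, metric_split, omegaThree_split, map_neg,
    LinearMap.neg_apply, h𝒥.sigma_cx, h𝒥.sigma_cx]
  ring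

end AlmostSpecialJoyce

/-! ### A special Joyce structure in coordinates -/

section Potential

open Filter Topology

variable {E : Type*} [NormedAddCommGroup E] [NormedSpace ℝ E] [FiniteDimensional ℝ E]
  {M : Type*} [TopologicalSpace M] [ChartedSpace E M] [IsManifold 𝓘(ℝ, E) ∞ M]
  {S : AffineSpecialKahler E M} {V₀ V : TangentBundle 𝓘(ℝ, E) M}
  {J : TangentBundle 𝓘(ℝ, E) M → ℂ}

theorem coe_nu (w : TangentSpace 𝓘(ℝ, E) V.proj) :
    (nu V w : TangentSpace (𝓘(ℝ, E)).tangent V) = vertLift V w := rfl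

theorem ham_eq_mkC (f : TangentSpace 𝓘(ℝ, E) V.proj → ℂ) : ∃ s t, S.ham V f =
    mkC (nu V s) (nu V t) ∧ (∀ w, S.form V.proj w s = (fderiv ℝ f V.2 w).re) ∧
      ∀ w, S.form V.proj w t = (fderiv ℝ f V.2 w).im :=
  ⟨_, _, baseChange_mkC _ _ _,
    fun w => LinearMap.BilinForm.apply_toDual_symm_apply (B := (S.form V.proj).flip) _ w,
    fun w => LinearMap.BilinForm.apply_toDual_symm_apply (B := (S.form V.proj).flip) _ w⟩

/-- A function on `TM` in the chart at `V₀`. -/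
def chartFun (V₀ : TangentBundle 𝓘(ℝ, E) M) (J : TangentBundle 𝓘(ℝ, E) M → ℂ) : E × E → ℂ :=
  J ∘ (extChartAt (𝓘(ℝ, E)).tangent V₀).symm

omit [FiniteDimensional ℝ E] in
theorem contDiffAt_chartFun (hV : V.proj ∈ (chartAt E V₀.proj).source)
    (hJ : ContMDiff (𝓘(ℝ, E)).tangent 𝓘(ℝ, ℂ) ∞ J) :
    ContDiffAt ℝ ∞ (chartFun V₀ J) (extChartAt (𝓘(ℝ, E)).tangent V₀ V) :=
  contDiffAt_comp_extChartAt_symm (tangent_mem_source hV) (hJ V)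

omit [FiniteDimensional ℝ E] in
theorem mvfderiv_eq_chartFun (hV : V.proj ∈ (chartAt E V₀.proj).source)
    (hJ : ContMDiff (𝓘(ℝ, E)).tangent 𝓘(ℝ, ℂ) ∞ J)
    (a : TangentSpace (𝓘(ℝ, E)).tangent V) : mvfderiv (𝓘(ℝ, E)).tangent J V a =
      fderiv ℝ (chartFun V₀ J) (extChartAt (𝓘(ℝ, E)).tangent V₀ V)
        (chartDeriv (𝓘(ℝ, E)).tangent V₀ V a) := by
  refine mvfderiv_eq_fderiv (tangent_mem_source hV)
    ((contDiffAt_chartFun hV hJ).differentiableAt (by simp)) ?_ a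
  filter_upwards [(chartAt (ModelProd E E) V₀).open_source.mem_nhds (tangent_mem_source hV)]
    with W hW
  rw [chartFun, Function.comp_apply, (extChartAt (𝓘(ℝ, E)).tangent V₀).left_inv
    (by rwa [extChartAt_source])]

theorem liftBaseChange_mkC {W : Type*} [AddCommGroup W] [Module ℝ W] (l : W →ₗ[ℝ] ℂ) (a b : W) :
    LinearMap.liftBaseChange ℂ l (mkC a b) = l a + Complex.I * l b := by
  simp [mkC]

/-- The point Z of the fibre enters the right side only through its linear coordinate, so the
derivative of ℋ_X J along the fibre becomes a partial derivative of `horizPot`. The factor 1/2 comes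
from X = (w - iIw)/2. -/
theorem horizDeriv_eq_horizPot {p q : M} {V₀ : TangentBundle 𝓘(ℝ, E) M}
    (hp : V₀.proj = p) (hq : q ∈ (chartAt E p).source)
    (hJ : ContMDiff (𝓘(ℝ, E)).tangent 𝓘(ℝ, ℂ) ∞ J) (w Z : TangentSpace 𝓘(ℝ, E) q) :
    S.horizDeriv J q (AlmostSpecialJoyce.hol S ⟨q, Z⟩ w) Z = (1 / 2 : ℂ) *
      horizPot (S.christoffelChart p) (S.cxChart p) (chartFun V₀ J)
        (extChartAt 𝓘(ℝ, E) p q, chartDeriv 𝓘(ℝ, E) p q Z) (chartDeriv 𝓘(ℝ, E) p q w) := by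
  subst hp
  have h1 : ∀ a, mvfderiv (𝓘(ℝ, E)).tangent J ⟨q, Z⟩ (S.horiz ⟨q, Z⟩ a) =
      fderiv ℝ (chartFun V₀ J) (extChartAt 𝓘(ℝ, E) V₀.proj q, chartDeriv 𝓘(ℝ, E) V₀.proj q Z)
        (horizLift (S.christoffelChart V₀.proj) (extChartAt 𝓘(ℝ, E) V₀.proj q,
          chartDeriv 𝓘(ℝ, E) V₀.proj q Z) (chartDeriv 𝓘(ℝ, E) V₀.proj q a)) := fun a => by
    have h2 := mvfderiv_eq_chartFun (V := ⟨q, Z⟩) hq hJ (S.horiz ⟨q, Z⟩ a)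
    have h3 := chartDeriv_tangent_horiz (V := ⟨q, Z⟩) hq S a
    have h4 := extChartAt_tangent (V := ⟨q, Z⟩) (V₀ := V₀) hq
    rw [h3, h4] at h2
    refine h2.trans (congrArg _ (Prod.ext rfl ?_))
    simp only [horizLift, ContinuousLinearMap.prod_apply, neg_apply]
    rw [AffineSpecialKahler.christoffelChart_apply hq]
  rw [AffineSpecialKahler.horizDeriv, AlmostSpecialJoyce.hol_coe, baseChange_mkC,
    liftBaseChange_mkC]
  simp only [ContinuousLinearMap.coe_coe]
  rw [map_smul, map_smul, map_smul, map_smul, h1, h1, AffineSpecialKahler.chartDeriv_cx hq,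
    horizPot]
  simp only [sub_apply, smul_apply, ContinuousLinearMap.comp_apply, Complex.real_smul,
    smul_eq_mul]
  push_cast
  ring

theorem vertDeriv_eq_vertPot {p q : M} {V₀ : TangentBundle 𝓘(ℝ, E) M}
    (hp : V₀.proj = p) (hq : q ∈ (chartAt E p).source)
    (hJ : ContMDiff (𝓘(ℝ, E)).tangent 𝓘(ℝ, ℂ) ∞ J) (w Z : TangentSpace 𝓘(ℝ, E) q) :
    vertDeriv J q (conj (AlmostSpecialJoyce.hol S ⟨q, Z⟩ w : ℂ ⊗[ℝ] TangentSpace 𝓘(ℝ, E) q)) Z =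
      (1 / 2 : ℂ) * vertPot (S.cxChart p) (chartFun V₀ J)
        (extChartAt 𝓘(ℝ, E) p q, chartDeriv 𝓘(ℝ, E) p q Z) (chartDeriv 𝓘(ℝ, E) p q w) := by
  subst hp
  have h1 : ∀ a, mvfderiv (𝓘(ℝ, E)).tangent J ⟨q, Z⟩ (vertLift ⟨q, Z⟩ a) =
      fderiv ℝ (chartFun V₀ J) (extChartAt 𝓘(ℝ, E) V₀.proj q, chartDeriv 𝓘(ℝ, E) V₀.proj q Z)
        (0, chartDeriv 𝓘(ℝ, E) V₀.proj q a) := fun a => by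
    have h2 := mvfderiv_eq_chartFun (V := ⟨q, Z⟩) hq hJ (vertLift ⟨q, Z⟩ a)
    have h3 := chartDeriv_tangent_vertLift (V := ⟨q, Z⟩) hq a
    have h4 := extChartAt_tangent (V := ⟨q, Z⟩) (V₀ := V₀) hq
    rw [h3, h4] at h2
    exact h2
  rw [vertDeriv, AlmostSpecialJoyce.hol_coe, conj_mkC, baseChange_mkC, liftBaseChange_mkC]
  simp only [ContinuousLinearMap.coe_coe]
  rw [neg_smul, neg_neg, map_smul, map_smul, map_smul, map_smul, h1, h1,
    AffineSpecialKahler.chartDeriv_cx hq, vertPot]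
  simp only [add_apply, smul_apply, ContinuousLinearMap.comp_apply, Complex.real_smul,
    smul_eq_mul, ContinuousLinearMap.inr_apply]
  push_cast
  ring

omit [FiniteDimensional ℝ E] in
theorem fderiv_fibre {G : E × E → E →L[ℝ] ℂ} {x y b : E} (hG : DifferentiableAt ℝ G (x, y))
    {e : E →L[ℝ] E} {c : ℂ} {f : E → ℂ} {Z : E} (hZ : e Z = y)
    (hf : ∀ Z, f Z = c * G (x, e Z) b) (v : E) :
    fderiv ℝ f Z v = c * fderiv ℝ G (x, y) (0, e v) b := by
  subst hZ
  have h1 : HasFDerivAt (fun Z => (x, e Z)) ((0 : E →L[ℝ] E).prod e) Z :=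
    (hasFDerivAt_const x Z).prodMk e.hasFDerivAt
  have h2 : HasFDerivAt (fun Z => G (x, e Z)) _ Z :=
    HasFDerivAt.comp (g := G) Z hG.hasFDerivAt h1
  have h3 := (h2.clm_apply (hasFDerivAt_const b Z)).const_mul c
  rw [funext hf, h3.fderiv]
  simp

end Potential

/-! ### The real parts of h and v in the chart of TM. -/

namespace AlmostSpecialJoyce

open Filter Topology

variable {E : Type*} [NormedAddCommGroup E] [NormedSpace ℝ E] [FiniteDimensional ℝ E]
  {M : Type*} [TopologicalSpace M] [ChartedSpace E M] [IsManifold 𝓘(ℝ, E) ∞ M]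
  {S : AffineSpecialKahler E M} (𝒥 : AlmostSpecialJoyce S) (V₀ : TangentBundle 𝓘(ℝ, E) M)

/-- A function `J` which defines the special Joyce structure. -/
def potential : TangentBundle 𝓘(ℝ, E) M → ℂ := 𝒥.exists_potential.choose

theorem contMDiff_potential : ContMDiff (𝓘(ℝ, E)).tangent 𝓘(ℝ, ℂ) ∞ 𝒥.potential :=
  𝒥.exists_potential.choose_spec.1

theorem h_eq (V X) : 𝒥.h V X = (S.horiz V).baseChange ℂ X
    + vertIncl V (S.ham V (S.horizDeriv 𝒥.potential V.proj X)) :=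
  𝒥.exists_potential.choose_spec.2.1 V X

theorem v_eq (V X) : 𝒥.v V X = (2 * (Real.pi : ℂ) * Complex.I) •
    ((nu V).toLinearMap.baseChange ℂ (conj X.1)
      + S.ham V (vertDeriv 𝒥.potential V.proj (conj X.1))) :=
  𝒥.exists_potential.choose_spec.2.2 V X

/-- The vertical part of `Re h` in the chart at `V₀`. -/
def reChart : E × E → E →L[ℝ] E :=
  connRe (S.formChart V₀.proj) (S.christoffelChart V₀.proj) (S.cxChart V₀.proj)
    (chartFun V₀ 𝒥.potential)

/-- The map `Re v` in the chart at `V₀`. -/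
def imChart : E × E → E →L[ℝ] E :=
  connIm (S.formChart V₀.proj) (S.cxChart V₀.proj) (chartFun V₀ 𝒥.potential)

variable {V₀} {V : TangentBundle 𝓘(ℝ, E) M}

/-- A Hamiltonian vector is determined by its pairings with all vertical vectors, as the form in the
chart is invertible. -/
theorem eq_fibreHam (hV : V.proj ∈ (chartAt E V₀.proj).source) {H : E × E → E →L[ℝ] ℝ} {b : E}
    {s : TangentSpace 𝓘(ℝ, E) V.proj}
    (hs : ∀ w, S.form V.proj w s = fderiv ℝ H (extChartAt (𝓘(ℝ, E)).tangent V₀ V)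
      (0, chartDeriv 𝓘(ℝ, E) V₀.proj V.proj w) b) :
    chartDeriv 𝓘(ℝ, E) V₀.proj V.proj s =
      fibreHam (S.formChart V₀.proj) H (extChartAt (𝓘(ℝ, E)).tangent V₀ V) b := by
  have hinv := AffineSpecialKahler.isInvertible_formChart_flip (S := S) hV
  have hz : (extChartAt (𝓘(ℝ, E)).tangent V₀ V).1 = extChartAt 𝓘(ℝ, E) V₀.proj V.proj := by
    rw [extChartAt_tangent hV]
  rw [← hz] at hinv
  obtain ⟨f, hf⟩ := id hinv
  apply f.injective
  have h2 : ∀ a, f a = (S.formChart V₀.proj (extChartAt (𝓘(ℝ, E)).tangent V₀ V).1).flip a :=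
    fun a => DFunLike.congr_fun hf a
  rw [h2, h2]
  ext v
  rw [ContinuousLinearMap.flip_apply, ContinuousLinearMap.flip_apply, apply_fibreHam hinv]
  have h3 := hs (chartDerivSymm 𝓘(ℝ, E) V₀.proj V.proj v)
  rw [AffineSpecialKahler.form_eq_formChart hV, chartDeriv_symm hV, ← hz] at h3
  exact h3

section

variable [T2Space M] (hV : V.proj ∈ (chartAt E V₀.proj).source)
include hV

/-- As 2 Re X = w, the vector R_w is the horizontal lift of w plus the Hamiltonian field of Re(2 ℋ_X
J); each of the two is known in the chart. -/
theorem chartDeriv_realH (w : TangentSpace 𝓘(ℝ, E) V.proj) :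
    chartDeriv (𝓘(ℝ, E)).tangent V₀ V (𝒥.realH V w) =
      (chartDeriv 𝓘(ℝ, E) V₀.proj V.proj w,
        𝒥.reChart V₀ (extChartAt (𝓘(ℝ, E)).tangent V₀ V)
          (chartDeriv 𝓘(ℝ, E) V₀.proj V.proj w)) := by
  obtain ⟨s, t, h1, h2, -⟩ := ham_eq_mkC (S := S) (V := V)
    (S.horizDeriv 𝒥.potential V.proj (hol S V w))
  have hz : extChartAt (𝓘(ℝ, E)).tangent V₀ V = _ := extChartAt_tangent hV
  have hd : ContDiffAt ℝ ∞ (horizPot (S.christoffelChart V₀.proj) (S.cxChart V₀.proj)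
      (chartFun V₀ 𝒥.potential)) (extChartAt (𝓘(ℝ, E)).tangent V₀ V) := by
    have h3 := contDiffAt_chartFun hV 𝒥.contMDiff_potential
    rw [hz] at h3 ⊢
    exact contDiffAt_horizPot (AffineSpecialKahler.contDiffAt_christoffelChart hV)
      (AffineSpecialKahler.contDiffAt_cxChart hV) h3
  have h4 : 𝒥.realH V w = S.horiz V w + vertLift V ((2 : ℝ) • s) := by
    have h5 : 𝒥.realH V w = (2 : ℝ) • rePart (𝒥.h V (hol S V w)) := rfl
    rw [h5, h_eq, h1, hol_coe, baseChange_mkC, vertIncl, baseChange_mkC, mkC_add, rePart_mkC,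
      Submodule.subtype_apply, coe_nu, map_smul, map_smul, smul_add, smul_smul]
    simp
  have h6 : chartDeriv 𝓘(ℝ, E) V₀.proj V.proj ((2 : ℝ) • s) =
      fibreHam (S.formChart V₀.proj) (fun z => Complex.reCLM.comp
        (horizPot (S.christoffelChart V₀.proj) (S.cxChart V₀.proj) (chartFun V₀ 𝒥.potential) z))
        (extChartAt (𝓘(ℝ, E)).tangent V₀ V) (chartDeriv 𝓘(ℝ, E) V₀.proj V.proj w) := by
    refine eq_fibreHam hV fun u => ?_
    rw [map_smul, h2]
    have hd' := hd.differentiableAt (by simp)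
    have hd'' := hd'
    rw [hz] at hd''
    have h7 : fderiv ℝ (S.horizDeriv 𝒥.potential V.proj (hol S V w)) V.2 u = _ :=
      fderiv_fibre hd'' (e := chartDeriv 𝓘(ℝ, E) V₀.proj V.proj) (c := 1 / 2)
        (f := S.horizDeriv 𝒥.potential V.proj (hol S V w)) (Z := V.2) rfl
        (fun Z => horizDeriv_eq_horizPot rfl hV 𝒥.contMDiff_potential w Z) u
    have h8 : HasFDerivAt (fun z => Complex.reCLM.comp (horizPot (S.christoffelChart V₀.proj)
        (S.cxChart V₀.proj) (chartFun V₀ 𝒥.potential) z)) _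
        (extChartAt (𝓘(ℝ, E)).tangent V₀ V) :=
      (hasFDerivAt_const Complex.reCLM _).clm_comp hd'.hasFDerivAt
    rw [h7, h8.fderiv, ← hz]
    simp
    rfl
  rw [h4, map_add, chartDeriv_tangent_horiz hV, chartDeriv_tangent_vertLift hV, h6, reChart, connRe]
  refine Prod.ext (add_zero _) ?_
  simp only [Prod.snd_add, add_apply, neg_apply]
  congr 2
  rw [hz, AffineSpecialKahler.christoffelChart_apply hV]

omit [T2Space M] in
theorem chartDeriv_realV (w : TangentSpace 𝓘(ℝ, E) V.proj) :
    chartDeriv (𝓘(ℝ, E)).tangent V₀ V (𝒥.realV V w : TangentSpace (𝓘(ℝ, E)).tangent V) =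
      (0, 𝒥.imChart V₀ (extChartAt (𝓘(ℝ, E)).tangent V₀ V)
          (chartDeriv 𝓘(ℝ, E) V₀.proj V.proj w)) := by
  obtain ⟨s, t, h1, -, h2⟩ := ham_eq_mkC (S := S) (V := V)
    (vertDeriv 𝒥.potential V.proj (conj (hol S V w : ℂ ⊗[ℝ] TangentSpace 𝓘(ℝ, E) V.proj)))
  have hz : extChartAt (𝓘(ℝ, E)).tangent V₀ V = _ := extChartAt_tangent hV
  have hd : ContDiffAt ℝ ∞ (vertPot (S.cxChart V₀.proj)
      (chartFun V₀ 𝒥.potential)) (extChartAt (𝓘(ℝ, E)).tangent V₀ V) := by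
    have h3 := contDiffAt_chartFun hV 𝒥.contMDiff_potential
    rw [hz] at h3 ⊢
    exact contDiffAt_vertPot (AffineSpecialKahler.contDiffAt_cxChart hV) h3
  have h4 : 𝒥.realV V w = nu V ((-2 * Real.pi) • (S.cx V.proj w + (2 : ℝ) • t)) := by
    have h5 : 𝒥.realV V w = (2 : ℝ) • rePart (𝒥.v V (hol S V w)) := rfl
    rw [h5, v_eq, h1, hol_coe, conj_mkC, baseChange_mkC, mkC_add, rePart_smul, rePart_mkC,
      imPart_mkC]
    simp only [LinearEquiv.coe_coe, ← map_add, ← map_smul, ← map_sub]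
    congr 1
    have h6 : (2 * (Real.pi : ℂ) * Complex.I).re = 0 := by simp
    have h7 : (2 * (Real.pi : ℂ) * Complex.I).im = 2 * Real.pi := by simp
    rw [h6, h7, map_smul (S.cx V.proj)]
    module
  have h6 : chartDeriv 𝓘(ℝ, E) V₀.proj V.proj ((2 : ℝ) • t) =
      fibreHam (S.formChart V₀.proj) (fun z => Complex.imCLM.comp
        (vertPot (S.cxChart V₀.proj) (chartFun V₀ 𝒥.potential) z))
        (extChartAt (𝓘(ℝ, E)).tangent V₀ V) (chartDeriv 𝓘(ℝ, E) V₀.proj V.proj w) := by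
    refine eq_fibreHam hV fun u => ?_
    rw [map_smul, h2]
    have hd' := hd.differentiableAt (by simp)
    have hd'' := hd'
    rw [hz] at hd''
    have h7 : fderiv ℝ (vertDeriv 𝒥.potential V.proj
        (conj (hol S V w : ℂ ⊗[ℝ] TangentSpace 𝓘(ℝ, E) V.proj))) V.2 u = _ :=
      fderiv_fibre hd'' (e := chartDeriv 𝓘(ℝ, E) V₀.proj V.proj) (c := 1 / 2)
        (f := vertDeriv 𝒥.potential V.proj
          (conj (hol S V w : ℂ ⊗[ℝ] TangentSpace 𝓘(ℝ, E) V.proj))) (Z := V.2) rfl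
        (fun Z => vertDeriv_eq_vertPot rfl hV 𝒥.contMDiff_potential w Z) u
    have h8 : HasFDerivAt (fun z => Complex.imCLM.comp (vertPot
        (S.cxChart V₀.proj) (chartFun V₀ 𝒥.potential) z)) _
        (extChartAt (𝓘(ℝ, E)).tangent V₀ V) :=
      (hasFDerivAt_const Complex.imCLM _).clm_comp hd'.hasFDerivAt
    rw [h7, h8.fderiv, ← hz]
    simp
    rfl
  rw [h4, coe_nu, chartDeriv_tangent_vertLift hV, map_smul, map_add, h6,
    AffineSpecialKahler.chartDeriv_cx hV, imChart, connIm]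
  refine Prod.ext rfl ?_
  simp only [add_apply, smul_apply]
  rw [hz]

omit [T2Space M] in
theorem vertForm_eq_formChart (u u' : vert V) : S.vertForm V u u' =
    S.formChart V₀.proj (extChartAt (𝓘(ℝ, E)).tangent V₀ V).1
      (chartDeriv (𝓘(ℝ, E)).tangent V₀ V u).2 (chartDeriv (𝓘(ℝ, E)).tangent V₀ V u').2 := by
  obtain ⟨s, rfl⟩ := (nu V).surjective u
  obtain ⟨s', rfl⟩ := (nu V).surjective u'
  rw [coe_nu, coe_nu, chartDeriv_tangent_vertLift hV, chartDeriv_tangent_vertLift hV,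
    extChartAt_tangent hV, ← AffineSpecialKahler.form_eq_formChart hV]
  simp [AffineSpecialKahler.vertForm]

end

end AlmostSpecialJoyce

/-! ### Involutivity and closedness -/

section Bracket

open Filter Topology VectorField

variable {E : Type*} [NormedAddCommGroup E] [NormedSpace ℝ E]

/-- Fields with constant base component have a vertical bracket; this covers lifts of constant
vectors and vertical fields at once. -/
theorem lieBracket_of_eventuallyEq {f g : E × E → E →L[ℝ] E} {z : E × E} {c d w w' : E}
    {A B : E × E → E × E} (hf : DifferentiableAt ℝ f z) (hg : DifferentiableAt ℝ g z)
    (hA : A =ᶠ[𝓝 z] fun z => (c, f z w)) (hB : B =ᶠ[𝓝 z] fun z => (d, g z w')) :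
    lieBracket ℝ A B z =
      (0, fderiv ℝ g z (c, f z w) w' - fderiv ℝ f z (d, g z w') w) := by
  have hA' : HasFDerivAt A _ z := ((hasFDerivAt_const c z).prodMk
    (hf.hasFDerivAt.clm_apply (hasFDerivAt_const w z))).congr_of_eventuallyEq hA
  have hB' : HasFDerivAt B _ z := ((hasFDerivAt_const d z).prodMk
    (hg.hasFDerivAt.clm_apply (hasFDerivAt_const w' z))).congr_of_eventuallyEq hB
  rw [lieBracket, hA'.fderiv, hB'.fderiv, hA.self_of_nhds, hB.self_of_nhds]
  simp

theorem fderiv_fun_const_smul_real {F G : Type*} [NormedAddCommGroup F] [NormedSpace ℝ F]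
    [NormedAddCommGroup G] [NormedSpace ℝ G] {f : F → G} {z : F} (h : DifferentiableAt ℝ f z)
    (k : ℝ) : fderiv ℝ (fun z => k • f z) z = k • fderiv ℝ f z :=
  (h.hasFDerivAt.fun_const_smul k).fderiv

set_option synthInstance.maxHeartbeats 400000 in
set_option maxHeartbeats 1000000 in
theorem extDerivTwo_const_smul {F : Type*} [NormedAddCommGroup F] [NormedSpace ℝ F]
    {β : F → F →L[ℝ] F →L[ℝ] ℝ} {z : F} (h : DifferentiableAt ℝ β z) (k : ℝ) (a b c : F) :
    extDerivTwo (fun z => k • β z) z a b c = k * extDerivTwo β z a b c := by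
  have h1 : ∀ a, fderiv ℝ (fun z => k • β z) z a = k • fderiv ℝ β z a := fun a =>
    DFunLike.congr_fun (fderiv_fun_const_smul_real (G := F →L[ℝ] F →L[ℝ] ℝ) h k) a
  simp only [extDerivTwo, h1]
  simp only [smul_apply, smul_eq_mul]
  ring

end Bracket

namespace AlmostSpecialJoyce

open Filter Topology VectorField

variable {E : Type*} [NormedAddCommGroup E] [NormedSpace ℝ E] [FiniteDimensional ℝ E]
  {M : Type*} [TopologicalSpace M] [ChartedSpace E M] [IsManifold 𝓘(ℝ, E) ∞ M]
  {S : AffineSpecialKahler E M} {𝒥 : AlmostSpecialJoyce S} {V₀ V : TangentBundle 𝓘(ℝ, E) M}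

section ChartMaps

variable (hV : V.proj ∈ (chartAt E V₀.proj).source)
include hV

omit [FiniteDimensional ℝ E] in
theorem extChartAt_tangent_fst : (extChartAt (𝓘(ℝ, E)).tangent V₀ V).1 =
    extChartAt 𝓘(ℝ, E) V₀.proj V.proj := by
  rw [extChartAt_tangent hV]

theorem contDiffAt_reChart [T2Space M] :
    ContDiffAt ℝ ∞ (𝒥.reChart V₀) (extChartAt (𝓘(ℝ, E)).tangent V₀ V) := by
  have h := contDiffAt_chartFun hV 𝒥.contMDiff_potential
  rw [extChartAt_tangent hV] at h ⊢
  exact contDiffAt_connRe (AffineSpecialKahler.contDiffAt_formChart hV)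
    (AffineSpecialKahler.isInvertible_formChart_flip hV)
    (AffineSpecialKahler.contDiffAt_christoffelChart hV)
    (AffineSpecialKahler.contDiffAt_cxChart hV) h

theorem contDiffAt_imChart :
    ContDiffAt ℝ ∞ (𝒥.imChart V₀) (extChartAt (𝓘(ℝ, E)).tangent V₀ V) := by
  have h := contDiffAt_chartFun hV 𝒥.contMDiff_potential
  rw [extChartAt_tangent hV] at h ⊢
  exact contDiffAt_connIm (AffineSpecialKahler.contDiffAt_formChart hV)
    (AffineSpecialKahler.isInvertible_formChart_flip hV)
    (AffineSpecialKahler.contDiffAt_cxChart hV) h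

theorem contDiffAt_formChart_fst : ContDiffAt ℝ ∞ (S.formChart V₀.proj)
    (extChartAt (𝓘(ℝ, E)).tangent V₀ V).1 := by
  rw [extChartAt_tangent_fst hV]
  exact AffineSpecialKahler.contDiffAt_formChart hV

theorem contDiffAt_cxChart_fst : ContDiffAt ℝ ∞ (fun z : E × E => S.cxChart V₀.proj z.1)
    (extChartAt (𝓘(ℝ, E)).tangent V₀ V) := by
  refine ContDiffAt.comp (g := S.cxChart V₀.proj) _ ?_ contDiffAt_fst
  rw [extChartAt_tangent_fst hV]
  exact AffineSpecialKahler.contDiffAt_cxChart hV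

-- Invertibility is needed on a whole neighbourhood, because `fibreHam_symplectic` differentiates
-- the defining equation of the Hamiltonian field.
omit hV in
variable (S) in
theorem eventually_isInvertible (V₀ : TangentBundle 𝓘(ℝ, E) M) :
    ∀ᶠ z in 𝓝 (extChartAt (𝓘(ℝ, E)).tangent V₀ V₀),
      (S.formChart V₀.proj z.1).flip.IsInvertible := by
  have h1 : ∀ᶠ x in 𝓝 (extChartAt (𝓘(ℝ, E)).tangent V₀ V₀).1,
      (S.formChart V₀.proj x).flip.IsInvertible := by
    rw [extChartAt_tangent_fst (mem_chart_source E V₀.proj)]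
    filter_upwards [extChartAt_target_mem_nhds (I := 𝓘(ℝ, E)) V₀.proj] with x hx
    rw [← (extChartAt 𝓘(ℝ, E) V₀.proj).right_inv hx]
    refine AffineSpecialKahler.isInvertible_formChart_flip ?_
    rw [← extChartAt_source 𝓘(ℝ, E)]
    exact (extChartAt 𝓘(ℝ, E) V₀.proj).map_target hx
  exact continuous_fst.continuousAt.eventually h1

theorem chartDeriv_split [T2Space M] (w w' : TangentSpace 𝓘(ℝ, E) V.proj) :
    chartDeriv (𝓘(ℝ, E)).tangent V₀ V (𝒥.split V (w, w')) =
      (chartDeriv 𝓘(ℝ, E) V₀.proj V.proj w,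
        𝒥.reChart V₀ (extChartAt (𝓘(ℝ, E)).tangent V₀ V) (chartDeriv 𝓘(ℝ, E) V₀.proj V.proj w)
        + 𝒥.imChart V₀ (extChartAt (𝓘(ℝ, E)).tangent V₀ V)
          (chartDeriv 𝓘(ℝ, E) V₀.proj V.proj w')) := by
  rw [split_apply, map_add, chartDeriv_realH 𝒥 hV, chartDeriv_realV 𝒥 hV]
  exact Prod.ext (add_zero _) rfl

theorem sigma_eq_formChart (w u : TangentSpace 𝓘(ℝ, E) V.proj) :
    𝒥.sigma V w u = -(1 / (4 * Real.pi ^ 2)) *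
      S.formChart V₀.proj (extChartAt (𝓘(ℝ, E)).tangent V₀ V).1
        (𝒥.imChart V₀ (extChartAt (𝓘(ℝ, E)).tangent V₀ V) (chartDeriv 𝓘(ℝ, E) V₀.proj V.proj w))
        (𝒥.imChart V₀ (extChartAt (𝓘(ℝ, E)).tangent V₀ V)
          (chartDeriv 𝓘(ℝ, E) V₀.proj V.proj u)) := by
  rw [sigma_apply, vertForm_eq_formChart hV, chartDeriv_realV 𝒥 hV, chartDeriv_realV 𝒥 hV]

end ChartMaps

/-! ### Complex connections in the chart and the equations of zero curvature. -/

/-- The connection `R + i N` in the chart at `V₀`, where `N` is a family of vertical vectors. -/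
structure IsChartConnection (𝒥 : AlmostSpecialJoyce S) (V₀ : TangentBundle 𝓘(ℝ, E) M) (ζ : ℂ)
    (n : E × E → E →L[ℝ] E) : Prop where
  contDiffAt : ∀ V : TangentBundle 𝓘(ℝ, E) M, V.proj ∈ (chartAt E V₀.proj).source →
    ContDiffAt ℝ ∞ n (extChartAt (𝓘(ℝ, E)).tangent V₀ V)
  exists_vert : ∃ N : ∀ V : TangentBundle 𝓘(ℝ, E) M, TangentSpace 𝓘(ℝ, E) V.proj →ₗ[ℝ] vert V,
    (∀ V w, 𝒥.connection ζ V ((1 : ℂ) ⊗ₜ[ℝ] w) =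
      mkC (𝒥.realH V w) (N V w : TangentSpace (𝓘(ℝ, E)).tangent V)) ∧
    ∀ V : TangentBundle 𝓘(ℝ, E) M, V.proj ∈ (chartAt E V₀.proj).source → ∀ w,
      chartDeriv (𝓘(ℝ, E)).tangent V₀ V (N V w : TangentSpace (𝓘(ℝ, E)).tangent V) =
        (0, n (extChartAt (𝓘(ℝ, E)).tangent V₀ V) (chartDeriv 𝓘(ℝ, E) V₀.proj V.proj w))

theorem isChartConnection_I : IsChartConnection 𝒥 V₀ Complex.I (𝒥.imChart V₀) :=
  ⟨fun _ hV => contDiffAt_imChart hV, 𝒥.realV, 𝒥.connection_I,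
    fun _ hV w => chartDeriv_realV 𝒥 hV w⟩

theorem isChartConnection_one : IsChartConnection 𝒥 V₀ 1
    (fun z => (𝒥.imChart V₀ z).comp (S.cxChart V₀.proj z.1)) :=
  ⟨fun _ hV => (contDiffAt_imChart hV).clm_comp (contDiffAt_cxChart_fst hV),
    fun V => 𝒥.realV V ∘ₗ S.cx V.proj, 𝒥.connection_one, fun V hV w => by
      rw [LinearMap.comp_apply, chartDeriv_realV 𝒥 hV, AffineSpecialKahler.chartDeriv_cx hV,
        ← extChartAt_tangent_fst hV]
      rfl⟩

/-- In a chart, involutivity of a connection means that it is flat. -/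
theorem IsChartConnection.flat [T2Space M] {ζ : ℂ} {n : E × E → E →L[ℝ] E}
    (h : IsChartConnection 𝒥 V₀ ζ n)
    (hinv : IsInvolutive (𝓘(ℝ, E)).tangent (fun V => LinearMap.range (𝒥.connection ζ V)))
    (w w' : E) :
    let z := extChartAt (𝓘(ℝ, E)).tangent V₀ V₀
    let r := 𝒥.reChart V₀
    fderiv ℝ r z (w, r z w) w' - fderiv ℝ r z (w', r z w') w
        = fderiv ℝ n z (0, n z w) w' - fderiv ℝ n z (0, n z w') w ∧
      fderiv ℝ n z (w, r z w) w' - fderiv ℝ r z (0, n z w') w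
        + fderiv ℝ r z (0, n z w) w' - fderiv ℝ n z (w', r z w') w = 0 := by
  intro z r
  obtain ⟨hn, N, hN, hNn⟩ := h
  let U : Set (TangentBundle 𝓘(ℝ, E) M) := (chartAt (ModelProd E E) V₀).source
  have hU : ∀ V ∈ U, V.proj ∈ (chartAt E V₀.proj).source := fun V hV =>
    (TangentBundle.mem_chart_source_iff V V₀).1 hV
  have hUo : IsOpen U := (chartAt (ModelProd E E) V₀).open_source
  have h0 : V₀ ∈ U := mem_chart_source _ V₀
  let R : E → ∀ V : TangentBundle 𝓘(ℝ, E) M, TangentSpace (𝓘(ℝ, E)).tangent V :=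
    fun w V => 𝒥.realH V (constField V₀.proj w V.proj)
  let Q : E → ∀ V : TangentBundle 𝓘(ℝ, E) M, TangentSpace (𝓘(ℝ, E)).tangent V :=
    fun w V => (N V (constField V₀.proj w V.proj) : TangentSpace (𝓘(ℝ, E)).tangent V)
  have hR : ∀ w, ∀ V ∈ U, chartDeriv (𝓘(ℝ, E)).tangent V₀ V (R w V) =
      (w, r (extChartAt (𝓘(ℝ, E)).tangent V₀ V) w) := fun w V hV => by
    have h1 := chartDeriv_realH 𝒥 (hU V hV) (constField V₀.proj w V.proj)
    rwa [constField, chartDeriv_symm (hU V hV)] at h1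
  have hQ : ∀ w, ∀ V ∈ U, chartDeriv (𝓘(ℝ, E)).tangent V₀ V (Q w V) =
      (0, n (extChartAt (𝓘(ℝ, E)).tangent V₀ V) w) := fun w V hV => by
    have h1 := hNn V (hU V hV) (constField V₀.proj w V.proj)
    rwa [constField, chartDeriv_symm (hU V hV)] at h1
  have smooth : ∀ (A : ∀ V : TangentBundle 𝓘(ℝ, E) M, TangentSpace (𝓘(ℝ, E)).tangent V)
      (f : E × E → E × E), (∀ V ∈ U, chartDeriv (𝓘(ℝ, E)).tangent V₀ V (A V) =
        f (extChartAt (𝓘(ℝ, E)).tangent V₀ V)) →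
      (∀ V ∈ U, ContDiffAt ℝ ∞ f (extChartAt (𝓘(ℝ, E)).tangent V₀ V)) →
      SmoothField (𝓘(ℝ, E)).tangent U A := fun A f hA hf =>
    smoothField_of_contMDiffAt fun V hV => ⟨V₀, hV, contMDiffAt_of_contDiffAt hV (hf V hV)
      (by filter_upwards [hUo.mem_nhds hV] with W hW using hA W hW)⟩
  have chart : ∀ (A : ∀ V : TangentBundle 𝓘(ℝ, E) M, TangentSpace (𝓘(ℝ, E)).tangent V)
      (f : E × E → E × E), (∀ V ∈ U, chartDeriv (𝓘(ℝ, E)).tangent V₀ V (A V) =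
        f (extChartAt (𝓘(ℝ, E)).tangent V₀ V)) →
      chartField (𝓘(ℝ, E)).tangent V₀ A =ᶠ[𝓝 z] f := fun A f hA => by
    filter_upwards [extChartAt_target_mem_nhds (I := (𝓘(ℝ, E)).tangent) V₀] with x hx
    have h1 := hA _ (by
      have := (extChartAt (𝓘(ℝ, E)).tangent V₀).map_target hx
      rwa [extChartAt_source] at this)
    rwa [(extChartAt (𝓘(ℝ, E)).tangent V₀).right_inv hx] at h1
  have dr := (contDiffAt_reChart (𝒥 := 𝒥) (mem_chart_source E V₀.proj)).differentiableAt
    (by simp)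
  have dn := (hn V₀ (mem_chart_source E V₀.proj)).differentiableAt (by simp)
  have smoothR : ∀ w, SmoothField (𝓘(ℝ, E)).tangent U (R w) := fun w =>
    smooth _ _ (hR w) fun V hV => contDiffAt_const.prodMk
      ((contDiffAt_reChart (hU V hV)).clm_apply contDiffAt_const)
  have smoothQ : ∀ w, SmoothField (𝓘(ℝ, E)).tangent U (Q w) := fun w =>
    smooth _ _ (hQ w) fun V hV => contDiffAt_const.prodMk
      ((hn V (hU V hV)).clm_apply contDiffAt_const)
  have mem : ∀ w, ∀ V, mkC (R w V) (Q w V) ∈ LinearMap.range (𝒥.connection ζ V) := fun w V =>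
    ⟨_, hN V (constField V₀.proj w V.proj)⟩
  have key := hinv U (fun V => mkC (R w V) (Q w V)) (fun V => mkC (R w' V) (Q w' V)) hUo
    ⟨by simpa only [rePart_mkC] using smoothR w, by simpa only [imPart_mkC] using smoothQ w⟩
    ⟨by simpa only [rePart_mkC] using smoothR w', by simpa only [imPart_mkC] using smoothQ w'⟩
    (fun V _ => mem w V) (fun V _ => mem w' V) V₀ h0
  simp only [complexBracket, rePart_mkC, imPart_mkC] at key
  have b₁ := (mlieBracket_eq_lieBracket (I := (𝓘(ℝ, E)).tangent) (p := V₀) (R w) (R w')).trans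
    (lieBracket_of_eventuallyEq dr dr (chart _ _ (hR w)) (chart _ _ (hR w')))
  have b₂ := (mlieBracket_eq_lieBracket (I := (𝓘(ℝ, E)).tangent) (p := V₀) (Q w) (Q w')).trans
    (lieBracket_of_eventuallyEq dn dn (chart _ _ (hQ w)) (chart _ _ (hQ w')))
  have b₃ := (mlieBracket_eq_lieBracket (I := (𝓘(ℝ, E)).tangent) (p := V₀) (R w) (Q w')).trans
    (lieBracket_of_eventuallyEq dr dn (chart _ _ (hR w)) (chart _ _ (hQ w')))
  have b₄ := (mlieBracket_eq_lieBracket (I := (𝓘(ℝ, E)).tangent) (p := V₀) (Q w) (R w')).trans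
    (lieBracket_of_eventuallyEq dn dr (chart _ _ (hQ w)) (chart _ _ (hR w')))
  have hproj : ∀ a : TangentSpace (𝓘(ℝ, E)).tangent V₀, (show E × E from a).1 = dproj V₀ a :=
    fun a => by
      have h1 := chartDeriv_tangent_fst (V₀ := V₀) (mem_chart_source E V₀.proj) a
      rwa [chartDeriv_self, chartDeriv_self] at h1
  -- The connection is a right inverse of dπ, so its image contains no nonzero vertical vector. The
  -- bracket of lifts of constant vectors is vertical and, by involutivity, lies in the image; hence
  -- it vanishes, and its real and imaginary parts are the two equations.
  have hzero : ∀ a b : TangentSpace (𝓘(ℝ, E)).tangent V₀,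
      mkC a b ∈ LinearMap.range (𝒥.connection ζ V₀) → dproj V₀ a = 0 → dproj V₀ b = 0 →
      a = 0 ∧ b = 0 := by
    rintro a b ⟨x, hx⟩ ha hb
    have hx' : x = (1 : ℂ) ⊗ₜ[ℝ] rePart x + Complex.I • ((1 : ℂ) ⊗ₜ[ℝ] imPart x) := by
      conv_lhs => rw [← mkC_rePart_imPart x]
      simp [mkC, TensorProduct.smul_tmul']
    rw [hx', map_add, map_smul, hN, hN, smul_mkC, mkC_add] at hx
    have h1 := congrArg rePart hx
    have h2 := congrArg imPart hx
    simp only [rePart_mkC, imPart_mkC, Complex.I_re, Complex.I_im, zero_smul, one_smul, zero_sub,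
      add_zero] at h1 h2
    have hd : ∀ u : vert V₀, dproj V₀ u = 0 := fun u => u.2
    have h3 := congrArg (dproj V₀) h1
    have h4 := congrArg (dproj V₀) h2
    rw [map_add, map_neg, hd, dproj_realH, ha, neg_zero, add_zero] at h3
    rw [map_add, hd, dproj_realH, hb, zero_add] at h4
    rw [h3, h4] at h1 h2
    simp only [map_zero, Submodule.coe_zero, neg_zero, add_zero] at h1 h2
    exact ⟨h1.symm, h2.symm⟩
  rw [b₁, b₂, b₃, b₄] at key
  obtain ⟨h1, h2⟩ := hzero _ _ key ((hproj _).symm.trans (sub_self _))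
    ((hproj _).symm.trans (add_zero _))
  refine ⟨sub_eq_zero.1 (congrArg Prod.snd h1), ?_⟩
  exact (add_sub_assoc _ _ _).trans (congrArg Prod.snd h2)

end AlmostSpecialJoyce

/-! ### The pseudo-hyperkähler structure -/

namespace AlmostSpecialJoyce

open Filter Topology

variable {E : Type*} [NormedAddCommGroup E] [NormedSpace ℝ E] [FiniteDimensional ℝ E]
  {M : Type*} [TopologicalSpace M] [T2Space M] [ChartedSpace E M] [IsManifold 𝓘(ℝ, E) ∞ M]
  {S : AffineSpecialKahler E M} {𝒥 : AlmostSpecialJoyce S} {V₀ V : TangentBundle 𝓘(ℝ, E) M}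

omit [FiniteDimensional ℝ E] [T2Space M] in
theorem extChartAt_tangent_self (V₀ : TangentBundle 𝓘(ℝ, E) M) :
    (extChartAt (𝓘(ℝ, E)).tangent V₀ V₀).1 = extChartAt 𝓘(ℝ, E) V₀.proj V₀.proj :=
  extChartAt_tangent_fst (mem_chart_source E V₀.proj)

omit [T2Space M] in
theorem formChart_skew_self (v v' : E) :
    S.formChart V₀.proj (extChartAt (𝓘(ℝ, E)).tangent V₀ V₀).1 v v' =
      -S.formChart V₀.proj (extChartAt (𝓘(ℝ, E)).tangent V₀ V₀).1 v' v := by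
  rw [extChartAt_tangent_self]
  exact AffineSpecialKahler.formChart_skew (mem_chart_source E V₀.proj) v v'

theorem reChart_symplectic (w v v' : E) :
    let z := extChartAt (𝓘(ℝ, E)).tangent V₀ V₀
    fderiv ℝ (S.formChart V₀.proj) z.1 w v v'
      + S.formChart V₀.proj z.1 (fderiv ℝ (𝒥.reChart V₀) z (0, v) w) v'
      + S.formChart V₀.proj z.1 v (fderiv ℝ (𝒥.reChart V₀) z (0, v') w) = 0 := by
  have h0 := mem_chart_source E V₀.proj
  have h1 := AffineSpecialKahler.contDiffAt_christoffelChart (S := S) h0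
  have h2 := AffineSpecialKahler.contDiffAt_cxChart (S := S) h0
  have h3 := AffineSpecialKahler.fderiv_formChart (S := S) h0
  rw [← extChartAt_tangent_self] at h1 h2 h3
  exact connRe_symplectic (contDiffAt_formChart_fst h0) (eventually_isInvertible S V₀) h1 h2
    (contDiffAt_chartFun h0 𝒥.contMDiff_potential) formChart_skew_self h3 w v v'

omit [T2Space M] in
theorem imChart_symplectic (w v v' : E) :
    let z := extChartAt (𝓘(ℝ, E)).tangent V₀ V₀
    S.formChart V₀.proj z.1 (fderiv ℝ (𝒥.imChart V₀) z (0, v) w) v'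
      + S.formChart V₀.proj z.1 v (fderiv ℝ (𝒥.imChart V₀) z (0, v') w) = 0 := by
  have h0 := mem_chart_source E V₀.proj
  have h2 := AffineSpecialKahler.contDiffAt_cxChart (S := S) h0
  rw [← extChartAt_tangent_fst h0] at h2
  refine connIm_symplectic (contDiffAt_formChart_fst h0) (eventually_isInvertible S V₀) h2
    (contDiffAt_chartFun h0 𝒥.contMDiff_potential) (fun v v' => ?_) w v v'
  rw [extChartAt_tangent_fst h0]
  exact AffineSpecialKahler.formChart_skew h0 v v'

/-- A flat chart connection whose parallel transport is symplectic gives two closed forms. -/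
theorem IsChartConnection.extDerivTwo_eq_zero {ζ : ℂ} {n : E × E → E →L[ℝ] E}
    (h : IsChartConnection 𝒥 V₀ ζ n)
    (hinv : IsInvolutive (𝓘(ℝ, E)).tangent (fun V => LinearMap.range (𝒥.connection ζ V)))
    (hM : ∀ w v v', S.formChart V₀.proj (extChartAt (𝓘(ℝ, E)).tangent V₀ V₀).1
        (fderiv ℝ n (extChartAt (𝓘(ℝ, E)).tangent V₀ V₀) (0, v) w) v'
      + S.formChart V₀.proj (extChartAt (𝓘(ℝ, E)).tangent V₀ V₀).1 v
        (fderiv ℝ n (extChartAt (𝓘(ℝ, E)).tangent V₀ V₀) (0, v') w) = 0) (a b c : E × E) :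
    extDerivTwo (connFormRe (S.formChart V₀.proj) (𝒥.reChart V₀) n)
        (extChartAt (𝓘(ℝ, E)).tangent V₀ V₀) a b c = 0 ∧
      extDerivTwo (connFormIm (S.formChart V₀.proj) (𝒥.reChart V₀) n)
        (extChartAt (𝓘(ℝ, E)).tangent V₀ V₀) a b c = 0 := by
  have h0 := mem_chart_source E V₀.proj
  have hΩ := contDiffAt_formChart_fst (S := S) (V₀ := V₀) h0
  have hr := contDiffAt_reChart (𝒥 := 𝒥) (V₀ := V₀) h0
  have hn := h.contDiffAt V₀ h0
  exact extDerivTwo_connForm (hΩ.differentiableAt (by simp)) (hr.differentiableAt (by simp))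
    (hn.differentiableAt (by simp))
    ((contDiffAt_connFormRe hΩ hr hn).differentiableAt (by simp))
    ((contDiffAt_connFormIm hΩ hr hn).differentiableAt (by simp)) formChart_skew_self
    (reChart_symplectic (𝒥 := 𝒥)) hM (fun w w' => (h.flat hinv w w').1)
    (fun w w' => (h.flat hinv w w').2) a b c

-- It suffices to compare the form with a constant multiple of a local form on vectors written in
-- the splitting, and to check closedness at the centre of each chart.
omit [T2Space M] in
theorem isClosedTwoForm_of_chartForm {b : ∀ V : TangentBundle 𝓘(ℝ, E) M,
      LinearMap.BilinForm ℝ (TangentSpace (𝓘(ℝ, E)).tangent V)} (alt : ∀ V, (b V).IsAlt) {k : ℝ}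
    (h : ∀ V₀ : TangentBundle 𝓘(ℝ, E) M, ∃ β : E × E → E × E →L[ℝ] E × E →L[ℝ] ℝ,
      ContDiffAt ℝ ∞ β (extChartAt (𝓘(ℝ, E)).tangent V₀ V₀) ∧
      (∀ a c d, extDerivTwo β (extChartAt (𝓘(ℝ, E)).tangent V₀ V₀) a c d = 0) ∧
      ∀ V : TangentBundle 𝓘(ℝ, E) M, V.proj ∈ (chartAt E V₀.proj).source → ∀ w w' u u',
        b V (𝒥.split V (w, w')) (𝒥.split V (u, u')) =
          k * β (extChartAt (𝓘(ℝ, E)).tangent V₀ V)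
            (chartDeriv (𝓘(ℝ, E)).tangent V₀ V (𝒥.split V (w, w')))
            (chartDeriv (𝓘(ℝ, E)).tangent V₀ V (𝒥.split V (u, u')))) :
    IsClosedTwoForm (𝓘(ℝ, E)).tangent b := by
  refine isClosedTwoForm_of_charts alt fun V₀ => ?_
  obtain ⟨β, h1, h2, h3⟩ := h V₀
  refine ⟨fun z => k • β z, contDiffAt_clm_of_apply fun a => contDiffAt_clm_of_apply fun c =>
    contDiffAt_const.mul ((h1.clm_apply contDiffAt_const).clm_apply contDiffAt_const),
    ?_, fun a c d => ?_⟩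
  · filter_upwards [(chartAt (ModelProd E E) V₀).open_source.mem_nhds (mem_chart_source _ V₀)]
      with V hV a c
    obtain ⟨⟨w, w'⟩, rfl⟩ := (𝒥.split V).surjective a
    obtain ⟨⟨u, u'⟩, rfl⟩ := (𝒥.split V).surjective c
    exact h3 V ((TangentBundle.mem_chart_source_iff V V₀).1 hV) w w' u u'
  · rw [extDerivTwo_const_smul (h1.differentiableAt (by simp)), h2, mul_zero]

/-! ### Closedness of ω₁, ω₂ and ω₃. -/

variable (h𝒥 : 𝒥.IsSpecialJoyce)
include h𝒥

/-- Modulo the connection 𝒜^i the vector R_w + V_{w'} is the vertical vector V_{w'} - i V_w.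
Inserting this into -ω^ν/(4π²) gives ω₃ as the real part and -ω₂ as the imaginary part. -/
theorem IsSpecialJoyce.isClosed_omegaThree :
    IsClosedTwoForm (𝓘(ℝ, E)).tangent 𝒥.omegaThree := by
  refine isClosedTwoForm_of_chartForm 𝒥.omegaThree_alt (𝒥 := 𝒥)
    (k := -(1 / (4 * Real.pi ^ 2))) fun V₀ => ?_
  have h0 := mem_chart_source E V₀.proj
  refine ⟨_, contDiffAt_connFormRe (contDiffAt_formChart_fst h0)
    (contDiffAt_reChart (𝒥 := 𝒥) h0) (contDiffAt_imChart (𝒥 := 𝒥) h0),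
    fun a c d => (isChartConnection_I.extDerivTwo_eq_zero (h𝒥.flat _ Complex.I_ne_zero)
      imChart_symplectic a c d).1, fun V hV w w' u u' => ?_⟩
  rw [omegaThree_split, sigma_eq_formChart hV, sigma_eq_formChart hV, chartDeriv_split hV,
    chartDeriv_split hV, connFormRe_apply, add_sub_cancel_left, add_sub_cancel_left]
  ring

theorem IsSpecialJoyce.isClosed_omegaTwo :
    IsClosedTwoForm (𝓘(ℝ, E)).tangent (fun V => (𝒥.metric V).compLeft (𝒥.I₂ V)) := by
  refine isClosedTwoForm_of_chartForm
    (fun V => h𝒥.metric_skew V (I₂_sq V) (h𝒥.metric_I₂ V)) (𝒥 := 𝒥)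
    (k := 1 / (4 * Real.pi ^ 2)) fun V₀ => ?_
  have h0 := mem_chart_source E V₀.proj
  refine ⟨_, contDiffAt_connFormIm (contDiffAt_formChart_fst h0)
    (contDiffAt_reChart (𝒥 := 𝒥) h0) (contDiffAt_imChart (𝒥 := 𝒥) h0),
    fun a c d => (isChartConnection_I.extDerivTwo_eq_zero (h𝒥.flat _ Complex.I_ne_zero)
      imChart_symplectic a c d).2, fun V hV w w' u u' => ?_⟩
  rw [h𝒥.omegaTwo_split, sigma_eq_formChart hV, sigma_eq_formChart hV, chartDeriv_split hV,
    chartDeriv_split hV, connFormIm_apply, add_sub_cancel_left, add_sub_cancel_left]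
  ring

/-- For ζ = 1 the vertical part is V_{w'} - i V_{Iw}, and the imaginary part of -Ξ/(4π²) is -ω₁ by
the invariance of σ. -/
theorem IsSpecialJoyce.isClosed_omegaOne :
    IsClosedTwoForm (𝓘(ℝ, E)).tangent (fun V => (𝒥.metric V).compLeft (𝒥.I₁ V)) := by
  refine isClosedTwoForm_of_chartForm
    (fun V => h𝒥.metric_skew V (I₁_sq V) (metric_I₁ V)) (𝒥 := 𝒥)
    (k := 1 / (4 * Real.pi ^ 2)) fun V₀ => ?_
  have h0 := mem_chart_source E V₀.proj
  -- The complex structure of M depends on the base point alone, so along the fibre the derivative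
  -- of V_{Iw} is that of V with Iw held fixed.
  have hsymp : ∀ w v v' : E, S.formChart V₀.proj (extChartAt (𝓘(ℝ, E)).tangent V₀ V₀).1
      (fderiv ℝ (fun z => (𝒥.imChart V₀ z).comp (S.cxChart V₀.proj z.1))
        (extChartAt (𝓘(ℝ, E)).tangent V₀ V₀) (0, v) w) v'
      + S.formChart V₀.proj (extChartAt (𝓘(ℝ, E)).tangent V₀ V₀).1 v
      (fderiv ℝ (fun z => (𝒥.imChart V₀ z).comp (S.cxChart V₀.proj z.1))
        (extChartAt (𝓘(ℝ, E)).tangent V₀ V₀) (0, v') w) = 0 := fun w v v' => by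
    have h1 : DifferentiableAt ℝ (S.cxChart V₀.proj)
        (extChartAt (𝓘(ℝ, E)).tangent V₀ V₀).1 := by
      rw [extChartAt_tangent_self]
      exact (AffineSpecialKahler.contDiffAt_cxChart h0).differentiableAt (by simp)
    have h2 := (contDiffAt_imChart (𝒥 := 𝒥) (V₀ := V₀) h0).differentiableAt (by simp)
    have h3 := h2.hasFDerivAt.clm_comp (hasFDerivAt_comp_fst (G := E →L[ℝ] E) h1)
    have h4 : ∀ v, fderiv ℝ (fun z => (𝒥.imChart V₀ z).comp (S.cxChart V₀.proj z.1))
        (extChartAt (𝓘(ℝ, E)).tangent V₀ V₀) (0, v) w =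
        fderiv ℝ (𝒥.imChart V₀) (extChartAt (𝓘(ℝ, E)).tangent V₀ V₀) (0, v)
          (S.cxChart V₀.proj (extChartAt (𝓘(ℝ, E)).tangent V₀ V₀).1 w) := fun v => by
      rw [h3.fderiv]
      simp only [add_apply, ContinuousLinearMap.comp_apply, ContinuousLinearMap.compL_apply,
        ContinuousLinearMap.flip_apply, ContinuousLinearMap.coe_fst', map_zero,
        zero_add]
    rw [h4, h4]
    exact imChart_symplectic _ v v'
  refine ⟨_, contDiffAt_connFormIm (contDiffAt_formChart_fst h0)
    (contDiffAt_reChart (𝒥 := 𝒥) h0) (isChartConnection_one.contDiffAt V₀ h0),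
    fun a c d => (isChartConnection_one.extDerivTwo_eq_zero (h𝒥.flat _ one_ne_zero)
      hsymp a c d).2, fun V hV w w' u u' => ?_⟩
  rw [omegaOne_split, h𝒥.sigma_cx_right V w u', sigma_eq_formChart hV, sigma_eq_formChart hV,
    chartDeriv_split hV, chartDeriv_split hV, connFormIm_apply, add_sub_cancel_left,
    add_sub_cancel_left, AffineSpecialKahler.chartDeriv_cx hV,
    AffineSpecialKahler.chartDeriv_cx hV, ← extChartAt_tangent_fst hV]
  simp only [ContinuousLinearMap.comp_apply]
  ring

/-! ### Smoothness of the splitting and of I₁, I₂, I₃. -/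

omit h𝒥

variable (𝒥 V₀) in
/-- The splitting of `TN` in the chart at `V₀`. -/
def splitChart (z : E × E) : E × E →L[ℝ] E × E :=
  (ContinuousLinearMap.fst ℝ E E).prod ((𝒥.reChart V₀ z).coprod (𝒥.imChart V₀ z))

theorem contDiffAt_splitChart (hV : V.proj ∈ (chartAt E V₀.proj).source) :
    ContDiffAt ℝ ∞ (𝒥.splitChart V₀) (extChartAt (𝓘(ℝ, E)).tangent V₀ V) :=
  contDiffAt_clm_of_apply fun _ => contDiffAt_const.prodMk
    (((contDiffAt_reChart hV).clm_apply contDiffAt_const).add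
      ((contDiffAt_imChart hV).clm_apply contDiffAt_const))

theorem chartDeriv_split_eq (hV : V.proj ∈ (chartAt E V₀.proj).source)
    (w w' : TangentSpace 𝓘(ℝ, E) V.proj) :
    chartDeriv (𝓘(ℝ, E)).tangent V₀ V (𝒥.split V (w, w')) =
      𝒥.splitChart V₀ (extChartAt (𝓘(ℝ, E)).tangent V₀ V)
        (chartDeriv 𝓘(ℝ, E) V₀.proj V.proj w, chartDeriv 𝓘(ℝ, E) V₀.proj V.proj w') :=
  chartDeriv_split hV w w'

theorem isInvertible_splitChart (hV : V.proj ∈ (chartAt E V₀.proj).source) :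
    (𝒥.splitChart V₀ (extChartAt (𝓘(ℝ, E)).tangent V₀ V)).IsInvertible := by
  have hinj : Function.Injective (𝒥.splitChart V₀ (extChartAt (𝓘(ℝ, E)).tangent V₀ V)) := by
    rw [injective_iff_map_eq_zero]
    rintro ⟨a, a'⟩ ha
    have h1 := chartDeriv_split_eq (𝒥 := 𝒥) hV (chartDerivSymm 𝓘(ℝ, E) V₀.proj V.proj a)
      (chartDerivSymm 𝓘(ℝ, E) V₀.proj V.proj a')
    rw [chartDeriv_symm hV, chartDeriv_symm hV, ha] at h1
    have h2 := congrArg (chartDerivSymm (𝓘(ℝ, E)).tangent V₀ V) h1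
    rw [chartDerivSymm_deriv (tangent_mem_source hV), map_zero] at h2
    have h3 := (𝒥.split V).map_eq_zero_iff.1 h2
    have h4 := congrArg (chartDeriv 𝓘(ℝ, E) V₀.proj V.proj) (congrArg Prod.fst h3)
    have h5 := congrArg (chartDeriv 𝓘(ℝ, E) V₀.proj V.proj) (congrArg Prod.snd h3)
    rw [chartDeriv_symm hV] at h4 h5
    exact Prod.ext (h4.trans (map_zero _)) (h5.trans (map_zero _))
  exact ⟨(LinearEquiv.ofInjectiveEndo _ hinj).toContinuousLinearEquiv, rfl⟩

/-- An endomorphism of `TN` which is given in terms of the splitting by a smooth endomorphism of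
two copies of `TM` is smooth. -/
theorem smoothEndo_of_split {K : ∀ V : TangentBundle 𝓘(ℝ, E) M,
      TangentSpace (𝓘(ℝ, E)).tangent V →ₗ[ℝ] TangentSpace (𝓘(ℝ, E)).tangent V}
    (h : ∀ V₀ : TangentBundle 𝓘(ℝ, E) M, ∃ L : E × E → E × E →L[ℝ] E × E,
      ContDiffAt ℝ ∞ L (extChartAt (𝓘(ℝ, E)).tangent V₀ V₀) ∧
      ∀ V : TangentBundle 𝓘(ℝ, E) M, V.proj ∈ (chartAt E V₀.proj).source → ∀ w w',
        chartDeriv (𝓘(ℝ, E)).tangent V₀ V (K V (𝒥.split V (w, w'))) =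
          𝒥.splitChart V₀ (extChartAt (𝓘(ℝ, E)).tangent V₀ V)
            (L (extChartAt (𝓘(ℝ, E)).tangent V₀ V) (chartDeriv 𝓘(ℝ, E) V₀.proj V.proj w,
              chartDeriv 𝓘(ℝ, E) V₀.proj V.proj w'))) :
    SmoothEndo (𝓘(ℝ, E)).tangent K := by
  refine smoothEndo_of_charts fun V₀ => ?_
  obtain ⟨L, h1, h2⟩ := h V₀
  have h0 := mem_chart_source E V₀.proj
  have hP := contDiffAt_splitChart (𝒥 := 𝒥) (V₀ := V₀) h0
  have hinv : ContDiffAt ℝ ∞ (fun z => (𝒥.splitChart V₀ z).inverse)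
      (extChartAt (𝓘(ℝ, E)).tangent V₀ V₀) := by
    have : CompleteSpace E := FiniteDimensional.complete ℝ E
    refine ContDiffAt.comp (g := ContinuousLinearMap.inverse) _ ?_ hP
    obtain ⟨e, he⟩ := isInvertible_splitChart (𝒥 := 𝒥) (V₀ := V₀) h0
    rw [← he]
    exact contDiffAt_map_inverse e
  refine ⟨fun z => (𝒥.splitChart V₀ z).comp ((L z).comp (𝒥.splitChart V₀ z).inverse),
    hP.clm_comp (h1.clm_comp hinv), ?_⟩
  filter_upwards [(chartAt (ModelProd E E) V₀).open_source.mem_nhds (mem_chart_source _ V₀)]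
    with V hV a
  obtain ⟨⟨w, w'⟩, rfl⟩ := (𝒥.split V).surjective a
  have hV' := (TangentBundle.mem_chart_source_iff V V₀).1 hV
  rw [h2 V hV', chartDeriv_split_eq hV', ContinuousLinearMap.comp_apply,
    ContinuousLinearMap.comp_apply, (isInvertible_splitChart hV').inverse_apply_self]

theorem smoothEndo_I₁ : SmoothEndo (𝓘(ℝ, E)).tangent 𝒥.I₁ := by
  refine smoothEndo_of_split (𝒥 := 𝒥) fun V₀ => ⟨fun _ =>
    (-ContinuousLinearMap.snd ℝ E E).prod (ContinuousLinearMap.fst ℝ E E), contDiffAt_const,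
    fun V hV w w' => ?_⟩
  rw [I₁_split, chartDeriv_split_eq hV, map_neg]
  rfl

theorem smoothEndo_I₂ : SmoothEndo (𝓘(ℝ, E)).tangent 𝒥.I₂ := by
  refine smoothEndo_of_split (𝒥 := 𝒥) fun V₀ => ⟨fun z =>
    (-(S.cxChart V₀.proj z.1).comp (ContinuousLinearMap.snd ℝ E E)).prod
      (-(S.cxChart V₀.proj z.1).comp (ContinuousLinearMap.fst ℝ E E)), ?_, fun V hV w w' => ?_⟩
  · have h := contDiffAt_cxChart_fst (S := S) (mem_chart_source E V₀.proj)
    exact contDiffAt_clm_of_apply fun _ => (h.clm_apply contDiffAt_const).neg.prodMk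
      (h.clm_apply contDiffAt_const).neg
  · rw [I₂_split, chartDeriv_split_eq hV, map_neg, map_neg, AffineSpecialKahler.chartDeriv_cx hV,
      AffineSpecialKahler.chartDeriv_cx hV, ← extChartAt_tangent_fst hV]
    rfl

theorem smoothEndo_I₃ : SmoothEndo (𝓘(ℝ, E)).tangent 𝒥.I₃ := by
  have h : 𝒥.I₃ = fun V => 𝒥.I₁ V ∘ₗ 𝒥.I₂ V := funext fun V =>
    LinearMap.ext fun a => (I₁_I₂ V a).symm
  rw [h]
  exact smoothEndo_I₁.comp smoothEndo_I₂

include h𝒥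

/-- Integrability uses the cyclic relations ω₃ = -ω₂(I₁-, -), ω₁ = -ω₃(I₂-, -) and ω₂ = -ω₁(I₃-, -),
each between two closed nondegenerate forms. -/
theorem IsSpecialJoyce.isPseudoHyperkahler :
    IsPseudoHyperkahler (𝓘(ℝ, E)).tangent 𝒥.metric 𝒥.I₁ 𝒥.I₂ 𝒥.I₃ := by
  have c₃ : IsClosedTwoForm (𝓘(ℝ, E)).tangent (fun V => (𝒥.metric V).compLeft (𝒥.I₃ V)) := by
    rw [funext h𝒥.omegaThree_eq]
    exact h𝒥.isClosed_omegaThree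
  refine
    { metric_smooth := h𝒥.isClosed_omegaThree.smooth.compRight smoothEndo_I₃
      metric_symm := h𝒥.metric_symm
      metric_nondegenerate := h𝒥.metric_nondegenerate
      complex₁ := isComplexStructure_of_closed smoothEndo_I₁ I₁_sq h𝒥.isClosed_omegaTwo c₃
        (fun V => h𝒥.form_nondegenerate V (I₂_sq V) (h𝒥.metric_I₂ V)) fun V a b => ?_
      complex₂ := isComplexStructure_of_closed smoothEndo_I₂ I₂_sq c₃ h𝒥.isClosed_omegaOne
        (fun V => h𝒥.form_nondegenerate V (I₃_sq V) (h𝒥.metric_I₃ V)) fun V a b => ?_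
      complex₃ := isComplexStructure_of_closed smoothEndo_I₃ I₃_sq h𝒥.isClosed_omegaOne
        h𝒥.isClosed_omegaTwo
        (fun V => h𝒥.form_nondegenerate V (I₁_sq V) (metric_I₁ V)) fun V a b => ?_
      mul_one_two := I₁_I₂
      anti_one_two := fun V a => by rw [I₁_I₂, I₂_I₁, neg_neg]
      anti_two_three := fun V a => by rw [I₂_I₃, I₃_I₂, neg_neg]
      anti_three_one := fun V a => by rw [I₃_I₁, I₁_I₃, neg_neg]
      hermitian₁ := metric_I₁
      hermitian₂ := h𝒥.metric_I₂
      hermitian₃ := h𝒥.metric_I₃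
      closed₁ := h𝒥.isClosed_omegaOne
      closed₂ := h𝒥.isClosed_omegaTwo
      closed₃ := c₃ }
  · rw [LinearMap.BilinForm.compLeft_apply, LinearMap.BilinForm.compLeft_apply, I₂_I₁, map_neg,
      LinearMap.neg_apply, neg_neg]
  · rw [LinearMap.BilinForm.compLeft_apply, LinearMap.BilinForm.compLeft_apply, I₃_I₂, map_neg,
      LinearMap.neg_apply, neg_neg]
  · rw [LinearMap.BilinForm.compLeft_apply, LinearMap.BilinForm.compLeft_apply, I₁_I₃, map_neg,
      LinearMap.neg_apply, neg_neg]

end AlmostSpecialJoyce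

end SpecialJoyce

end

theorem theorem3p1
    {E : Type*} [NormedAddCommGroup E] [NormedSpace ℝ E] [FiniteDimensional ℝ E]
    {M : Type*} [TopologicalSpace M] [T2Space M] [SigmaCompactSpace M] [ChartedSpace E M]
    [IsManifold 𝓘(ℝ, E) ∞ M]
    (S : SpecialJoyce.AffineSpecialKahler E M) (𝒥 : SpecialJoyce.AlmostSpecialJoyce S)
    (h𝒥 : 𝒥.IsSpecialJoyce) :
    ∃ ω₃ : ∀ V : TangentBundle 𝓘(ℝ, E) M,
        LinearMap.BilinForm ℝ (TangentSpace (𝓘(ℝ, E)).tangent V),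
      𝒥.IsOmegaThree ω₃ ∧
      (∀ ω' : ∀ V : TangentBundle 𝓘(ℝ, E) M,
        LinearMap.BilinForm ℝ (TangentSpace (𝓘(ℝ, E)).tangent V),
        𝒥.IsOmegaThree ω' → ω' = ω₃) ∧
      SpecialJoyce.IsClosedTwoForm (𝓘(ℝ, E)).tangent ω₃ ∧
      SpecialJoyce.IsPseudoHyperkahler (𝓘(ℝ, E)).tangent
        (fun V => (ω₃ V).compRight (𝒥.I₃ V)) 𝒥.I₁ 𝒥.I₂ 𝒥.I₃ := by
  exact ⟨𝒥.omegaThree, h𝒥.isOmegaThree, fun _ h => h𝒥.omegaThree_unique h, h𝒥.isClosed_omegaThree,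
    h𝒥.isPseudoHyperkahler⟩
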